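/- Let $d\ge 0$ be an integer and let $\gamma_d(dx)=\pi^{-d/2}e^{-|x|^2}\,dx$ be the Gaussian measure on $\mathbb R^d$. For a multi-index $\nu\in\mathbb N^d$ let $|\nu|=\sum_i\nu_i$, $\nu!=\prod_i\nu_i!$, and let $$h_\nu(x)=\frac1{(2^{|\nu|}\nu!)^{1/2}}\prod_{i=1}^d(-1)^{\nu_i}e^{x_i^2}\,\partial_i^{\nu_i}\big(e^{-x_i^2}\big)$$ be the normalized Hermite polynomials, which are eigenfunctions of $L=\frac12\Delta-\langle x,\nabla\rangle$ with $Lh_\nu=-|\nu|h_\nu$. Let $$T_tf(x)=\int_{\mathbb R^d}f\big(\sqrt{1-e^{-2t}}\,u+e^{-t}x\big)\,\gamma_d(du),\qquad P_tf(x)=\frac1{\sqrt\pi}\int_0^\infty\frac{e^{-u}}{\sqrt u}\,T_{t^2/4u}f(x)\,du$$ be the Ornstein--Uhlenbeck and Poisson--Hermite semigroups. For $\alpha\ge 0$, $1\le p,q<\infty$ and $k$ the smallest integer greater than $\alpha$, the Gaussian Triebel--Lizorkin space $F^\alpha_{p,q}(\gamma_d)$ is the set of all (real-valued) $f\in L^p(\gamma_d)$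 such that $$\|f\|_{F^\alpha_{p,q}}:=\|f\|_{L^p(\gamma_d)}+\left\|\left(\int_0^\infty\Big(t^{k-\alpha}\Big|\frac{\partial^kP_tf}{\partial t^k}\Big|\Big)^q\frac{dt}t\right)^{1/q}\right\|_{L^p(\gamma_d)}<\infty .$$ **Theorem.** Let $\beta>0$ and $1<p<\infty$. There is exactly one continuous linear operator $\mathcal J_\beta$ on $L^p(\gamma_d)$ such that $\mathcal J_\beta h_\nu=(1+\sqrt{|\nu|})^{-\beta}h_\nu$ for all $\nu$ (the Gaussian Bessel potential $\mathcal J_\beta=(I+\sqrt{-L})^{-\beta}$). For all $\alpha\ge 0$ and $1\le q<\infty$ it is bounded from $F^\alpha_{p,q}(\gamma_d)$ into $F^{\alpha+\beta}_{p,q}(\gamma_d)$: there is a constant $C$, depending only on $d,p,q,\alpha,\beta$, such that for every $f\in F^\alpha_{p,q}(\gamma_d)$ one has $\mathcal J_\beta f\in F^{\alpha+\beta}_{p,q}(\gamma_d)$ and $$\|\mathcal J_\beta f\|_{F^{\alpha+\beta}_{p,q}}\le C\,\|f\|_{F^\alpha_{p,q}} .$$ -/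

import Mathlib

open MeasureTheory Set
open scoped ENNReal NNReal

noncomputable section

namespace GaussTL

/-- The Gaussian measure `γ_d(dx) = π^{-d/2} e^{-|x|²} dx` on `ℝ^d`. -/
def gaussian (d : ℕ) : Measure (EuclideanSpace ℝ (Fin d)) :=
  volume.withDensity fun x =>
    ENNReal.ofReal (Real.exp (-‖x‖ ^ 2) / Real.pi ^ ((d : ℝ) / 2))

/-- The Ornstein-Uhlenbeck semigroup
`T_t f(x) = ∫ f(√(1 - e^{-2t}) u + e^{-t} x) γ_d(du)`, `t ≥ 0`. -/
def ornsteinUhlenbeck {d : ℕ} (t : ℝ) (f : EuclideanSpace ℝ (Fin d) → ℝ)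
    (x : EuclideanSpace ℝ (Fin d)) : ℝ :=
  ∫ u, f (√(1 - Real.exp (-2 * t)) • u + Real.exp (-t) • x) ∂(gaussian d)

/-- The Poisson-Hermite semigroup, subordinated to the Ornstein-Uhlenbeck semigroup:
`P_t f(x) = π^{-1/2} ∫_0^∞ e^{-u} u^{-1/2} T_{t²/(4u)} f(x) du`, `t ≥ 0`. -/
def poissonHermite {d : ℕ} (t : ℝ) (f : EuclideanSpace ℝ (Fin d) → ℝ)
    (x : EuclideanSpace ℝ (Fin d)) : ℝ :=
  1 / √Real.pi *
    ∫ u in Ioi (0 : ℝ), Real.exp (-u) / √u * ornsteinUhlenbeck (t ^ 2 / (4 * u)) f x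

/-- The normalized Hermite polynomial `h_ν` in `d` variables,
`h_ν(x) = (2^{|ν|} ν!)^{-1/2} ∏_i (-1)^{ν_i} e^{x_i²} ∂_i^{ν_i}(e^{-x_i²})`. -/
def hermite {d : ℕ} (ν : Fin d → ℕ) (x : EuclideanSpace ℝ (Fin d)) : ℝ :=
  1 / √((2 : ℝ) ^ (∑ i, ν i) * ∏ i, ((ν i).factorial : ℝ)) *
    ∏ i, (-1 : ℝ) ^ ν i * Real.exp (x i ^ 2) *
      iteratedDeriv (ν i) (fun s : ℝ => Real.exp (-s ^ 2)) (x i)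

/-- One-variable Hermite functions are polynomials. -/
theorem exists_poly (n : ℕ) : ∃ P : Polynomial ℝ, ∀ s : ℝ,
    iteratedDeriv n (fun s : ℝ => Real.exp (-s ^ 2)) s = P.eval s * Real.exp (-s ^ 2) := by
  induction n with
  | zero => exact ⟨1, fun s => by simp⟩
  | succ n ih =>
    obtain ⟨P, hP⟩ := ih
    refine ⟨Polynomial.derivative P - 2 * Polynomial.X * P, fun s => ?_⟩
    rw [iteratedDeriv_succ, funext hP]
    have h1 : HasDerivAt (fun s : ℝ => Real.exp (-s ^ 2)) (Real.exp (-s ^ 2) * (-(2 * s))) s := by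
      have := ((hasDerivAt_pow 2 s).neg).exp
      simpa using this
    have h2 := (P.hasDerivAt s).mul h1
    rw [show (fun x => Polynomial.eval x P * Real.exp (-x ^ 2)) =
      ((fun x => Polynomial.eval x P) * fun s : ℝ => Real.exp (-s ^ 2)) from rfl, h2.deriv]
    simp
    ring

theorem poly_bound (P : Polynomial ℝ) {ε : ℝ} (hε : 0 < ε) :
    ∃ C : ℝ, 0 ≤ C ∧ ∀ s : ℝ, |P.eval s| ≤ C * Real.exp (ε * s ^ 2) := by
  induction P using Polynomial.induction_on' with
  | add p q hp hq =>
    obtain ⟨C, hC, h⟩ := hp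
    obtain ⟨D, hD, h'⟩ := hq
    refine ⟨C + D, by positivity, fun s => ?_⟩
    rw [Polynomial.eval_add, add_mul]
    exact (abs_add_le _ _).trans (add_le_add (h s) (h' s))
  | monomial n a =>
    refine ⟨|a| * (1 + n.factorial / ε ^ n), by positivity, fun s => ?_⟩
    rw [Polynomial.eval_monomial, abs_mul, mul_assoc]
    refine mul_le_mul_of_nonneg_left ?_ (abs_nonneg a)
    have h1 : (ε * s ^ 2) ^ n / n.factorial ≤ Real.exp (ε * s ^ 2) :=
      Real.pow_div_factorial_le_exp _ (by positivity) n
    have h2 : 1 ≤ Real.exp (ε * s ^ 2) := Real.one_le_exp (by positivity)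
    have h3 : (s ^ 2) ^ n ≤ n.factorial / ε ^ n * Real.exp (ε * s ^ 2) := by
      have : (s ^ 2) ^ n = n.factorial / ε ^ n * ((ε * s ^ 2) ^ n / n.factorial) := by
        rw [mul_pow ε]
        field_simp
      rw [this]
      exact mul_le_mul_of_nonneg_left h1 (by positivity)
    have h4 : |s ^ n| ≤ 1 + (s ^ 2) ^ n := by
      rw [← pow_mul, mul_comm 2 n, pow_mul, ← sq_abs (s ^ n)]
      nlinarith [sq_nonneg (|s ^ n| - 1)]
    linarith

theorem hermite_bound {d : ℕ} (ν : Fin d → ℕ) {ε : ℝ} (hε : 0 < ε) :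
    ∃ C : ℝ, 0 ≤ C ∧ ∀ x, |hermite ν x| ≤ C * Real.exp (ε * ‖x‖ ^ 2) := by
  choose P hP using exists_poly
  choose C hC hb using fun i => poly_bound (P (ν i)) hε
  refine ⟨|1 / √((2 : ℝ) ^ (∑ i, ν i) * ∏ i, ((ν i).factorial : ℝ))| * ∏ i, C i,
    mul_nonneg (abs_nonneg _) (Finset.prod_nonneg fun i _ => hC i), fun x => ?_⟩
  rw [hermite, abs_mul, mul_assoc]
  refine mul_le_mul_of_nonneg_left ?_ (abs_nonneg _)
  rw [Finset.abs_prod, EuclideanSpace.real_norm_sq_eq, Finset.mul_sum, Real.exp_sum,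
    ← Finset.prod_mul_distrib]
  refine Finset.prod_le_prod (fun i _ => abs_nonneg _) fun i _ => ?_
  have h0 : (-1 : ℝ) ^ ν i * Real.exp (x i ^ 2) *
      iteratedDeriv (ν i) (fun s : ℝ => Real.exp (-s ^ 2)) (x i) =
      (-1 : ℝ) ^ ν i * (P (ν i)).eval (x i) := by
    rw [hP]
    have : Real.exp (x i ^ 2) * Real.exp (-x i ^ 2) = 1 := by
      rw [← Real.exp_add]
      simp
    linear_combination ((-1 : ℝ) ^ ν i * (P (ν i)).eval (x i)) * this
  rw [h0, abs_mul, abs_pow, abs_neg, abs_one, one_pow, one_mul]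
  exact hb i (x i)

theorem continuous_hermite {d : ℕ} (ν : Fin d → ℕ) : Continuous (hermite ν) := by
  choose P hP using exists_poly
  unfold hermite
  simp only [hP]
  refine continuous_const.mul (continuous_finsetProd _ fun i _ => ?_)
  have h := (P (ν i)).continuous
  fun_prop

theorem memLp_hermite {d : ℕ} (ν : Fin d → ℕ) {p : ℝ≥0∞} (hp : p ≠ ∞) :
    MemLp (hermite ν) p (gaussian d) := by
  rcases eq_or_ne p 0 with rfl | hp0
  · exact memLp_zero_iff_aestronglyMeasurable.2 (continuous_hermite ν).aestronglyMeasurable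
  have hpos : 0 < p.toReal := ENNReal.toReal_pos hp0 hp
  obtain ⟨C, hC, hb⟩ := hermite_bound (d := d) ν (ε := 1 / (2 * p.toReal)) (by positivity)
  rw [← integrable_norm_rpow_iff (continuous_hermite ν).aestronglyMeasurable hp0 hp, gaussian,
    integrable_withDensity_iff (by fun_prop) (by simp)]
  have hint : Integrable (fun x : EuclideanSpace ℝ (Fin d) =>
      C ^ p.toReal / Real.pi ^ ((d : ℝ) / 2) * Real.exp (-(1 / 2) * ‖x‖ ^ 2)) := by
    refine Integrable.const_mul ?_ _
    have h := (GaussianFourier.integrable_cexp_neg_mul_sq_norm_add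
      (V := EuclideanSpace ℝ (Fin d)) (b := 1 / 2) (by norm_num) 0 0).norm
    refine h.congr (Filter.Eventually.of_forall fun x => ?_)
    simp only [Complex.norm_exp]
    congr 1
    simp [← Complex.ofReal_pow]
  refine hint.mono' ?_ (Filter.Eventually.of_forall fun x => ?_)
  · have := continuous_hermite ν
    exact ((this.norm.rpow_const fun x => Or.inr hpos.le).mul (by
      have : (fun x : EuclideanSpace ℝ (Fin d) => (ENNReal.ofReal
          (Real.exp (-‖x‖ ^ 2) / Real.pi ^ ((d : ℝ) / 2))).toReal) =
          fun x => Real.exp (-‖x‖ ^ 2) / Real.pi ^ ((d : ℝ) / 2) := by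
        funext x
        exact ENNReal.toReal_ofReal (by positivity)
      rw [this]
      fun_prop)).aestronglyMeasurable
  · rw [ENNReal.toReal_ofReal (by positivity), Real.norm_of_nonneg (by positivity)]
    have h1 : ‖hermite ν x‖ ^ p.toReal ≤ C ^ p.toReal * Real.exp (1 / 2 * ‖x‖ ^ 2) := by
      refine (Real.rpow_le_rpow (norm_nonneg _) (hb x) hpos.le).trans_eq ?_
      rw [Real.mul_rpow hC (Real.exp_nonneg _), ← Real.exp_mul]
      congr 2
      field_simp
    refine (mul_le_mul_of_nonneg_right h1 (by positivity)).trans_eq ?_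
    have h2 : Real.exp (-(1 / 2) * ‖x‖ ^ 2) =
        Real.exp (1 / 2 * ‖x‖ ^ 2) * Real.exp (-‖x‖ ^ 2) := by
      rw [← Real.exp_add]
      ring_nf
    rw [h2]
    ring

/-- The class of `h_ν` in `L^p(γ_d)`, `p < ∞`. -/
def hermiteLp {d : ℕ} {p : ℝ≥0∞} (hp : p ≠ ∞) (ν : Fin d → ℕ) : Lp ℝ p (gaussian d) :=
  (memLp_hermite ν hp).toLp (hermite ν)

/-- `J` is the Bessel potential `(I + √(-L))^{-β}` on `L^p(γ_d)`: it is linear, continuous and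
`J h_ν = (1 + √|ν|)^{-β} h_ν` for every multi-index `ν`. -/
def IsBesselPotential {d : ℕ} {p : ℝ≥0∞} [Fact (1 ≤ p)] (hp : p ≠ ∞) (β : ℝ)
    (J : Lp ℝ p (gaussian d) →L[ℝ] Lp ℝ p (gaussian d)) : Prop :=
  ∀ ν : Fin d → ℕ,
    J (hermiteLp hp ν) = ((1 + √((∑ i, ν i : ℕ) : ℝ)) ^ (-β)) • hermiteLp hp ν

/-- The function
`x ↦ (∫_0^∞ (t^{k-α} |∂^k/∂t^k P_t f(x)|)^q dt/t)^{1/q}`, with `k = ⌊α⌋ + 1` the smallest integer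
greater than `α ≥ 0`. -/
def triebelFun {d : ℕ} (α q : ℝ) (f : EuclideanSpace ℝ (Fin d) → ℝ)
    (x : EuclideanSpace ℝ (Fin d)) : ℝ≥0∞ :=
  (∫⁻ t in Ioi (0 : ℝ), ENNReal.ofReal
    ((t ^ (((⌊α⌋₊ + 1 : ℕ) : ℝ) - α) *
      |iteratedDeriv (⌊α⌋₊ + 1) (fun s => poissonHermite s f x) t|) ^ q / t)) ^ (1 / q)

/-- The norm `‖f‖_{F^α_{p,q}(γ_d)}`, with value `∞` where it is infinite. -/
def triebelNorm {d : ℕ} (α : ℝ) (p : ℝ≥0∞) (q : ℝ) (f : EuclideanSpace ℝ (Fin d) → ℝ) : ℝ≥0∞ :=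
  eLpNorm f p (gaussian d) + eLpNorm (triebelFun α q f) p (gaussian d)

/-- The Gaussian Triebel-Lizorkin space `F^α_{p,q}(γ_d)`, as a subset of `L^p(γ_d)`. -/
def triebelLizorkin (d : ℕ) (α : ℝ) (p : ℝ≥0∞) (q : ℝ) : Set (Lp ℝ p (gaussian d)) :=
  {f | eLpNorm (triebelFun α q f) p (gaussian d) < ∞}

end GaussTL

end

/-!
Write `w_t(r) = t / (2 √π) · r^{-3/2} e^{-t²/4r}` for the one-sided stable density (`pker`), so that
`P_t = ∫ w_t(r) T_r dr` and `P_t h_ν = e^{-t√|ν|} h_ν`. Since `(1 + λ)^{-β}` is the Laplace transform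
of the Gamma law `Γ(β)⁻¹ s^{β-1} e^{-s} ds`, the Bessel potential is the mean of the contractions
`P_s` under this law (`bop`, `besselOp`, `isBesselPotential_besselOp`).

Uniqueness holds because the Hermite polynomials span a dense subspace of `L^p(γ_d)`
(`hermiteClosure_eq_top`). Their span contains all powers of linear forms. The Taylor series of
`cos(⟨ξ, x⟩ + φ)` converges in `L^p(γ_d)`, as the Gaussian measure integrates exponentials, so the
closure contains the trigonometric polynomials; by the Stone-Weierstrass theorem on compact sets it
contains the bounded continuous functions, which are dense.

For the norm inequality put `k = ⌊α⌋ + 1` and `l = ⌊α + β⌋ + 1`, so that `k ≤ l` and `α + β < l`.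
Halving the time absorbs derivatives of the stable density: `|∂_t^m w_t| ≤ C t^{-m} w_{t/2}`
(`exists_abs_pkd_le`). Together with the semigroup law for derivatives (`dP_dP`) this gives
`|∂_t^l P_t f| ≤ C t^{-(l-k)} P_{t/4} |∂^k P_{t/2} f|` (`exists_enorm_dP_le_mix`). Inserting this in
`∂_t^l P_t J_β f = ∫ ∂_t^l P_{t+s} f dΓ_β(s)` and substituting `s = tσ` bounds
`t^{l-α-β} |∂_t^l P_t J_β f|` by a mean over `σ`, with the finite weight
`σ^{β-1} (1 + σ)^{-(l-α)} dσ`, of dilations in `t` of `P_{t/2} (t^{k-α} |∂_t^k P_t f|)`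
(`exists_wd_bop_le`). The norm of `L^q(dt/t)` is invariant under dilations, so Jensen's inequality
removes the mean (`lintegral_dilation_rpow_le`), and it remains to remove `P_{t/2}` inside the mixed
norm `L^p(γ_d; L^q(dt/t))`.

This is a vector-valued inequality of Fefferman-Stein type (`IsMixFamily.exists_vectorValued`), valid
for positive contractions that are symmetric on `L²(γ_d)` and dominated by a maximal operator bounded
on all `L^r(γ_d)`, `1 < r`. For `q = 1` it follows by duality from the maximal theorem, Jensen's
inequality reduces `q ≤ p` to this case, and for `p < q` Hölder's inequality against powers of the
`L^q` norm in the parameter moves the maximal function onto a scalar function. The operators `P_t`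
are dominated by the maximal function of the ergodic averages of `T_r`, because `w_t` is below a
convergent combination of uniform densities on dyadic intervals (`mix_pois_le_maxFun`); the maximal
function is bounded on `L^r` by Hopf's maximal lemma and Doob's argument (`hopf_maximal`,
`lintegral_maxFun_rpow_le`). The only property of the Gaussian measure used here is the rotation
invariance of `γ_d ⊗ γ_d`, which gives the semigroup law and the symmetry of `T_r`.

The pointwise identities are proved at the points where all `P_t |f|` are finite (`IsGood`), which is
almost every point, so that the time derivatives are genuine derivatives there. Nonnegative functions
are treated with values in `[0, ∞]`, where Fubini's theorem and the semigroup law need no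
integrability.
-/

noncomputable section

namespace GaussTL

section

/-! ### Gaussian measure and its rotation invariance -/

instance isProbabilityMeasure_gaussian (d : ℕ) : IsProbabilityMeasure (gaussian d) := by
  refine ⟨?_⟩
  have h := GaussianFourier.integral_rexp_neg_mul_sq_norm
    (V := EuclideanSpace ℝ (Fin d)) (b := 1) one_pos
  simp only [neg_mul, one_mul, div_one, finrank_euclideanSpace, Fintype.card_fin] at h
  have hpos : 0 < Real.pi ^ ((d : ℝ) / 2) := Real.rpow_pos_of_pos Real.pi_pos _
  have hint : Integrable (fun x : EuclideanSpace ℝ (Fin d) => Real.exp (-‖x‖ ^ 2)) := by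
    by_contra hc
    rw [integral_undef hc] at h
    exact hpos.ne h
  rw [gaussian, withDensity_apply _ MeasurableSet.univ, Measure.restrict_univ,
    ← ofReal_integral_eq_lintegral_ofReal (hint.div_const _)
      (Filter.Eventually.of_forall fun x => by positivity), integral_div, h, div_self hpos.ne',
    ENNReal.ofReal_one]

variable {d : ℕ}

theorem norm_sq_rotation {a b : ℝ} (hab : a ^ 2 + b ^ 2 = 1) (x y : EuclideanSpace ℝ (Fin d)) :
    ‖a • x + b • y‖ ^ 2 + ‖b • x - a • y‖ ^ 2 = ‖x‖ ^ 2 + ‖y‖ ^ 2 := by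
  rw [norm_add_sq_real, norm_sub_sq_real]
  simp only [norm_smul, inner_smul_left, inner_smul_right, mul_pow, Real.norm_eq_abs, sq_abs,
    conj_trivial]
  linear_combination (‖x‖ ^ 2 + ‖y‖ ^ 2) * hab

/-- The orthogonal transformation `(u, x) ↦ (a u + b x, b u - a x)`, `a² + b² = 1`, of two copies
of `ℝ^d` leaves Lebesgue measure invariant. -/
theorem measurePreserving_volume_rotation {a b : ℝ} (hab : a ^ 2 + b ^ 2 = 1) :
    MeasurePreserving (fun z : EuclideanSpace ℝ (Fin d) × EuclideanSpace ℝ (Fin d) =>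
      (a • z.1 + b • z.2, b • z.1 - a • z.2)) (volume.prod volume) (volume.prod volume) := by
  let E := EuclideanSpace ℝ (Fin d)
  let L : E × E →ₗ[ℝ] E × E :=
    { toFun := fun z => (a • z.1 + b • z.2, b • z.1 - a • z.2)
      map_add' := fun z w => by
        refine Prod.ext ?_ ?_ <;> simp only [Prod.fst_add, Prod.snd_add] <;> module
      map_smul' := fun r z => by
        refine Prod.ext ?_ ?_ <;>
          simp only [Prod.smul_fst, Prod.smul_snd, RingHom.id_apply] <;> module }
  let e := WithLp.linearEquiv 2 ℝ (E × E)
  let R : WithLp 2 (E × E) →ₗᵢ[ℝ] WithLp 2 (E × E) :=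
    { toLinearMap := e.symm.toLinearMap ∘ₗ L ∘ₗ e.toLinearMap
      norm_map' := fun z => by
        rw [← sq_eq_sq₀ (norm_nonneg _) (norm_nonneg _), WithLp.prod_norm_sq_eq_of_L2,
          WithLp.prod_norm_sq_eq_of_L2]
        exact norm_sq_rotation hab _ _ }
  have hR := (R.toLinearIsometryEquiv rfl).measurePreserving
  have h := (WithLp.volume_preserving_ofLp (U := E) (V := E)).comp
    (hR.comp (WithLp.volume_preserving_toLp (U := E) (V := E)))
  exact h

theorem gaussian_prod_eq :
    (gaussian d).prod (gaussian d) =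
      (volume.prod volume : Measure (EuclideanSpace ℝ (Fin d) × EuclideanSpace ℝ (Fin d))).withDensity
        fun z => ENNReal.ofReal (Real.exp (-(‖z.1‖ ^ 2 + ‖z.2‖ ^ 2)) /
          (Real.pi ^ ((d : ℝ) / 2) * Real.pi ^ ((d : ℝ) / 2))) := by
  rw [gaussian, prod_withDensity (by fun_prop) (by fun_prop)]
  congr 1
  ext z
  rw [← ENNReal.ofReal_mul (by positivity), div_mul_div_comm, ← Real.exp_add]
  ring_nf

/-- Rotation invariance of `γ_d ⊗ γ_d`. -/
theorem measurePreserving_rotation {a b : ℝ} (hab : a ^ 2 + b ^ 2 = 1) :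
    MeasurePreserving (fun z : EuclideanSpace ℝ (Fin d) × EuclideanSpace ℝ (Fin d) =>
      (a • z.1 + b • z.2, b • z.1 - a • z.2))
      ((gaussian d).prod (gaussian d)) ((gaussian d).prod (gaussian d)) := by
  have h := measurePreserving_volume_rotation (d := d) hab
  refine ⟨h.measurable, Measure.ext_of_lintegral _ fun F hF => ?_⟩
  rw [lintegral_map hF h.measurable, gaussian_prod_eq, lintegral_withDensity_eq_lintegral_mul _
    (by fun_prop) hF, lintegral_withDensity_eq_lintegral_mul _ (by fun_prop)
    (by fun_prop)]
  refine Eq.trans (lintegral_congr fun z => ?_) (h.lintegral_comp (by fun_prop))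
  simp only [Pi.mul_apply, norm_sq_rotation hab]

/-- A centred Gaussian combination: if `a² + b² = s²`, then `a u + b v` has under `γ_d ⊗ γ_d` the
law of `s u` under `γ_d`. -/
theorem lintegral_gaussian_add {a b s : ℝ} (hs : a ^ 2 + b ^ 2 = s ^ 2)
    {F : EuclideanSpace ℝ (Fin d) → ℝ≥0∞} (hF : Measurable F) :
    ∫⁻ z, F (a • z.1 + b • z.2) ∂((gaussian d).prod (gaussian d)) =
      ∫⁻ u, F (s • u) ∂(gaussian d) := by
  rcases eq_or_ne s 0 with rfl | h0
  · have ha : a = 0 := by nlinarith [sq_nonneg a, sq_nonneg b]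
    have hb : b = 0 := by nlinarith [sq_nonneg a, sq_nonneg b]
    simp [ha, hb]
  · have h := measurePreserving_rotation (d := d) (a := a / s) (b := b / s) (by
      field_simp; exact hs)
    have h2 := h.lintegral_comp (f := fun z => F (s • z.1)) (by fun_prop)
    rw [lintegral_prod _ (by fun_prop)] at h2
    rw [lintegral_prod (fun z => F (s • z.1)) (by fun_prop)] at h2
    simp only [lintegral_const, measure_univ, mul_one] at h2
    rw [← h2, lintegral_prod _ (by fun_prop)]
    simp only [smul_add, smul_smul, mul_div_cancel₀ _ h0]

end

section

/-! ### The Ornstein-Uhlenbeck semigroup and its mixtures on nonnegative functions -/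

variable {d : ℕ}

/-- The Ornstein-Uhlenbeck operator `T_r` on nonnegative functions. -/
def ouL (r : ℝ) (F : EuclideanSpace ℝ (Fin d) → ℝ≥0∞) (x : EuclideanSpace ℝ (Fin d)) : ℝ≥0∞ :=
  ∫⁻ u, F (√(1 - Real.exp (-2 * r)) • u + Real.exp (-r) • x) ∂(gaussian d)

theorem sq_ouCoeff {r : ℝ} (hr : 0 ≤ r) : √(1 - Real.exp (-2 * r)) ^ 2 = 1 - Real.exp (-2 * r) :=
  Real.sq_sqrt (by simpa using hr)

theorem sq_ouCoeff_add {r : ℝ} (hr : 0 ≤ r) :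
    √(1 - Real.exp (-2 * r)) ^ 2 + Real.exp (-r) ^ 2 = 1 := by
  rw [sq_ouCoeff hr, ← Real.exp_nat_mul]
  ring_nf

theorem measurable_ouL_param {ι : Type*} [MeasurableSpace ι]
    {G : ι × EuclideanSpace ℝ (Fin d) → ℝ≥0∞} (hG : Measurable G) :
    Measurable fun z : (ι × ℝ) × EuclideanSpace ℝ (Fin d) =>
      ouL z.1.2 (fun y => G (z.1.1, y)) z.2 := by
  unfold ouL
  exact Measurable.lintegral_prod_right'
    (f := fun z : ((ι × ℝ) × EuclideanSpace ℝ (Fin d)) × EuclideanSpace ℝ (Fin d) =>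
      G (z.1.1.1, √(1 - Real.exp (-2 * z.1.1.2)) • z.2 + Real.exp (-z.1.1.2) • z.1.2))
    (by fun_prop)

theorem measurable_ouL_prod {F : EuclideanSpace ℝ (Fin d) → ℝ≥0∞} (hF : Measurable F) :
    Measurable fun z : ℝ × EuclideanSpace ℝ (Fin d) => ouL z.1 F z.2 := by
  unfold ouL
  exact Measurable.lintegral_prod_right'
    (f := fun z : (ℝ × EuclideanSpace ℝ (Fin d)) × EuclideanSpace ℝ (Fin d) =>
      F (√(1 - Real.exp (-2 * z.1.1)) • z.2 + Real.exp (-z.1.1) • z.1.2)) (by fun_prop)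

@[fun_prop]
theorem measurable_ouL {F : EuclideanSpace ℝ (Fin d) → ℝ≥0∞} (hF : Measurable F) (r : ℝ) :
    Measurable (ouL r F) := by
  have h := (measurable_ouL_prod hF).comp (measurable_prodMk_left (x := r))
  exact h

theorem measurable_ouL_time {F : EuclideanSpace ℝ (Fin d) → ℝ≥0∞} (hF : Measurable F)
    (x : EuclideanSpace ℝ (Fin d)) : Measurable fun r => ouL r F x := by
  have h := (measurable_ouL_prod hF).comp (measurable_prodMk_right (y := x))
  exact h

theorem ouL_mono {F G : EuclideanSpace ℝ (Fin d) → ℝ≥0∞} (h : ∀ x, F x ≤ G x) (r : ℝ)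
    (x : EuclideanSpace ℝ (Fin d)) : ouL r F x ≤ ouL r G x :=
  lintegral_mono fun _ => h _

@[simp]
theorem ouL_const (r : ℝ) (a : ℝ≥0∞) (x : EuclideanSpace ℝ (Fin d)) :
    ouL r (fun _ => a) x = a := by
  simp [ouL]

theorem ouL_add {F : EuclideanSpace ℝ (Fin d) → ℝ≥0∞} (hF : Measurable F)
    (G : EuclideanSpace ℝ (Fin d) → ℝ≥0∞) (r : ℝ) (x : EuclideanSpace ℝ (Fin d)) :
    ouL r (fun y => F y + G y) x = ouL r F x + ouL r G x :=
  lintegral_add_left (by fun_prop) _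

theorem ouL_const_mul {F : EuclideanSpace ℝ (Fin d) → ℝ≥0∞} (hF : Measurable F) (a : ℝ≥0∞)
    (r : ℝ) (x : EuclideanSpace ℝ (Fin d)) : ouL r (fun y => a * F y) x = a * ouL r F x :=
  lintegral_const_mul _ (by fun_prop)

/-- `T_r` is symmetric with respect to `γ_d`. -/
theorem lintegral_ouL_mul {F H : EuclideanSpace ℝ (Fin d) → ℝ≥0∞} (hF : Measurable F)
    (hH : Measurable H) {r : ℝ} (hr : 0 ≤ r) :
    ∫⁻ x, ouL r F x * H x ∂(gaussian d) = ∫⁻ x, F x * ouL r H x ∂(gaussian d) := by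
  set a := √(1 - Real.exp (-2 * r)) with ha
  set b := Real.exp (-r) with hb
  have hab : a ^ 2 + b ^ 2 = 1 := sq_ouCoeff_add hr
  have h := (measurePreserving_rotation (d := d) hab).lintegral_comp
    (f := fun z => F z.1 * H (b • z.1 - a • z.2)) (by fun_prop)
  calc ∫⁻ x, ouL r F x * H x ∂(gaussian d)
      = ∫⁻ x, ∫⁻ u, F (a • u + b • x) * H x ∂(gaussian d) ∂(gaussian d) := by
        refine lintegral_congr fun x => ?_
        rw [lintegral_mul_const _ (by fun_prop)]
        rfl
    _ = ∫⁻ z, F (a • z.1 + b • z.2) * H z.2 ∂((gaussian d).prod (gaussian d)) := by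
        rw [lintegral_prod_symm
          (fun z : EuclideanSpace ℝ (Fin d) × EuclideanSpace ℝ (Fin d) =>
            F (a • z.1 + b • z.2) * H z.2) (by fun_prop)]
    _ = ∫⁻ z, F z.1 * H (b • z.1 - a • z.2) ∂((gaussian d).prod (gaussian d)) := by
        rw [← h]
        refine lintegral_congr fun z => ?_
        have : b • (a • z.1 + b • z.2) - a • (b • z.1 - a • z.2) = (a ^ 2 + b ^ 2) • z.2 := by
          module
        simp only [this, hab, one_smul]
    _ = ∫⁻ y, F y * ∫⁻ w, H (b • y - a • w) ∂(gaussian d) ∂(gaussian d) := by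
        rw [lintegral_prod _ (by fun_prop)]
        exact lintegral_congr fun y => lintegral_const_mul (F y)
          (f := fun w => H (b • y - a • w)) (by fun_prop)
    _ = ∫⁻ x, F x * ouL r H x ∂(gaussian d) := by
        refine lintegral_congr fun y => ?_
        congr 1
        -- the law of `u` under `γ_d` is symmetric
        have h3 := lintegral_gaussian_add (d := d) (a := -a) (b := 0) (s := a) (by ring)
          (F := fun v => H (v + b • y)) (by fun_prop)
        rw [lintegral_prod _ (by fun_prop)] at h3
        simp only [zero_smul, add_zero, lintegral_const, measure_univ, mul_one, neg_smul] at h3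
        rw [ouL, ← ha, ← hb, ← h3]
        refine lintegral_congr fun w => ?_
        rw [neg_add_eq_sub]

theorem lintegral_ouL {F : EuclideanSpace ℝ (Fin d) → ℝ≥0∞} (hF : Measurable F)
    {r : ℝ} (hr : 0 ≤ r) : ∫⁻ x, ouL r F x ∂(gaussian d) = ∫⁻ x, F x ∂(gaussian d) := by
  simpa using lintegral_ouL_mul hF (measurable_const (a := (1 : ℝ≥0∞))) hr

/-- The semigroup law `T_s T_t = T_{s+t}`, with both Gaussian integrals taken over the product
space. -/
theorem lintegral_prod_ou {F : EuclideanSpace ℝ (Fin d) → ℝ≥0∞} (hF : Measurable F)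
    {s t : ℝ} (hs : 0 ≤ s) (ht : 0 ≤ t) (x : EuclideanSpace ℝ (Fin d)) :
    ∫⁻ z, F (√(1 - Real.exp (-2 * t)) • z.2 +
        Real.exp (-t) • (√(1 - Real.exp (-2 * s)) • z.1 + Real.exp (-s) • x))
        ∂((gaussian d).prod (gaussian d)) = ouL (s + t) F x := by
  have h := lintegral_gaussian_add (d := d) (a := Real.exp (-t) * √(1 - Real.exp (-2 * s)))
    (b := √(1 - Real.exp (-2 * t))) (s := √(1 - Real.exp (-2 * (s + t)))) (by
      rw [mul_pow, sq_ouCoeff hs, sq_ouCoeff ht, sq_ouCoeff (add_nonneg hs ht), mul_sub,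
        ← Real.exp_nat_mul, ← Real.exp_add]
      ring_nf)
    (F := fun v => F (v + Real.exp (-(s + t)) • x)) (by fun_prop)
  rw [ouL, ← h]
  refine lintegral_congr fun z => ?_
  congr 1
  rw [neg_add_rev, Real.exp_add]
  module

/-- `T_s T_t = T_{s+t}`. -/
theorem ouL_ouL {F : EuclideanSpace ℝ (Fin d) → ℝ≥0∞} (hF : Measurable F)
    {s t : ℝ} (hs : 0 ≤ s) (ht : 0 ≤ t) (x : EuclideanSpace ℝ (Fin d)) :
    ouL s (ouL t F) x = ouL (s + t) F x := by
  rw [← lintegral_prod_ou hF hs ht, lintegral_prod _ (by fun_prop)]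
  rfl

/-- The mixture `∫ T_r dν(r)` of Ornstein-Uhlenbeck operators. -/
def mix (ν : Measure ℝ) (F : EuclideanSpace ℝ (Fin d) → ℝ≥0∞) (x : EuclideanSpace ℝ (Fin d)) :
    ℝ≥0∞ :=
  ∫⁻ r, ouL r F x ∂ν

variable {ν : Measure ℝ}

theorem mix_eq_lintegral_prod {F : EuclideanSpace ℝ (Fin d) → ℝ≥0∞}
    (hF : Measurable F) (x : EuclideanSpace ℝ (Fin d)) :
    mix ν F x = ∫⁻ z, F (√(1 - Real.exp (-2 * z.1)) • z.2 + Real.exp (-z.1) • x)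
      ∂(ν.prod (gaussian d)) := by
  rw [lintegral_prod _ (by fun_prop)]
  rfl

@[fun_prop]
theorem measurable_mix [SFinite ν] {F : EuclideanSpace ℝ (Fin d) → ℝ≥0∞} (hF : Measurable F) :
    Measurable (mix ν F) :=
  Measurable.lintegral_prod_left' (measurable_ouL_prod hF)

theorem mix_mono {F G : EuclideanSpace ℝ (Fin d) → ℝ≥0∞} (h : ∀ x, F x ≤ G x)
    (x : EuclideanSpace ℝ (Fin d)) : mix ν F x ≤ mix ν G x :=
  lintegral_mono fun r => ouL_mono h r x

theorem mix_add {F G : EuclideanSpace ℝ (Fin d) → ℝ≥0∞} (hF : Measurable F)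
    (x : EuclideanSpace ℝ (Fin d)) : mix ν (fun y => F y + G y) x = mix ν F x + mix ν G x := by
  simp only [mix, ouL_add hF]
  exact lintegral_add_left (measurable_ouL_time hF x) _

theorem mix_const_mul {F : EuclideanSpace ℝ (Fin d) → ℝ≥0∞} (hF : Measurable F) (a : ℝ≥0∞)
    (x : EuclideanSpace ℝ (Fin d)) : mix ν (fun y => a * F y) x = a * mix ν F x := by
  simp only [mix, ouL_const_mul hF]
  exact lintegral_const_mul _ (measurable_ouL_time hF x)

theorem lintegral_mix_mul [SFinite ν] (hν : ∀ᵐ r ∂ν, 0 ≤ r)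
    {F H : EuclideanSpace ℝ (Fin d) → ℝ≥0∞} (hF : Measurable F) (hH : Measurable H) :
    ∫⁻ x, mix ν F x * H x ∂(gaussian d) = ∫⁻ x, F x * mix ν H x ∂(gaussian d) := by
  have h1 := measurable_ouL_prod hF
  have h2 := measurable_ouL_prod hH
  calc ∫⁻ x, mix ν F x * H x ∂(gaussian d)
      = ∫⁻ x, ∫⁻ r, ouL r F x * H x ∂ν ∂(gaussian d) :=
        lintegral_congr fun x => (lintegral_mul_const _ (measurable_ouL_time hF x)).symm
    _ = ∫⁻ r, ∫⁻ x, ouL r F x * H x ∂(gaussian d) ∂ν :=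
        lintegral_lintegral_swap (by
          have : Measurable fun z : EuclideanSpace ℝ (Fin d) × ℝ => ouL z.2 F z.1 * H z.1 :=
            (h1.comp measurable_swap).mul (by fun_prop)
          exact this.aemeasurable)
    _ = ∫⁻ r, ∫⁻ x, F x * ouL r H x ∂(gaussian d) ∂ν :=
        lintegral_congr_ae (hν.mono fun r hr => lintegral_ouL_mul hF hH hr)
    _ = ∫⁻ x, ∫⁻ r, F x * ouL r H x ∂ν ∂(gaussian d) :=
        lintegral_lintegral_swap (by
          have : Measurable fun z : ℝ × EuclideanSpace ℝ (Fin d) => F z.2 * ouL z.1 H z.2 := by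
            fun_prop
          exact this.aemeasurable)
    _ = ∫⁻ x, F x * mix ν H x ∂(gaussian d) :=
        lintegral_congr fun x => lintegral_const_mul _ (measurable_ouL_time hH x)

theorem lintegral_mix [SFinite ν] (hν : ∀ᵐ r ∂ν, 0 ≤ r)
    {F : EuclideanSpace ℝ (Fin d) → ℝ≥0∞} (hF : Measurable F) :
    ∫⁻ x, mix ν F x ∂(gaussian d) = ν univ * ∫⁻ x, F x ∂(gaussian d) := by
  have h := lintegral_mix_mul hν hF (measurable_const (a := (1 : ℝ≥0∞)))
  simp only [mul_one, mix, ouL_const, lintegral_const, one_mul] at h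
  simp only [mix]
  rw [h, lintegral_mul_const _ hF, mul_comm]

/-- Jensen's inequality for powers, for a measure of arbitrary total mass. -/
theorem lintegral_rpow_le {α : Type*} [MeasurableSpace α] (κ : Measure α) {f : α → ℝ≥0∞}
    (hf : AEMeasurable f κ) {q : ℝ} (hq : 1 ≤ q) :
    (∫⁻ a, f a ∂κ) ^ q ≤ κ univ ^ (q - 1) * ∫⁻ a, f a ^ q ∂κ := by
  rcases hq.eq_or_lt with rfl | hq1
  · simp
  · have hc := Real.HolderConjugate.conjExponent hq1
    have h := ENNReal.lintegral_mul_le_Lp_mul_Lq κ hc hf (aemeasurable_const (b := (1 : ℝ≥0∞)))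
    simp only [Pi.mul_apply, mul_one, ENNReal.one_rpow, lintegral_const, one_mul] at h
    have h2 := ENNReal.rpow_le_rpow h (zero_le_one.trans hq)
    rw [ENNReal.mul_rpow_of_nonneg _ _ (zero_le_one.trans hq), ← ENNReal.rpow_mul,
      ← ENNReal.rpow_mul, one_div_mul_cancel (by positivity), ENNReal.rpow_one, mul_comm] at h2
    refine h2.trans_eq ?_
    congr 2
    rw [Real.conjExponent]
    field_simp

theorem mix_rpow_le [IsProbabilityMeasure ν] {F : EuclideanSpace ℝ (Fin d) → ℝ≥0∞}
    (hF : Measurable F) {q : ℝ} (hq : 1 ≤ q) (x : EuclideanSpace ℝ (Fin d)) :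
    mix ν F x ^ q ≤ mix ν (fun y => F y ^ q) x := by
  rw [mix_eq_lintegral_prod hF, mix_eq_lintegral_prod (by fun_prop)]
  refine (lintegral_rpow_le _ (by fun_prop) hq).trans_eq ?_
  simp

theorem mix_mul_le {F G : EuclideanSpace ℝ (Fin d) → ℝ≥0∞}
    (hF : Measurable F) (hG : Measurable G) {p q : ℝ} (hpq : p.HolderConjugate q)
    (x : EuclideanSpace ℝ (Fin d)) :
    mix ν (fun y => F y * G y) x ≤
      mix ν (fun y => F y ^ p) x ^ (1 / p) * mix ν (fun y => G y ^ q) x ^ (1 / q) := by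
  rw [mix_eq_lintegral_prod (by fun_prop), mix_eq_lintegral_prod (by fun_prop),
    mix_eq_lintegral_prod (by fun_prop)]
  exact ENNReal.lintegral_mul_le_Lp_mul_Lq _ hpq (by fun_prop) (by fun_prop)

theorem lintegral_mix_rpow_le [IsProbabilityMeasure ν] (hν : ∀ᵐ r ∂ν, 0 ≤ r)
    {F : EuclideanSpace ℝ (Fin d) → ℝ≥0∞} (hF : Measurable F) {q : ℝ} (hq : 1 ≤ q) :
    ∫⁻ x, mix ν F x ^ q ∂(gaussian d) ≤ ∫⁻ x, F x ^ q ∂(gaussian d) := by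
  refine (lintegral_mono fun x => mix_rpow_le hF hq x).trans_eq ?_
  rw [lintegral_mix hν (by fun_prop), measure_univ, one_mul]

end

section

/-! ### The maximal ergodic theorem -/

/-- Absorption: `I ≤ K I^{1/q}` with `I < ∞` and `1/p + 1/q = 1` forces `I ≤ K^p`. -/
theorem le_rpow_of_le_mul_rpow {p q : ℝ} (hpq : p.HolderConjugate q) {I K : ℝ≥0∞} (hI : I ≠ ∞)
    (h : I ≤ K * I ^ (1 / q)) : I ≤ K ^ p := by
  rcases eq_or_ne I 0 with rfl | h0
  · exact zero_le
  have hne : I ^ (1 / q) ≠ 0 := by simp [h0, hI]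
  have hnt : I ^ (1 / q) ≠ ∞ := ENNReal.rpow_ne_top_of_nonneg (by simpa using hpq.symm.pos.le) hI
  have h1 : I = I ^ (1 / p) * I ^ (1 / q) := by
    rw [← ENNReal.rpow_add _ _ h0 hI, one_div, one_div, hpq.inv_add_inv_eq_one, ENNReal.rpow_one]
  have h2 : I ^ (1 / p) ≤ K := by
    refine (ENNReal.mul_le_mul_iff_left hne hnt).1 ?_
    rw [← h1]
    exact h
  have h3 := ENNReal.rpow_le_rpow h2 hpq.pos.le
  rwa [← ENNReal.rpow_mul, one_div_mul_cancel hpq.pos.ne', ENNReal.rpow_one] at h3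

/-- Doob's argument: a weak-type inequality localised on the level sets of `Y` gives the strong
`L^p` inequality. -/
theorem lintegral_rpow_le_of_weak {α : Type*} [MeasurableSpace α] (μ : Measure α)
    [IsFiniteMeasure μ] {h Y : α → ℝ≥0∞} (hh : Measurable h) (hY : Measurable Y)
    (hw : ∀ t : ℝ, 0 < t → ENNReal.ofReal t * μ {a | ENNReal.ofReal t < Y a} ≤
      ∫⁻ a in {a | ENNReal.ofReal t < Y a}, h a ∂μ)
    {p : ℝ} (hp : 1 < p) (hfin : ∫⁻ a, Y a ^ p ∂μ ≠ ∞) :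
    ∫⁻ a, Y a ^ p ∂μ ≤ ENNReal.ofReal (p / (p - 1)) ^ p * ∫⁻ a, h a ^ p ∂μ := by
  have hp0 : 0 < p := zero_lt_one.trans hp
  have hp1 : 0 < p - 1 := sub_pos.2 hp
  have hYfin : ∀ᵐ a ∂μ, Y a ≠ ∞ := by
    filter_upwards [ae_lt_top (hY.pow_const p) hfin] with a ha h
    rw [h, ENNReal.top_rpow_of_pos hp0] at ha
    exact lt_irrefl _ ha
  have hset : ∀ (ν : Measure α), (∀ᵐ a ∂ν, Y a ≠ ∞) → ∀ t : ℝ, 0 < t →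
      ν {a | t < (Y a).toReal} = ν {a | ENNReal.ofReal t < Y a} := fun ν hν t ht => by
    refine measure_congr ?_
    filter_upwards [hν] with a ha
    exact propext (ENNReal.ofReal_lt_iff_lt_toReal ht.le ha).symm
  have hpow : ∀ (ν : Measure α), (∀ᵐ a ∂ν, Y a ≠ ∞) → ∀ s : ℝ, 0 < s →
      ∫⁻ a, Y a ^ s ∂ν = ENNReal.ofReal s * ∫⁻ t in Ioi (0 : ℝ),
        ν {a | ENNReal.ofReal t < Y a} * ENNReal.ofReal (t ^ (s - 1)) := fun ν hν s hs => by
    have h1 := lintegral_rpow_eq_lintegral_meas_lt_mul ν (f := fun a => (Y a).toReal)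
      (Filter.Eventually.of_forall fun a => ENNReal.toReal_nonneg) hY.ennreal_toReal.aemeasurable hs
    rw [setLIntegral_congr_fun measurableSet_Ioi
      (g := fun t => ν {a | ENNReal.ofReal t < Y a} * ENNReal.ofReal (t ^ (s - 1)))
      (fun t ht => by simp only [hset ν hν t ht])] at h1
    rw [← h1]
    refine lintegral_congr_ae ?_
    filter_upwards [hν] with a ha
    rw [← ENNReal.ofReal_rpow_of_nonneg ENNReal.toReal_nonneg hs.le, ENNReal.ofReal_toReal ha]
  have hν : ∀ᵐ a ∂(μ.withDensity h), Y a ≠ ∞ :=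
    (withDensity_absolutelyContinuous μ h).ae_le hYfin
  have hmeas : ∀ t : ℝ, MeasurableSet {a | ENNReal.ofReal t < Y a} := fun t =>
    measurableSet_lt measurable_const hY
  have key : ∫⁻ a, Y a ^ p ∂μ ≤
      ENNReal.ofReal (p / (p - 1)) * ∫⁻ a, h a * Y a ^ (p - 1) ∂μ := by
    have h2 := hpow _ hν (p - 1) hp1
    rw [lintegral_withDensity_eq_lintegral_mul _ hh (hY.pow_const _)] at h2
    simp only [Pi.mul_apply] at h2
    rw [hpow μ hYfin p hp0, h2, ← mul_assoc, ← ENNReal.ofReal_mul (by positivity),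
      div_mul_cancel₀ _ hp1.ne']
    gcongr _ * ?_
    refine setLIntegral_mono' measurableSet_Ioi fun t (ht : 0 < t) => ?_
    rw [withDensity_apply _ (hmeas t)]
    calc μ {a | ENNReal.ofReal t < Y a} * ENNReal.ofReal (t ^ (p - 1))
        = (ENNReal.ofReal t * μ {a | ENNReal.ofReal t < Y a}) *
            ENNReal.ofReal (t ^ (p - 1 - 1)) := by
          rw [mul_comm (ENNReal.ofReal t), mul_assoc, ← ENNReal.ofReal_mul ht.le]
          congr 2
          rw [Real.rpow_sub_one ht.ne' (p - 1)]
          field_simp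
      _ ≤ _ := by
          gcongr
          exact hw t ht
  have hc := Real.HolderConjugate.conjExponent hp
  have hH := ENNReal.lintegral_mul_le_Lp_mul_Lq μ hc hh.aemeasurable
    (hY.pow_const (p - 1)).aemeasurable
  simp only [Pi.mul_apply] at hH
  have he : (p - 1) * p.conjExponent = p := by
    rw [Real.conjExponent]; field_simp
  simp only [← ENNReal.rpow_mul, he] at hH
  have h4 := le_rpow_of_le_mul_rpow hc hfin
    (K := ENNReal.ofReal (p / (p - 1)) * (∫⁻ a, h a ^ p ∂μ) ^ (1 / p)) (by
      refine key.trans ?_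
      rw [mul_assoc]
      gcongr)
  refine h4.trans_eq ?_
  rw [ENNReal.mul_rpow_of_nonneg _ _ hp0.le, ← ENNReal.rpow_mul, one_div_mul_cancel hp0.ne',
    ENNReal.rpow_one]

variable {d : ℕ}

/-- The ergodic sum `∑_{j<n} T_{jε} F`. -/
def ergSum (ε : ℝ) (n : ℕ) (F : EuclideanSpace ℝ (Fin d) → ℝ≥0∞) (x : EuclideanSpace ℝ (Fin d)) :
    ℝ≥0∞ :=
  ∑ j ∈ Finset.range n, ouL (j * ε) F x

@[fun_prop]
theorem measurable_ergSum {F : EuclideanSpace ℝ (Fin d) → ℝ≥0∞} (hF : Measurable F) (ε : ℝ)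
    (n : ℕ) : Measurable (ergSum ε n F) := by
  unfold ergSum
  fun_prop

theorem ouL_zero (F : EuclideanSpace ℝ (Fin d) → ℝ≥0∞) (x : EuclideanSpace ℝ (Fin d)) :
    ouL 0 F x = F x := by
  simp [ouL]

theorem ergSum_succ {ε : ℝ} (hε : 0 ≤ ε) (n : ℕ) {F : EuclideanSpace ℝ (Fin d) → ℝ≥0∞}
    (hF : Measurable F) (x : EuclideanSpace ℝ (Fin d)) :
    ergSum ε (n + 1) F x = F x + ouL ε (ergSum ε n F) x := by
  have h : ouL ε (ergSum ε n F) x = ∑ j ∈ Finset.range n, ouL ε (ouL (j * ε) F) x := by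
    simp only [ouL, ergSum]
    exact lintegral_finsetSum _ fun j _ => by
      have := measurable_ouL hF (j * ε)
      exact this.comp (by fun_prop)
  rw [h, ergSum, Finset.sum_range_succ']
  simp only [Nat.cast_zero, zero_mul, ouL_zero]
  rw [add_comm]
  congr 1
  refine Finset.sum_congr rfl fun j _ => ?_
  rw [ouL_ouL hF hε (by positivity)]
  congr 1
  push_cast
  ring

theorem lintegral_ergSum {ε : ℝ} (hε : 0 ≤ ε) (n : ℕ) {F : EuclideanSpace ℝ (Fin d) → ℝ≥0∞}
    (hF : Measurable F) :
    ∫⁻ x, ergSum ε n F x ∂(gaussian d) = n * ∫⁻ x, F x ∂(gaussian d) := by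
  simp only [ergSum]
  rw [lintegral_finsetSum _ fun j _ => measurable_ouL hF _]
  simp [lintegral_ouL hF (mul_nonneg (Nat.cast_nonneg _) hε)]

/-- Hopf's maximal ergodic lemma, by Garsia's argument applied to the maximum of the truncated
differences `∑_{j<n} T_{jε} F - n lam`. -/
theorem hopf_maximal {ε : ℝ} (hε : 0 ≤ ε) (N : ℕ) {F : EuclideanSpace ℝ (Fin d) → ℝ≥0∞}
    (hF : Measurable F) (hfin : ∫⁻ x, F x ∂(gaussian d) ≠ ∞) {lam : ℝ≥0∞} (hlam : lam ≠ ∞) :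
    lam * gaussian d {x | ∃ n : Fin (N + 1), (n : ℕ) * lam < ergSum ε n F x} ≤
      ∫⁻ x in {x | ∃ n : Fin (N + 1), (n : ℕ) * lam < ergSum ε n F x}, F x ∂(gaussian d) := by
  set S := {x : EuclideanSpace ℝ (Fin d) | ∃ n : Fin (N + 1), (n : ℕ) * lam < ergSum ε n F x}
    with hS
  have hSm : MeasurableSet S := by
    rw [hS, ofPred_exists]
    exact MeasurableSet.iUnion fun n => measurableSet_lt measurable_const (by fun_prop)
  let M : EuclideanSpace ℝ (Fin d) → ℝ≥0∞ := fun x =>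
    ⨆ n : Fin (N + 1), (ergSum ε n F x - (n : ℕ) * lam)
  have hM : Measurable M := Measurable.iSup fun n => (measurable_ergSum hF ε n).sub_const _
  have hMfin : ∫⁻ x, M x ∂(gaussian d) ≠ ∞ := by
    refine ne_top_of_le_ne_top (ENNReal.mul_ne_top (ENNReal.natCast_ne_top N) hfin)
      (le_of_le_of_eq (lintegral_mono fun x => ?_) (lintegral_ergSum hε N hF))
    refine iSup_le fun n => tsub_le_self.trans ?_
    exact Finset.sum_le_sum_of_subset (Finset.range_mono (Nat.lt_succ_iff.1 n.2))
  have hstep : ∀ x, ∀ n : Fin (N + 1), (n : ℕ) * lam < ergSum ε n F x →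
      (ergSum ε n F x - (n : ℕ) * lam) + lam ≤ F x + ouL ε M x := by
    rintro x ⟨n, hn⟩ hlt
    rcases n with _ | n
    · simp [ergSum] at hlt
    simp only at hlt ⊢
    have h1 : ergSum ε (n + 1) F x ≤ (F x + ouL ε M x) + n * lam := by
      rw [ergSum_succ hε n hF, add_assoc]
      gcongr
      calc ouL ε (ergSum ε n F) x ≤ ouL ε (fun y => M y + n * lam) x := by
            refine ouL_mono (fun y => tsub_le_iff_right.1 ?_) _ _
            exact le_iSup (fun n : Fin (N + 1) => ergSum ε n F y - (n : ℕ) * lam)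
              ⟨n, by omega⟩
        _ = ouL ε M x + n * lam := by rw [ouL_add hM, ouL_const]
    have h2 : (ergSum ε (n + 1) F x - ((n + 1 : ℕ) : ℝ≥0∞) * lam) + lam + n * lam =
        ergSum ε (n + 1) F x := by
      rw [add_assoc, show lam + n * lam = ((n + 1 : ℕ) : ℝ≥0∞) * lam by push_cast; ring]
      exact tsub_add_cancel_of_le hlt.le
    rw [← h2] at h1
    exact (ENNReal.add_le_add_iff_right
      (ENNReal.mul_ne_top (ENNReal.natCast_ne_top n) hlam)).1 h1
  have hpt : ∀ x, M x + S.indicator (fun _ => lam) x ≤ S.indicator F x + ouL ε M x := by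
    intro x
    by_cases hx : x ∈ S
    · rw [indicator_of_mem hx, indicator_of_mem hx, ENNReal.iSup_add]
      refine iSup_le fun n => ?_
      by_cases hn : (n : ℕ) * lam < ergSum ε n F x
      · exact hstep x n hn
      · obtain ⟨m, hm⟩ := hx
        rw [tsub_eq_zero_of_le (not_lt.1 hn), zero_add]
        exact le_add_self.trans (hstep x m hm)
    · have h0 : M x = 0 := by
        refine le_antisymm (iSup_le fun n => ?_) zero_le
        rw [tsub_eq_zero_of_le]
        by_contra hc
        exact hx ⟨n, not_le.1 hc⟩
      simp [indicator_of_notMem hx, h0]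
  have hint := lintegral_mono (μ := gaussian d) hpt
  rw [lintegral_add_left hM, lintegral_add_left (hF.indicator hSm), lintegral_ouL hM hε,
    lintegral_indicator hSm, lintegral_indicator hSm, setLIntegral_const, add_comm] at hint
  exact (ENNReal.add_le_add_iff_right hMfin).1 hint

theorem lintegral_ouL_rpow_le {F : EuclideanSpace ℝ (Fin d) → ℝ≥0∞} (hF : Measurable F) {r : ℝ}
    (hr : 0 ≤ r) {p : ℝ} (hp : 1 ≤ p) :
    ∫⁻ x, ouL r F x ^ p ∂(gaussian d) ≤ ∫⁻ x, F x ^ p ∂(gaussian d) := by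
  have h := lintegral_mix_rpow_le (ν := Measure.dirac r) (by rw [ae_dirac_eq]; exact hr) hF hp
  refine le_trans (lintegral_mono fun x => ?_) h
  simp only [mix]
  rw [lintegral_dirac' _ (measurable_ouL_time hF x)]

/-- The maximal inequality for discrete ergodic averages. -/
theorem lintegral_ergAverage_rpow_le {ε : ℝ} (hε : 0 ≤ ε) (N : ℕ)
    {F : EuclideanSpace ℝ (Fin d) → ℝ≥0∞} (hF : Measurable F) {p : ℝ} (hp : 1 < p) :
    ∫⁻ x, (⨆ n : Fin (N + 1), ergSum ε n F x / (n : ℕ)) ^ p ∂(gaussian d) ≤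
      ENNReal.ofReal (p / (p - 1)) ^ p * ∫⁻ x, F x ^ p ∂(gaussian d) := by
  have hp0 : 0 < p := zero_lt_one.trans hp
  by_cases hfin : ∫⁻ x, F x ^ p ∂(gaussian d) = ∞
  · rw [hfin, ENNReal.mul_top]
    · exact le_top
    · have : 0 < p / (p - 1) := div_pos hp0 (sub_pos.2 hp)
      simp [this]
  have h1 : ∫⁻ x, F x ∂(gaussian d) ≠ ∞ := by
    intro h
    have h2 := lintegral_rpow_le (gaussian d) hF.aemeasurable hp.le
    rw [h, ENNReal.top_rpow_of_pos hp0] at h2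
    simp at h2
    exact hfin h2
  refine lintegral_rpow_le_of_weak (gaussian d) hF (Measurable.iSup fun n => by fun_prop)
    (fun t ht => ?_) hp ?_
  · have hset : {x : EuclideanSpace ℝ (Fin d) |
        ENNReal.ofReal t < ⨆ n : Fin (N + 1), ergSum ε n F x / (n : ℕ)} =
        {x | ∃ n : Fin (N + 1), (n : ℕ) * ENNReal.ofReal t < ergSum ε n F x} := by
      ext x
      simp only [mem_ofPred_eq, lt_iSup_iff]
      refine exists_congr fun n => ?_
      rcases eq_or_ne (n : ℕ) 0 with h0 | h0
      · simp [h0, ergSum]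
      · rw [ENNReal.lt_div_iff_mul_lt (Or.inl (by exact_mod_cast h0))
          (Or.inl (ENNReal.natCast_ne_top _)), mul_comm]
    rw [hset]
    exact hopf_maximal hε N hF h1 ENNReal.ofReal_ne_top
  · have hle : ∀ x, (⨆ n : Fin (N + 1), ergSum ε n F x / (n : ℕ)) ^ p ≤
        (N : ℝ≥0∞) ^ (p - 1) * ∑ j ∈ Finset.range N, ouL (j * ε) F x ^ p := by
      intro x
      refine (ENNReal.rpow_le_rpow (iSup_le fun n => ?_) hp0.le).trans
        ((ENNReal.rpow_sum_le_const_mul_sum_rpow (Finset.range N) (fun j => ouL (j * ε) F x)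
          hp.le).trans_eq (by simp))
      rcases eq_or_ne (n : ℕ) 0 with h0 | h0
      · simp [h0, ergSum]
      · refine (ENNReal.div_le_of_le_mul' ?_)
        calc ergSum ε n F x ≤ ergSum ε N F x :=
              Finset.sum_le_sum_of_subset (Finset.range_mono (Nat.lt_succ_iff.1 n.2))
          _ ≤ _ := le_mul_of_one_le_left zero_le
              (by exact_mod_cast Nat.one_le_iff_ne_zero.2 h0)
    refine ne_top_of_le_ne_top ?_ (lintegral_mono hle)
    rw [lintegral_const_mul _ (Finset.measurable_sum _ fun j _ => by fun_prop),
      lintegral_finsetSum _ fun j _ => by fun_prop]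
    refine ENNReal.mul_ne_top (ENNReal.rpow_ne_top_of_nonneg (sub_nonneg.2 hp.le)
      (ENNReal.natCast_ne_top N)) (ENNReal.sum_ne_top.2 fun j _ => ?_)
    exact ne_top_of_le_ne_top hfin (lintegral_ouL_rpow_le hF (by positivity) hp.le)

end

section

/-! ### The maximal function of the semigroup -/

variable {d : ℕ}

theorem ouL_mix {ν : Measure ℝ} [SFinite ν] (hν : ∀ᵐ r ∂ν, 0 ≤ r)
    {F : EuclideanSpace ℝ (Fin d) → ℝ≥0∞} (hF : Measurable F) {s : ℝ} (hs : 0 ≤ s)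
    (x : EuclideanSpace ℝ (Fin d)) : ouL s (mix ν F) x = ∫⁻ r, ouL (s + r) F x ∂ν := by
  calc ouL s (mix ν F) x = ∫⁻ r, ouL s (ouL r F) x ∂ν := by
        simp only [ouL, mix]
        refine lintegral_lintegral_swap ?_
        have h := measurable_ouL_prod hF
        have h2 := h.comp (f := fun z : EuclideanSpace ℝ (Fin d) × ℝ =>
          (z.2, √(1 - Real.exp (-2 * s)) • z.1 + Real.exp (-s) • x)) (by fun_prop)
        exact h2.aemeasurable
    _ = ∫⁻ r, ouL (s + r) F x ∂ν :=
        lintegral_congr_ae (hν.mono fun r hr => ouL_ouL hF hs hr x)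

/-- The uniform probability measure on `(0, a]`. -/
def unif (a : ℝ) : Measure ℝ := (ENNReal.ofReal a)⁻¹ • volume.restrict (Ioc 0 a)

theorem isProbabilityMeasure_unif {a : ℝ} (ha : 0 < a) : IsProbabilityMeasure (unif a) := by
  refine ⟨?_⟩
  simp only [unif, Measure.smul_apply, Measure.restrict_apply MeasurableSet.univ, univ_inter,
    Real.volume_Ioc, sub_zero, smul_eq_mul]
  exact ENNReal.inv_mul_cancel (by simpa using ha) ENNReal.ofReal_ne_top

instance sFinite_unif (a : ℝ) : SFinite (unif a) := by
  unfold unif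
  infer_instance

theorem ae_unif_nonneg (a : ℝ) : ∀ᵐ r ∂(unif a), 0 ≤ r := by
  refine Measure.ae_smul_measure ?_ _
  exact (ae_restrict_mem measurableSet_Ioc).mono fun r hr => hr.1.le

theorem mix_unif (a : ℝ) (F : EuclideanSpace ℝ (Fin d) → ℝ≥0∞) (x : EuclideanSpace ℝ (Fin d)) :
    mix (unif a) F x = (ENNReal.ofReal a)⁻¹ * ∫⁻ r in Ioc 0 a, ouL r F x := by
  simp [mix, unif]

theorem sum_lintegral_Ioc (g : ℝ → ℝ≥0∞) {ε : ℝ} (hε : 0 ≤ ε) (n : ℕ) :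
    ∑ j ∈ Finset.range n, ∫⁻ r in Ioc 0 ε, g (j * ε + r) = ∫⁻ r in Ioc 0 (n * ε), g r := by
  induction n with
  | zero => simp
  | succ n ih =>
    rw [Finset.sum_range_succ, ih]
    have hun : Ioc 0 (((n + 1 : ℕ) : ℝ) * ε) = Ioc 0 (n * ε) ∪ Ioc (n * ε) ((n + 1 : ℕ) * ε) :=
      (Ioc_union_Ioc_eq_Ioc (by positivity) (by push_cast; nlinarith)).symm
    rw [hun, lintegral_union measurableSet_Ioc (Ioc_disjoint_Ioc_of_le le_rfl)]
    congr 1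
    have h := (measurePreserving_add_left (volume : Measure ℝ) (n * ε)).setLIntegral_comp_emb
      (MeasurableEquiv.addLeft (n * ε : ℝ)).measurableEmbedding g (Ioc 0 ε)
    rw [h]
    congr 2
    rw [image_const_add_Ioc]
    push_cast
    ring_nf

/-- Ergodic sums of `ε^{-1} ∫_0^ε T_r F dr` are integrals of `T_r F`. -/
theorem ergSum_mix_unif {ε : ℝ} (hε : 0 ≤ ε) (n : ℕ) {F : EuclideanSpace ℝ (Fin d) → ℝ≥0∞}
    (hF : Measurable F) (x : EuclideanSpace ℝ (Fin d)) :
    ergSum ε n (mix (unif ε) F) x =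
      (ENNReal.ofReal ε)⁻¹ * ∫⁻ r in Ioc 0 (n * ε), ouL r F x := by
  rw [← sum_lintegral_Ioc (fun r => ouL r F x) hε n, Finset.mul_sum, ergSum]
  refine Finset.sum_congr rfl fun j _ => ?_
  rw [ouL_mix (ae_unif_nonneg ε) hF (by positivity)]
  simp [unif]

/-- The maximal function of the ergodic averages of the Ornstein-Uhlenbeck semigroup over the
dyadic intervals `(0, 2^j]`. -/
def maxFun (F : EuclideanSpace ℝ (Fin d) → ℝ≥0∞) (x : EuclideanSpace ℝ (Fin d)) : ℝ≥0∞ :=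
  ⨆ j : ℤ, mix (unif (2 ^ j)) F x

@[fun_prop]
theorem measurable_maxFun {F : EuclideanSpace ℝ (Fin d) → ℝ≥0∞} (hF : Measurable F) :
    Measurable (maxFun F) :=
  Measurable.iSup fun _ => measurable_mix hF

/-- The maximal theorem: `maxFun` is bounded on `L^p`, `1 < p`. -/
theorem lintegral_maxFun_rpow_le {F : EuclideanSpace ℝ (Fin d) → ℝ≥0∞} (hF : Measurable F)
    {p : ℝ} (hp : 1 < p) :
    ∫⁻ x, maxFun F x ^ p ∂(gaussian d) ≤
      ENNReal.ofReal (p / (p - 1)) ^ p * ∫⁻ x, F x ^ p ∂(gaussian d) := by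
  have hp0 : 0 < p := zero_lt_one.trans hp
  let M : ℕ → EuclideanSpace ℝ (Fin d) → ℝ≥0∞ := fun m x =>
    ⨆ (j : ℤ) (_ : |j| ≤ m), mix (unif (2 ^ j)) F x
  have hM : ∀ m, Measurable (M m) := fun m =>
    Measurable.iSup fun j => Measurable.iSup_Prop _ (measurable_mix hF)
  have hmono : Monotone M := fun m n hmn x =>
    iSup_mono fun j => iSup_mono' fun hj => ⟨hj.trans (by exact_mod_cast hmn), le_rfl⟩
  have hsup : ∀ x, maxFun F x = ⨆ m, M m x := by
    intro x
    refine le_antisymm (iSup_le fun j => ?_) (iSup_le fun m => iSup₂_le fun j _ =>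
      le_iSup (fun j : ℤ => mix (unif (2 ^ j)) F x) j)
    exact le_iSup_of_le j.natAbs (le_iSup₂_of_le (f := fun (j' : ℤ) (_ : |j'| ≤ (j.natAbs : ℕ)) =>
      mix (unif (2 ^ j')) F x) j (by simp) le_rfl)
  have hpow : ∀ x, maxFun F x ^ p = ⨆ m, M m x ^ p := fun x => by
    rw [hsup]
    exact (ENNReal.orderIsoRpow p hp0).map_iSup _
  simp only [hpow]
  rw [lintegral_iSup (fun m => (hM m).pow_const p)
    (fun m n hmn x => ENNReal.rpow_le_rpow (hmono hmn x) hp0.le)]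
  refine iSup_le fun m => ?_
  set ε : ℝ := 2 ^ (-(m : ℤ)) with hε
  have hεpos : 0 < ε := by positivity
  have := isProbabilityMeasure_unif hεpos
  have hle : ∀ x, M m x ≤
      ⨆ n : Fin (2 ^ (2 * m) + 1), ergSum ε n (mix (unif ε) F) x / (n : ℕ) := by
    intro x
    refine iSup₂_le fun j hj => ?_
    rw [abs_le] at hj
    obtain ⟨i, hi⟩ := Int.eq_ofNat_of_zero_le (a := j + m) (by omega)
    refine le_iSup_of_le ⟨2 ^ i, Nat.lt_succ_of_le (Nat.pow_le_pow_right two_pos (by omega))⟩ ?_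
    simp only
    have h2 : ((2 ^ i : ℕ) : ℝ) * ε = 2 ^ j := by
      rw [hε, Nat.cast_pow, Nat.cast_ofNat, ← zpow_natCast, ← zpow_add₀ two_ne_zero, ← hi]
      ring_nf
    rw [ergSum_mix_unif hεpos.le _ hF, mix_unif, h2, ← h2, ENNReal.ofReal_mul (by positivity),
      ENNReal.ofReal_natCast, ENNReal.mul_inv (by simp) (by simp), ENNReal.div_eq_inv_mul,
      mul_assoc]
  refine (lintegral_mono fun x => ENNReal.rpow_le_rpow (hle x) hp0.le).trans ?_
  refine (lintegral_ergAverage_rpow_le hεpos.le _ (measurable_mix hF) hp).trans ?_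
  gcongr _ * ?_
  exact lintegral_mix_rpow_le (ae_unif_nonneg ε) hF hp.le

end

section

/-! ### A vector-valued inequality for mixtures dominated by the maximal function -/

variable {d : ℕ} {ι : Type*} [MeasurableSpace ι]

/-- A family of mixing measures: probability measures on `[0, ∞)`, depending measurably on the
parameter, whose mixtures are controlled by the ergodic maximal function. -/
structure IsMixFamily (d : ℕ) (ν : ι → Measure ℝ) (C : ℝ≥0∞) : Prop where
  prob : ∀ t, IsProbabilityMeasure (ν t)
  nonneg : ∀ t, ∀ᵐ r ∂(ν t), 0 ≤ r
  measurable : ∀ G : ι × EuclideanSpace ℝ (Fin d) → ℝ≥0∞, Measurable G →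
    Measurable fun z : ι × EuclideanSpace ℝ (Fin d) => mix (ν z.1) (fun y => G (z.1, y)) z.2
  le_maxFun : ∀ t, ∀ F : EuclideanSpace ℝ (Fin d) → ℝ≥0∞, Measurable F → ∀ x,
    mix (ν t) F x ≤ C * maxFun F x
  ne_top : C ≠ ∞

variable {ν : ι → Measure ℝ} {C : ℝ≥0∞}

theorem IsMixFamily.lintegral_lintegral (hν : IsMixFamily d ν C) (μ : Measure ι) [SFinite μ]
    {G : ι × EuclideanSpace ℝ (Fin d) → ℝ≥0∞} (hG : Measurable G) :
    ∫⁻ x, ∫⁻ t, mix (ν t) (fun y => G (t, y)) x ∂μ ∂(gaussian d) =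
      ∫⁻ x, ∫⁻ t, G (t, x) ∂μ ∂(gaussian d) := by
  rw [lintegral_lintegral_swap (f := fun x t => mix (ν t) (fun y => G (t, y)) x)
      ((hν.measurable G hG).comp measurable_swap).aemeasurable,
    lintegral_lintegral_swap (f := fun x t => G (t, x)) (hG.comp measurable_swap).aemeasurable]
  refine lintegral_congr fun t => ?_
  have := hν.prob t
  rw [lintegral_mix (hν.nonneg t) (by fun_prop), measure_univ, one_mul]

/-- Duality with the maximal function: the case `q = 1` of the vector-valued inequality. -/
theorem IsMixFamily.lintegral_rpow_le (hν : IsMixFamily d ν C) (μ : Measure ι) [SFinite μ]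
    {G : ι × EuclideanSpace ℝ (Fin d) → ℝ≥0∞} (hG : Measurable G) {r : ℝ} (hr : 1 < r) :
    ∫⁻ x, (∫⁻ t, mix (ν t) (fun y => G (t, y)) x ∂μ) ^ r ∂(gaussian d) ≤
      (C * ENNReal.ofReal r) ^ r * ∫⁻ x, (∫⁻ t, G (t, x) ∂μ) ^ r ∂(gaussian d) := by
  have hr0 : 0 < r := zero_lt_one.trans hr
  have hc := Real.HolderConjugate.conjExponent hr
  set r' := r.conjExponent with hr'
  have hmix := hν.measurable G hG
  let F : EuclideanSpace ℝ (Fin d) → ℝ≥0∞ := fun x => ∫⁻ t, mix (ν t) (fun y => G (t, y)) x ∂μ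
  have hF : Measurable F := Measurable.lintegral_prod_left' hmix
  let H : EuclideanSpace ℝ (Fin d) → ℝ≥0∞ := fun x => ∫⁻ t, G (t, x) ∂μ
  have hH : Measurable H := Measurable.lintegral_prod_left' hG
  have he : (r - 1) * r' = r := by
    have : r - 1 ≠ 0 := (sub_pos.2 hr).ne'
    rw [hr', Real.conjExponent]; field_simp
  have hr'div : r' / (r' - 1) = r := by
    have : r - 1 ≠ 0 := (sub_pos.2 hr).ne'
    rw [hr', Real.conjExponent]; field_simp; ring
  -- the inequality for the truncations `min F N`
  have key : ∀ N : ℕ, ∫⁻ x, (min (F x) N) ^ r ∂(gaussian d) ≤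
      (C * ENNReal.ofReal r) ^ r * ∫⁻ x, H x ^ r ∂(gaussian d) := by
    intro N
    let h : EuclideanSpace ℝ (Fin d) → ℝ≥0∞ := fun x => (min (F x) N) ^ (r - 1)
    have hh : Measurable h := (hF.min measurable_const).pow_const _
    have hfin : ∫⁻ x, (min (F x) N) ^ r ∂(gaussian d) ≠ ∞ := by
      refine ne_top_of_le_ne_top (b := ∫⁻ _, (N : ℝ≥0∞) ^ r ∂(gaussian d)) ?_
        (lintegral_mono fun x => by gcongr; exact min_le_right _ _)
      simp [ENNReal.rpow_ne_top_of_nonneg hr0.le]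
    have h1 : ∫⁻ x, (min (F x) N) ^ r ∂(gaussian d) ≤ C * ∫⁻ x, H x * maxFun h x ∂(gaussian d) := by
      calc ∫⁻ x, (min (F x) N) ^ r ∂(gaussian d) ≤ ∫⁻ x, F x * h x ∂(gaussian d) := by
            refine lintegral_mono fun x => ?_
            have : (min (F x) N) ^ r = min (F x) N * h x := by
              have h0 : r = 1 + (r - 1) := by ring
              conv_lhs => rw [h0, ENNReal.rpow_add_of_nonneg _ _ zero_le_one (sub_pos.2 hr).le,
                ENNReal.rpow_one]
            simp only [this]
            gcongr
            exact min_le_left _ _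
        _ = ∫⁻ x, ∫⁻ t, mix (ν t) (fun y => G (t, y)) x * h x ∂μ ∂(gaussian d) :=
            lintegral_congr fun x => (lintegral_mul_const _
              (hmix.comp (measurable_prodMk_right (y := x)))).symm
        _ = ∫⁻ t, ∫⁻ x, mix (ν t) (fun y => G (t, y)) x * h x ∂(gaussian d) ∂μ :=
            lintegral_lintegral_swap ((hmix.comp measurable_swap).mul
              (hh.comp measurable_fst)).aemeasurable
        _ = ∫⁻ t, ∫⁻ x, G (t, x) * mix (ν t) h x ∂(gaussian d) ∂μ := by
            refine lintegral_congr fun t => ?_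
            have := hν.prob t
            exact lintegral_mix_mul (hν.nonneg t) (by fun_prop) hh
        _ ≤ ∫⁻ t, ∫⁻ x, G (t, x) * (C * maxFun h x) ∂(gaussian d) ∂μ := by
            gcongr with t x
            exact hν.le_maxFun t h hh x
        _ = ∫⁻ x, ∫⁻ t, G (t, x) * (C * maxFun h x) ∂μ ∂(gaussian d) :=
            lintegral_lintegral_swap (by fun_prop)
        _ = ∫⁻ x, C * (H x * maxFun h x) ∂(gaussian d) := by
            refine lintegral_congr fun x => ?_
            rw [lintegral_mul_const _ (by fun_prop)]
            ring
        _ = _ := lintegral_const_mul _ (by fun_prop)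
    have h2 := ENNReal.lintegral_mul_le_Lp_mul_Lq (gaussian d) hc hH.aemeasurable
      (measurable_maxFun hh).aemeasurable
    simp only [Pi.mul_apply] at h2
    have h3 : (∫⁻ x, maxFun h x ^ r' ∂(gaussian d)) ^ (1 / r') ≤
        ENNReal.ofReal r * (∫⁻ x, (min (F x) N) ^ r ∂(gaussian d)) ^ (1 / r') := by
      have h4 := ENNReal.rpow_le_rpow (lintegral_maxFun_rpow_le hh hc.symm.lt)
        (z := 1 / r') (by have := hc.symm.pos; positivity)
      rw [ENNReal.mul_rpow_of_nonneg _ _ (by have := hc.symm.pos; positivity), ← ENNReal.rpow_mul,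
        mul_one_div_cancel hc.symm.pos.ne', ENNReal.rpow_one, hr'div] at h4
      simp only [h, ← ENNReal.rpow_mul, he] at h4
      exact h4
    have h5 := le_rpow_of_le_mul_rpow hc hfin
      (K := C * ENNReal.ofReal r * (∫⁻ x, H x ^ r ∂(gaussian d)) ^ (1 / r)) (by
        calc _ ≤ C * ((∫⁻ x, H x ^ r ∂(gaussian d)) ^ (1 / r) *
              (ENNReal.ofReal r * (∫⁻ x, (min (F x) N) ^ r ∂(gaussian d)) ^ (1 / r'))) :=
              h1.trans (mul_le_mul_right (h2.trans (mul_le_mul_right h3 _)) _)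
          _ = _ := by ring)
    refine h5.trans_eq ?_
    rw [ENNReal.mul_rpow_of_nonneg _ _ hr0.le, ← ENNReal.rpow_mul, one_div_mul_cancel hr0.ne',
      ENNReal.rpow_one]
  have hsup : ∀ x, F x ^ r = ⨆ N : ℕ, (min (F x) N) ^ r := by
    intro x
    have h1 : F x = ⨆ N : ℕ, min (F x) (N : ℝ≥0∞) := by
      rw [← inf_iSup_eq, ENNReal.iSup_natCast, inf_top_eq]
    conv_lhs => rw [h1]
    exact (ENNReal.orderIsoRpow r hr0).map_iSup _
  change ∫⁻ x, F x ^ r ∂(gaussian d) ≤ _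
  simp only [hsup]
  rw [lintegral_iSup (fun N => (hF.min measurable_const).pow_const r)
    (fun m n hmn x => ENNReal.rpow_le_rpow (min_le_min_left _ (by exact_mod_cast hmn)) hr0.le)]
  exact iSup_le key

/-- The vector-valued inequality for `p < q`: Hölder's inequality inside the mixture against powers
of the `L^q` norm in the parameter moves the maximal function onto a scalar function. -/
theorem IsMixFamily.lintegral_rpow_le_of_lt_of_ne_top (hν : IsMixFamily d ν C) (μ : Measure ι)
    [SFinite μ] {G : ι × EuclideanSpace ℝ (Fin d) → ℝ≥0∞} (hG : Measurable G) {p q : ℝ}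
    (hp : 1 < p) (hpq : p < q) (hN : ∀ x, ∫⁻ t, G (t, x) ^ q ∂μ ≠ ∞) :
    ∫⁻ x, (∫⁻ t, mix (ν t) (fun y => G (t, y)) x ^ q ∂μ) ^ (p / q) ∂(gaussian d) ≤
      (C ^ (p * (q - 1) / (q - p)) * ENNReal.ofReal ((p * (q - 1) / (q - p)) /
        ((p * (q - 1) / (q - p)) - 1)) ^ (p * (q - 1) / (q - p))) ^ ((q - p) / q) * 2 ^ (p - 1) *
      ∫⁻ x, (∫⁻ t, G (t, x) ^ q ∂μ) ^ (p / q) ∂(gaussian d) := by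
  have hp0 : 0 < p := zero_lt_one.trans hp
  have hq : 1 < q := hp.trans hpq
  have hq0 : 0 < q := zero_lt_one.trans hq
  have hqp : 0 < q - p := sub_pos.2 hpq
  have hq1 : 0 < q - 1 := sub_pos.2 hq
  set e := p * (q - 1) / (q - p) with he
  have he1 : 1 < e := by
    rw [he, one_lt_div hqp]
    nlinarith
  set b := (q - p) / (q - 1) with hb
  have hbe : b * e = p := by
    rw [hb, he]
    field_simp
  set c := ENNReal.ofReal (e / (e - 1)) with hcdef
  have hc := Real.HolderConjugate.conjExponent hq
  have hc2 : (q / p).HolderConjugate (q / (q - p)) := by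
    rw [Real.holderConjugate_iff]
    refine ⟨(one_lt_div hp0).2 hpq, ?_⟩
    field_simp
    ring
  let N : EuclideanSpace ℝ (Fin d) → ℝ≥0∞ := fun x => ∫⁻ t, G (t, x) ^ q ∂μ
  have hNm : Measurable N := Measurable.lintegral_prod_left' (hG.pow_const q)
  -- the inequality with `N^{1/q}` replaced by the positive function `N^{1/q} + ε`
  have key : ∀ ε : ℝ≥0∞, ε ≠ 0 → ε ≠ ∞ →
      ∫⁻ x, (∫⁻ t, mix (ν t) (fun y => G (t, y)) x ^ q ∂μ) ^ (p / q) ∂(gaussian d) ≤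
      (C ^ e * c ^ e) ^ ((q - p) / q) * ∫⁻ x, (N x ^ (1 / q) + ε) ^ p ∂(gaussian d) := by
    intro ε hε0 hε
    let S : EuclideanSpace ℝ (Fin d) → ℝ≥0∞ := fun x => N x ^ (1 / q) + ε
    have hS : Measurable S := by fun_prop
    have hS0 : ∀ x, S x ≠ 0 := fun x => by simp [S, hε0]
    have hSt : ∀ x, S x ≠ ∞ := fun x =>
      ENNReal.add_ne_top.2 ⟨ENNReal.rpow_ne_top_of_nonneg (by positivity) (hN x), hε⟩
    let W : ι × EuclideanSpace ℝ (Fin d) → ℝ≥0∞ := fun z => G z ^ q * S z.2 ^ (p - q)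
    have hW : Measurable W := by fun_prop
    let M : EuclideanSpace ℝ (Fin d) → ℝ≥0∞ := maxFun fun x => S x ^ b
    have hM : Measurable M := measurable_maxFun (by fun_prop)
    let F : EuclideanSpace ℝ (Fin d) → ℝ≥0∞ := fun x => ∫⁻ t, mix (ν t) (fun y => W (t, y)) x ∂μ
    have hF : Measurable F := Measurable.lintegral_prod_left' (hν.measurable W hW)
    have h1 : ∀ t x, mix (ν t) (fun y => G (t, y)) x ^ q ≤
        mix (ν t) (fun y => W (t, y)) x * (C * M x) ^ (q - 1) := by
      intro t x
      have h2 := mix_mul_le (ν := ν t) (F := fun y => G (t, y) * S y ^ ((p - q) / q))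
        (G := fun y => S y ^ ((q - p) / q)) (by fun_prop) (by fun_prop) hc x
      have h3 : ∀ y, G (t, y) * S y ^ ((p - q) / q) * S y ^ ((q - p) / q) = G (t, y) := fun y => by
        rw [mul_assoc, ← ENNReal.rpow_add _ _ (hS0 y) (hSt y), ← add_div]
        simp
      have h4 : ∀ y, (G (t, y) * S y ^ ((p - q) / q)) ^ q = W (t, y) := fun y => by
        rw [ENNReal.mul_rpow_of_nonneg _ _ hq0.le, ← ENNReal.rpow_mul, div_mul_cancel₀ _ hq0.ne']
      have h5 : ∀ y, (S y ^ ((q - p) / q)) ^ q.conjExponent = S y ^ b := fun y => by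
        rw [← ENNReal.rpow_mul]
        congr 1
        rw [Real.conjExponent, hb]
        field_simp
      simp only [h3, h4, h5] at h2
      have h6 := ENNReal.rpow_le_rpow h2 hq0.le
      rw [ENNReal.mul_rpow_of_nonneg _ _ hq0.le, ← ENNReal.rpow_mul, one_div_mul_cancel hq0.ne',
        ENNReal.rpow_one, ← ENNReal.rpow_mul] at h6
      refine h6.trans ?_
      have h7 : 1 / q.conjExponent * q = q - 1 := by
        rw [Real.conjExponent]
        field_simp
      rw [h7]
      gcongr
      exact hν.le_maxFun t _ (by fun_prop) x
    have h2 : ∀ x, (∫⁻ t, mix (ν t) (fun y => G (t, y)) x ^ q ∂μ) ^ (p / q) ≤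
        F x ^ (p / q) * (C * M x) ^ ((q - 1) * (p / q)) := by
      intro x
      rw [ENNReal.rpow_mul, ← ENNReal.mul_rpow_of_nonneg _ _ (by positivity)]
      gcongr
      refine (lintegral_mono fun t => h1 t x).trans_eq ?_
      exact lintegral_mul_const _ ((hν.measurable W hW).comp (measurable_prodMk_right (y := x)))
    have hFint : ∫⁻ x, F x ∂(gaussian d) ≤ ∫⁻ x, S x ^ p ∂(gaussian d) := by
      rw [hν.lintegral_lintegral μ hW]
      refine lintegral_mono fun x => ?_
      simp only [W]
      rw [lintegral_mul_const _ (by fun_prop)]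
      calc N x * S x ^ (p - q) ≤ S x ^ q * S x ^ (p - q) := by
            gcongr
            calc N x = (N x ^ (1 / q)) ^ q := by
                  rw [← ENNReal.rpow_mul, one_div_mul_cancel hq0.ne', ENNReal.rpow_one]
              _ ≤ _ := by
                  gcongr
                  exact le_self_add
        _ = S x ^ p := by
            rw [← ENNReal.rpow_add _ _ (hS0 x) (hSt x)]
            congr 1
            ring
    have hMint : ∫⁻ x, (C * M x) ^ e ∂(gaussian d) ≤
        C ^ e * c ^ e * ∫⁻ x, S x ^ p ∂(gaussian d) := by
      simp only [ENNReal.mul_rpow_of_nonneg _ _ (zero_lt_one.trans he1).le]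
      rw [lintegral_const_mul _ (by fun_prop), mul_assoc]
      gcongr
      refine (lintegral_maxFun_rpow_le (by fun_prop) he1).trans_eq ?_
      simp only [← ENNReal.rpow_mul, hbe]
      rfl
    refine (lintegral_mono h2).trans ?_
    refine (ENNReal.lintegral_mul_le_Lp_mul_Lq (gaussian d) hc2 (by fun_prop)
      (by fun_prop)).trans ?_
    have e1 : p / q * (q / p) = 1 := by field_simp
    have e2 : (q - 1) * (p / q) * (q / (q - p)) = e := by rw [he]; field_simp
    have e3 : 1 / (q / p) = p / q := by field_simp
    have e4 : 1 / (q / (q - p)) = (q - p) / q := by field_simp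
    simp only [← ENNReal.rpow_mul, e1, e2, e3, e4, ENNReal.rpow_one]
    calc _ ≤ (∫⁻ x, S x ^ p ∂(gaussian d)) ^ (p / q) *
          (C ^ e * c ^ e * ∫⁻ x, S x ^ p ∂(gaussian d)) ^ ((q - p) / q) := by gcongr
      _ = (C ^ e * c ^ e) ^ ((q - p) / q) * ((∫⁻ x, S x ^ p ∂(gaussian d)) ^ (p / q) *
          (∫⁻ x, S x ^ p ∂(gaussian d)) ^ ((q - p) / q)) := by
          rw [ENNReal.mul_rpow_of_nonneg _ _ (by positivity)]
          ring
      _ = _ := by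
          rw [← ENNReal.rpow_add_of_nonneg _ _ (by positivity) (by positivity), ← add_div,
            add_sub_cancel, div_self hq0.ne', ENNReal.rpow_one]
  -- let `ε → 0`
  set B := ∫⁻ x, N x ^ (p / q) ∂(gaussian d)
  set K := (C ^ e * c ^ e) ^ ((q - p) / q) with hK
  have hKt : K ≠ ∞ := by
    refine ENNReal.rpow_ne_top_of_nonneg (by positivity) (ENNReal.mul_ne_top ?_ ?_)
    · exact ENNReal.rpow_ne_top_of_nonneg (by linarith) hν.ne_top
    · exact ENNReal.rpow_ne_top_of_nonneg (by linarith) ENNReal.ofReal_ne_top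
  have h2t : (2 : ℝ≥0∞) ^ (p - 1) ≠ ∞ := ENNReal.rpow_ne_top_of_nonneg (by linarith) (by simp)
  have key2 : ∀ δ : ℝ≥0∞, δ ≠ 0 → δ ≠ ∞ →
      ∫⁻ x, (∫⁻ t, mix (ν t) (fun y => G (t, y)) x ^ q ∂μ) ^ (p / q) ∂(gaussian d) ≤
      K * 2 ^ (p - 1) * (B + δ) := by
    intro δ hδ0 hδ
    refine (key (δ ^ (1 / p)) (by simp [hδ0, hδ]) (ENNReal.rpow_ne_top_of_nonneg (by positivity)
      hδ)).trans ?_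
    rw [mul_assoc]
    gcongr
    calc ∫⁻ x, (N x ^ (1 / q) + δ ^ (1 / p)) ^ p ∂(gaussian d)
        ≤ ∫⁻ x, 2 ^ (p - 1) * (N x ^ (p / q) + δ) ∂(gaussian d) := by
          refine lintegral_mono fun x => ?_
          refine (ENNReal.rpow_add_le_mul_rpow_add_rpow _ _ hp.le).trans_eq ?_
          rw [← ENNReal.rpow_mul, ← ENNReal.rpow_mul, one_div_mul_cancel hp0.ne', ENNReal.rpow_one,
            one_div_mul_eq_div]
      _ = 2 ^ (p - 1) * (B + δ) := by
          rw [lintegral_const_mul _ (by fun_prop), lintegral_add_left (by fun_prop)]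
          simp [B]
  have hlim : Filter.Tendsto (fun n : ℕ => K * 2 ^ (p - 1) * (B + ((n : ℝ≥0∞) + 1)⁻¹))
      Filter.atTop (nhds (K * 2 ^ (p - 1) * (B + 0))) := by
    refine ENNReal.Tendsto.const_mul (tendsto_const_nhds.add ?_)
      (Or.inr (ENNReal.mul_ne_top hKt h2t))
    have := (ENNReal.tendsto_inv_nat_nhds_zero).comp (Filter.tendsto_add_atTop_nat 1)
    simpa [Function.comp_def] using this
  rw [add_zero] at hlim
  refine ge_of_tendsto' hlim fun n => key2 _ ?_ ?_
  · simp [ENNReal.add_eq_top]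
  · simp

/-- The Fefferman-Stein type inequality
`‖(∫ (A_t G_t)^q dμ(t))^{1/q}‖_p ≤ C ‖(∫ G_t^q dμ(t))^{1/q}‖_p` for a family of mixtures of
Ornstein-Uhlenbeck operators dominated by the maximal function, `1 < p < ∞`, `1 ≤ q < ∞`. -/
theorem IsMixFamily.exists_vectorValued (hν : IsMixFamily d ν C) (μ : Measure ι) [SFinite μ]
    {p q : ℝ} (hp : 1 < p) (hq : 1 ≤ q) :
    ∃ K : ℝ≥0∞, K ≠ ∞ ∧ ∀ G : ι × EuclideanSpace ℝ (Fin d) → ℝ≥0∞, Measurable G →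
      ∫⁻ x, (∫⁻ t, mix (ν t) (fun y => G (t, y)) x ^ q ∂μ) ^ (p / q) ∂(gaussian d) ≤
        K * ∫⁻ x, (∫⁻ t, G (t, x) ^ q ∂μ) ^ (p / q) ∂(gaussian d) := by
  have hp0 : 0 < p := zero_lt_one.trans hp
  have hq0 : 0 < q := zero_lt_one.trans_le hq
  -- Jensen's inequality; for `q ≤ p` this leaves the case `q = 1` for the functions `G_t^q`
  have hJ : ∀ G : ι × EuclideanSpace ℝ (Fin d) → ℝ≥0∞, Measurable G →
      ∫⁻ x, (∫⁻ t, mix (ν t) (fun y => G (t, y)) x ^ q ∂μ) ^ (p / q) ∂(gaussian d) ≤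
      ∫⁻ x, (∫⁻ t, mix (ν t) (fun y => G (t, y) ^ q) x ∂μ) ^ (p / q) ∂(gaussian d) := by
    intro G hG
    gcongr with x t
    have := hν.prob t
    exact mix_rpow_le (by fun_prop) hq x
  rcases lt_trichotomy q p with hlt | rfl | hlt
  · refine ⟨(C * ENNReal.ofReal (p / q)) ^ (p / q), ?_, fun G hG => (hJ G hG).trans ?_⟩
    · exact ENNReal.rpow_ne_top_of_nonneg (by positivity)
        (ENNReal.mul_ne_top hν.ne_top ENNReal.ofReal_ne_top)
    · exact hν.lintegral_rpow_le μ (hG.pow_const q) ((one_lt_div hq0).2 hlt)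
  · refine ⟨1, ENNReal.one_ne_top, fun G hG => (hJ G hG).trans_eq ?_⟩
    simp only [div_self hq0.ne', ENNReal.rpow_one, one_mul]
    exact hν.lintegral_lintegral μ (hG.pow_const q)
  · set e := p * (q - 1) / (q - p) with he
    have hqp : 0 < q - p := sub_pos.2 hlt
    have he0 : 0 ≤ e := div_nonneg (mul_nonneg hp0.le (by linarith)) hqp.le
    set K := (C ^ e * ENNReal.ofReal (e / (e - 1)) ^ e) ^ ((q - p) / q) * 2 ^ (p - 1) with hK
    have hKt : K ≠ ∞ := by
      refine ENNReal.mul_ne_top (ENNReal.rpow_ne_top_of_nonneg (by positivity)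
        (ENNReal.mul_ne_top ?_ ?_)) (ENNReal.rpow_ne_top_of_nonneg (by linarith) (by simp))
      · exact ENNReal.rpow_ne_top_of_nonneg he0 hν.ne_top
      · exact ENNReal.rpow_ne_top_of_nonneg he0 ENNReal.ofReal_ne_top
    refine ⟨max K 1, by simp [hKt], fun G hG => ?_⟩
    let N : EuclideanSpace ℝ (Fin d) → ℝ≥0∞ := fun x => ∫⁻ t, G (t, x) ^ q ∂μ
    have hNm : Measurable N := Measurable.lintegral_prod_left' (hG.pow_const q)
    by_cases hfin : ∫⁻ x, N x ^ (p / q) ∂(gaussian d) = ∞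
    · rw [hfin, ENNReal.mul_top (by simp)]
      exact le_top
    -- discard the null set where the parameter norm is infinite
    let Z : Set (EuclideanSpace ℝ (Fin d)) := {x | N x = ∞}
    have hZm : MeasurableSet Z := hNm (measurableSet_singleton ∞)
    have hZ : gaussian d Z = 0 := by
      have := ae_lt_top (by fun_prop) hfin
      rw [ae_iff] at this
      refine measure_mono_null (fun x hx => ?_) this
      have hx' : N x = ∞ := hx
      have h0 : 0 < p / q := by positivity
      simp [hx', h0]
    let G' : ι × EuclideanSpace ℝ (Fin d) → ℝ≥0∞ := fun z => Zᶜ.indicator (fun _ => G z) z.2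
    have hG' : Measurable G' := by
      have : G' = (Prod.snd ⁻¹' Zᶜ).indicator G := by
        ext z
        simp [G', indicator]
      rw [this]
      exact hG.indicator (measurable_snd hZm.compl)
    have hN' : ∀ x, ∫⁻ t, G' (t, x) ^ q ∂μ = Zᶜ.indicator N x := by
      intro x
      by_cases hx : x ∈ Z
      · simp [G', hx, hq0]
      · simp [G', hx, N]
    have h1 := hν.lintegral_rpow_le_of_lt_of_ne_top μ hG' hp hlt (fun x => by
      rw [hN']
      by_cases hx : x ∈ Z
      · simp [hx]
      · rw [indicator_of_mem (by exact hx)]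
        exact hx)
    have h2 : ∀ᵐ x ∂(gaussian d), ∀ᵐ t ∂μ, mix (ν t) (Z.indicator fun _ => ∞) x = 0 := by
      have hm : Measurable fun z : ι × EuclideanSpace ℝ (Fin d) =>
          mix (ν z.1) (Z.indicator fun _ => (∞ : ℝ≥0∞)) z.2 :=
        hν.measurable (fun z => Z.indicator (fun _ => ∞) z.2)
          ((measurable_const.indicator hZm).comp measurable_snd)
      have h3 := hν.lintegral_lintegral μ (G := fun z => Z.indicator (fun _ => ∞) z.2)
        ((measurable_const.indicator hZm).comp measurable_snd)
      have h4 : ∫⁻ x, ∫⁻ _, Z.indicator (fun _ => (∞ : ℝ≥0∞)) x ∂μ ∂(gaussian d) = 0 := by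
        rw [lintegral_eq_zero_iff (by
          simp only [lintegral_const]
          exact (measurable_const.indicator hZm).mul_const _)]
        have hZae : ∀ᵐ x ∂(gaussian d), x ∉ Z := measure_eq_zero_iff_ae_notMem.1 hZ
        filter_upwards [hZae] with x hx
        simp [hx]
      rw [h4, lintegral_eq_zero_iff (Measurable.lintegral_prod_left' hm)] at h3
      filter_upwards [h3] with x hx
      exact (lintegral_eq_zero_iff (hm.comp (measurable_prodMk_right (y := x)))).1 hx
    calc ∫⁻ x, (∫⁻ t, mix (ν t) (fun y => G (t, y)) x ^ q ∂μ) ^ (p / q) ∂(gaussian d)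
        ≤ ∫⁻ x, (∫⁻ t, mix (ν t) (fun y => G' (t, y)) x ^ q ∂μ) ^ (p / q) ∂(gaussian d) := by
          refine lintegral_mono_ae ?_
          filter_upwards [h2] with x hx
          gcongr ?_ ^ _
          refine lintegral_mono_ae ?_
          filter_upwards [hx] with t ht
          gcongr ?_ ^ _
          calc mix (ν t) (fun y => G (t, y)) x
              ≤ mix (ν t) (fun y => G' (t, y) + Z.indicator (fun _ => ∞) y) x := by
                refine mix_mono (fun y => ?_) x
                by_cases hy : y ∈ Z
                · simp [hy]
                · simp [hy, G']
            _ = mix (ν t) (fun y => G' (t, y)) x := by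
                rw [mix_add (by fun_prop), ht, add_zero]
      _ ≤ K * ∫⁻ x, (∫⁻ t, G' (t, x) ^ q ∂μ) ^ (p / q) ∂(gaussian d) := h1
      _ ≤ max K 1 * ∫⁻ x, N x ^ (p / q) ∂(gaussian d) := by
          gcongr with x
          · exact le_max_left _ _
          · rw [hN']
            exact indicator_le_self _ _ _

end

section

/-! ### The subordination kernel -/

/-- The density `w_t(r) = t / (2√π) r^{-3/2} e^{-t²/(4r)}` of the one-sided stable law of order
`1/2`. It vanishes for `r ≤ 0`, since `√r = 0` there. -/
def pker (t r : ℝ) : ℝ := t / (2 * √Real.pi) * (r * √r)⁻¹ * Real.exp (-(t ^ 2 / (4 * r)))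

theorem pker_of_nonpos (t : ℝ) {r : ℝ} (hr : r ≤ 0) : pker t r = 0 := by
  simp [pker, Real.sqrt_eq_zero_of_nonpos hr]

theorem pker_nonneg {t : ℝ} (ht : 0 ≤ t) (r : ℝ) : 0 ≤ pker t r := by
  rcases le_or_gt r 0 with hr | hr
  · rw [pker_of_nonpos t hr]
  · unfold pker
    positivity

theorem measurable_pker : Measurable fun z : ℝ × ℝ => pker z.1 z.2 := by
  unfold pker
  fun_prop

theorem lintegral_Ioi_comp_div {c : ℝ} (hc : 0 < c) (g : ℝ → ℝ≥0∞) :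
    ∫⁻ r in Ioi (0 : ℝ), g r = ∫⁻ s in Ioi (0 : ℝ), ENNReal.ofReal (c / s ^ 2) * g (c / s) := by
  have himg : (fun s => c / s) '' Ioi (0 : ℝ) = Ioi 0 := by
    ext y
    constructor
    · rintro ⟨s, hs, rfl⟩
      exact div_pos hc hs
    · intro hy
      exact ⟨c / y, div_pos hc hy, by have : y ≠ 0 := ne_of_gt hy; field_simp⟩
  have h := lintegral_image_eq_lintegral_abs_deriv_mul (s := Ioi (0 : ℝ)) (f := fun s => c / s)
    (f' := fun s => -(c / s ^ 2)) measurableSet_Ioi (fun s hs => by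
      have hs0 : s ≠ 0 := ne_of_gt hs
      have h1 := ((hasDerivAt_id s).fun_inv hs0).const_mul c
      simp only [id, ← div_eq_mul_inv] at h1
      refine (h1.congr_deriv ?_).hasDerivWithinAt
      ring) (fun a ha b hb hab => by
      have ha0 : a ≠ 0 := ne_of_gt ha
      have hb0 : b ≠ 0 := ne_of_gt hb
      simp only at hab
      field_simp at hab
      exact hab.symm) g
  rw [himg] at h
  rw [h]
  refine setLIntegral_congr_fun measurableSet_Ioi fun s hs => ?_
  simp only [abs_neg]
  rw [abs_of_nonneg (by positivity)]

/-- The change of variables `y = B√r - A/√r` (Cauchy-Schlömilch). -/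
theorem lintegral_schloemilch {A B : ℝ} (hA : 0 < A) (hB : 0 ≤ B) :
    ∫⁻ r in Ioi (0 : ℝ), ENNReal.ofReal ((B / (2 * √r) + A / (2 * (r * √r))) *
      Real.exp (-(B * √r - A / √r) ^ 2)) =
      ∫⁻ y in (fun r => B * √r - A / √r) '' Ioi (0 : ℝ), ENNReal.ofReal (Real.exp (-y ^ 2)) := by
  rw [lintegral_image_eq_lintegral_abs_deriv_mul (f' := fun r => B / (2 * √r) + A / (2 * (r * √r)))
    measurableSet_Ioi]
  · refine setLIntegral_congr_fun measurableSet_Ioi fun r hr => ?_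
    have hr' : 0 < r := hr
    rw [abs_of_nonneg (by positivity), ENNReal.ofReal_mul (by positivity)]
  · intro r hr
    have hr' : 0 < r := hr
    have hs : √r ≠ 0 := (Real.sqrt_pos.2 hr').ne'
    have h1 := Real.hasDerivAt_sqrt hr'.ne'
    have h2 := (h1.const_mul B).fun_sub ((h1.fun_inv hs).const_mul A)
    simp only [← div_eq_mul_inv] at h2
    refine (h2.congr_deriv ?_).hasDerivWithinAt
    rw [Real.sq_sqrt hr'.le]
    field_simp
    ring
  · have hmono : StrictMonoOn (fun r => B * √r - A / √r) (Ioi (0 : ℝ)) := by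
      intro a ha b hb hab
      have ha' : 0 < √a := Real.sqrt_pos.2 ha
      have hlt : √a < √b := Real.sqrt_lt_sqrt (le_of_lt ha) hab
      have h1 : A / √b < A / √a := div_lt_div_of_pos_left hA ha' hlt
      have h2 : B * √a ≤ B * √b := mul_le_mul_of_nonneg_left hlt.le hB
      simp only
      linarith
    exact hmono.injOn

theorem exp_schloemilch (A B : ℝ) {r : ℝ} (hr : 0 < r) :
    Real.exp (-(B * √r - A / √r) ^ 2) =
      Real.exp (2 * A * B) * Real.exp (-(A ^ 2 / r) - B ^ 2 * r) := by
  rw [← Real.exp_add]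
  congr 1
  have hs : √r ≠ 0 := (Real.sqrt_pos.2 hr).ne'
  have h2 : √r ^ 2 = r := Real.sq_sqrt hr.le
  have h3 : (A / √r) ^ 2 = A ^ 2 / r := by rw [div_pow, h2]
  have h4 : (B * √r) * (A / √r) = B * A := by field_simp
  rw [sub_sq, h3, mul_pow, h2]
  linear_combination 2 * h4

theorem lintegral_gaussian_real : ∫⁻ y : ℝ, ENNReal.ofReal (Real.exp (-y ^ 2)) =
    ENNReal.ofReal √Real.pi := by
  have h := integral_gaussian 1
  have hi := integrable_exp_neg_mul_sq one_pos
  simp only [neg_mul, one_mul, div_one] at h hi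
  rw [← ofReal_integral_eq_lintegral_ofReal hi
    (Filter.Eventually.of_forall fun x => (Real.exp_pos _).le), h]

theorem lintegral_gaussian_Iio : ∫⁻ y in Iio (0 : ℝ), ENNReal.ofReal (Real.exp (-y ^ 2)) =
    ENNReal.ofReal (√Real.pi / 2) := by
  have h := integral_gaussian_Ioi 1
  have hi := integrable_exp_neg_mul_sq one_pos
  simp only [neg_mul, one_mul, div_one] at h hi
  rw [← h, ofReal_integral_eq_lintegral_ofReal hi.integrableOn
    (Filter.Eventually.of_forall fun x => (Real.exp_pos _).le)]
  have h2 := (Measure.measurePreserving_neg (volume : Measure ℝ)).setLIntegral_comp_emb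
    (MeasurableEquiv.neg ℝ).measurableEmbedding (fun y => ENNReal.ofReal (Real.exp (-y ^ 2))) (Ioi 0)
  simp only [image_neg_Ioi, neg_zero, even_two, Even.neg_pow] at h2
  exact h2.symm

/-- The two integrals `∫ r^{-3/2} e^{-A²/r - B²r} dr` and `∫ r^{-1/2} e^{-A²/r - B²r} dr` are
exchanged by `r ↦ A²/(B² r)`. -/
theorem lintegral_exp_swap {A B : ℝ} (hA : 0 < A) (hB : 0 < B) :
    ∫⁻ r in Ioi (0 : ℝ), ENNReal.ofReal (B * ((√r)⁻¹ * Real.exp (-(A ^ 2 / r) - B ^ 2 * r))) =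
    ∫⁻ r in Ioi (0 : ℝ),
      ENNReal.ofReal (A * ((r * √r)⁻¹ * Real.exp (-(A ^ 2 / r) - B ^ 2 * r))) := by
  rw [lintegral_Ioi_comp_div (c := A ^ 2 / B ^ 2) (by positivity)]
  refine setLIntegral_congr_fun measurableSet_Ioi fun r hr => ?_
  have hr' : 0 < r := hr
  have hs : 0 < √r := Real.sqrt_pos.2 hr'
  rw [← ENNReal.ofReal_mul (by positivity)]
  congr 1
  have h1 : √(A ^ 2 / B ^ 2 / r) = A / B / √r := by
    rw [Real.sqrt_div (by positivity), ← div_pow, Real.sqrt_sq (by positivity)]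
  have h2 : -(A ^ 2 / (A ^ 2 / B ^ 2 / r)) - B ^ 2 * (A ^ 2 / B ^ 2 / r) =
      -(A ^ 2 / r) - B ^ 2 * r := by
    field_simp
    ring
  rw [h1, h2]
  have h3 : √r * √r = r := Real.mul_self_sqrt hr'.le
  have h4 : A ^ 2 / B ^ 2 / r ^ 2 * (B * (A / B / √r)⁻¹) = A * (r * √r)⁻¹ := by
    field_simp
    rw [sq, h3]
  linear_combination (Real.exp (-(A ^ 2 / r) - B ^ 2 * r)) * h4

theorem image_schloemilch {A B : ℝ} (hA : 0 < A) (hB : 0 < B) :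
    (fun r => B * √r - A / √r) '' Ioi (0 : ℝ) = univ := by
  refine eq_univ_of_forall fun y => ?_
  set D := √(y ^ 2 + 4 * A * B) with hD
  have hD2 : D ^ 2 = y ^ 2 + 4 * A * B := Real.sq_sqrt (by positivity)
  have hDy : |y| < D := by
    rw [← Real.sqrt_sq_eq_abs]
    exact Real.sqrt_lt_sqrt (sq_nonneg y) (by nlinarith [mul_pos hA hB])
  have hv : 0 < (y + D) / (2 * B) := by
    have := neg_abs_le y
    exact div_pos (by linarith) (by positivity)
  refine ⟨((y + D) / (2 * B)) ^ 2, by simpa using pow_pos hv 2, ?_⟩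
  simp only [Real.sqrt_sq hv.le]
  have h0 : y + D ≠ 0 := by
    have := neg_abs_le y
    exact ne_of_gt (by linarith)
  field_simp
  linear_combination hD2

/-- `∫_0^∞ r^{-3/2} e^{-A²/r - B²r} dr = √π/A e^{-2AB}`. -/
theorem lintegral_exp_three_halves {A B : ℝ} (hA : 0 < A) (hB : 0 ≤ B) :
    ∫⁻ r in Ioi (0 : ℝ), ENNReal.ofReal ((r * √r)⁻¹ * Real.exp (-(A ^ 2 / r) - B ^ 2 * r)) =
      ENNReal.ofReal (√Real.pi / A * Real.exp (-(2 * A * B))) := by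
  set X := ∫⁻ r in Ioi (0 : ℝ),
    ENNReal.ofReal (A * ((r * √r)⁻¹ * Real.exp (-(A ^ 2 / r) - B ^ 2 * r))) with hX
  have hXval : X = ENNReal.ofReal (√Real.pi * Real.exp (-(2 * A * B))) := by
    have h := lintegral_schloemilch hA hB
    rcases hB.eq_or_lt with rfl | hB0
    · have himg : (fun r => 0 * √r - A / √r) '' Ioi (0 : ℝ) = Iio 0 := by
        ext y
        constructor
        · rintro ⟨r, hr, rfl⟩
          have : 0 < √r := Real.sqrt_pos.2 hr
          simp only [zero_mul, zero_sub, mem_Iio, Left.neg_neg_iff]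
          positivity
        · intro hy
          have hy' : y < 0 := hy
          have hy0 : y ≠ 0 := hy'.ne
          have hpos : 0 < A / -y := div_pos hA (by linarith)
          refine ⟨(A / -y) ^ 2, by simpa using pow_pos hpos 2, ?_⟩
          simp only [Real.sqrt_sq hpos.le]
          field_simp
          simp
      rw [himg, lintegral_gaussian_Iio] at h
      have h2 : X = ENNReal.ofReal 2 * ∫⁻ r in Ioi (0 : ℝ), ENNReal.ofReal
          ((0 / (2 * √r) + A / (2 * (r * √r))) * Real.exp (-(0 * √r - A / √r) ^ 2)) := by
        rw [← lintegral_const_mul' _ _ ENNReal.ofReal_ne_top]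
        refine setLIntegral_congr_fun measurableSet_Ioi fun r hr => ?_
        have hr' : 0 < r := hr
        rw [exp_schloemilch A 0 hr', ← ENNReal.ofReal_mul zero_le_two]
        congr 1
        simp
        field_simp
      rw [h2, h, ← ENNReal.ofReal_mul zero_le_two]
      congr 1
      simp
      ring
    · rw [image_schloemilch hA hB0, setLIntegral_univ, lintegral_gaussian_real] at h
      have h2 : ENNReal.ofReal (2 * Real.exp (-(2 * A * B))) *
          (∫⁻ r in Ioi (0 : ℝ), ENNReal.ofReal ((B / (2 * √r) + A / (2 * (r * √r))) *
          Real.exp (-(B * √r - A / √r) ^ 2))) = X + X := by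
        conv_rhs => rw [hX]; arg 1; rw [← lintegral_exp_swap hA hB0]
        rw [← lintegral_add_left (by fun_prop), ← lintegral_const_mul' _ _ ENNReal.ofReal_ne_top]
        refine setLIntegral_congr_fun measurableSet_Ioi fun r hr => ?_
        have hr' : 0 < r := hr
        rw [exp_schloemilch A B hr', ← ENNReal.ofReal_mul (by positivity),
          ← ENNReal.ofReal_add (by positivity) (by positivity)]
        congr 1
        have he : Real.exp (-(2 * A * B)) * Real.exp (2 * A * B) = 1 := by
          rw [← Real.exp_add]; simp
        field_simp
        linear_combination he
      rw [h, ← two_mul, ← ENNReal.ofReal_mul (by positivity), mul_assoc,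
        ENNReal.ofReal_mul zero_le_two, ENNReal.ofReal_ofNat] at h2
      rw [← (ENNReal.mul_right_inj two_ne_zero (by simp)).1 h2, mul_comm]
  have h3 : X = ENNReal.ofReal A * ∫⁻ r in Ioi (0 : ℝ),
      ENNReal.ofReal ((r * √r)⁻¹ * Real.exp (-(A ^ 2 / r) - B ^ 2 * r)) := by
    rw [← lintegral_const_mul' _ _ ENNReal.ofReal_ne_top]
    refine lintegral_congr fun r => ?_
    rw [ENNReal.ofReal_mul hA.le]
  have hA0 : ENNReal.ofReal A ≠ 0 := by simpa using hA
  refine (ENNReal.mul_right_inj hA0 ENNReal.ofReal_ne_top).1 ?_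
  rw [← h3, hXval, ← ENNReal.ofReal_mul hA.le]
  congr 1
  field_simp

/-- `∫_0^∞ r^{-1/2} e^{-A²/r - B²r} dr = √π/B e^{-2AB}`. -/
theorem lintegral_exp_one_half {A B : ℝ} (hA : 0 < A) (hB : 0 < B) :
    ∫⁻ r in Ioi (0 : ℝ), ENNReal.ofReal ((√r)⁻¹ * Real.exp (-(A ^ 2 / r) - B ^ 2 * r)) =
      ENNReal.ofReal (√Real.pi / B * Real.exp (-(2 * A * B))) := by
  have h := lintegral_exp_swap hA hB
  have h1 := lintegral_exp_three_halves hA hB.le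
  simp only [ENNReal.ofReal_mul hA.le, ENNReal.ofReal_mul hB.le] at h
  rw [lintegral_const_mul' _ _ ENNReal.ofReal_ne_top,
    lintegral_const_mul' _ _ ENNReal.ofReal_ne_top, h1] at h
  have hB0 : ENNReal.ofReal B ≠ 0 := by simpa using hB
  refine (ENNReal.mul_right_inj hB0 ENNReal.ofReal_ne_top).1 ?_
  rw [h, ← ENNReal.ofReal_mul hA.le, ← ENNReal.ofReal_mul hB.le]
  congr 1
  field_simp

theorem lintegral_eq_Ioi {g : ℝ → ℝ≥0∞} (hg : ∀ r ≤ 0, g r = 0) :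
    ∫⁻ r, g r = ∫⁻ r in Ioi (0 : ℝ), g r := by
  rw [← lintegral_indicator measurableSet_Ioi]
  refine lintegral_congr fun r => ?_
  by_cases hr : r ∈ Ioi (0 : ℝ)
  · rw [indicator_of_mem hr]
  · rw [indicator_of_notMem hr, hg r (not_lt.1 hr)]

/-- The Laplace transform of `w_t` is `e^{-t√lam}`. -/
theorem lintegral_pker_mul_exp {t lam : ℝ} (ht : 0 < t) (hl : 0 ≤ lam) :
    ∫⁻ r, ENNReal.ofReal (pker t r * Real.exp (-(lam * r))) =
      ENNReal.ofReal (Real.exp (-(t * √lam))) := by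
  rw [lintegral_eq_Ioi fun r hr => by simp [pker_of_nonpos t hr]]
  have h := lintegral_exp_three_halves (A := t / 2) (B := √lam) (by positivity) (Real.sqrt_nonneg _)
  have h2 : ∀ r, ENNReal.ofReal (pker t r * Real.exp (-(lam * r))) =
      ENNReal.ofReal (t / (2 * √Real.pi)) * ENNReal.ofReal ((r * √r)⁻¹ *
        Real.exp (-((t / 2) ^ 2 / r) - √lam ^ 2 * r)) := fun r => by
    rw [← ENNReal.ofReal_mul (by positivity), pker, Real.sq_sqrt hl, mul_assoc, mul_assoc,
      ← Real.exp_add]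
    congr 4
    ring
  simp only [h2]
  rw [lintegral_const_mul' _ _ ENNReal.ofReal_ne_top, h, ← ENNReal.ofReal_mul (by positivity)]
  congr 1
  have : √Real.pi ≠ 0 := (Real.sqrt_pos.2 Real.pi_pos).ne'
  field_simp

theorem lintegral_pker {t : ℝ} (ht : 0 < t) : ∫⁻ r, ENNReal.ofReal (pker t r) = 1 := by
  simpa using lintegral_pker_mul_exp ht le_rfl

/-- The stable laws form a convolution semigroup: `w_s * w_t = w_{s+t}`. -/
theorem lintegral_pker_conv {s t : ℝ} (hs : 0 < s) (ht : 0 < t) (r : ℝ) :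
    ∫⁻ ρ, ENNReal.ofReal (pker s (r - ρ) * pker t ρ) = ENNReal.ofReal (pker (s + t) r) := by
  rcases le_or_gt r 0 with hr | hr
  · rw [pker_of_nonpos _ hr, ENNReal.ofReal_zero]
    have : ∀ ρ, pker s (r - ρ) * pker t ρ = 0 := fun ρ => by
      rcases le_or_gt ρ 0 with h | h
      · rw [pker_of_nonpos t h, mul_zero]
      · rw [pker_of_nonpos s (by linarith), zero_mul]
    simp [this]
  have hIoo : ∫⁻ ρ, ENNReal.ofReal (pker s (r - ρ) * pker t ρ) =
      ∫⁻ ρ in Ioo 0 r, ENNReal.ofReal (pker s (r - ρ) * pker t ρ) := by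
    rw [← lintegral_indicator measurableSet_Ioo]
    refine lintegral_congr fun ρ => ?_
    by_cases h : ρ ∈ Ioo 0 r
    · rw [indicator_of_mem h]
    · rw [indicator_of_notMem h]
      rcases le_or_gt ρ 0 with h0 | h0
      · simp [pker_of_nonpos t h0]
      · have : r ≤ ρ := by
          by_contra hc
          exact h ⟨h0, not_le.1 hc⟩
        simp [pker_of_nonpos s (sub_nonpos.2 this)]
  -- substitute `ρ = r y / (1 + y)`
  have himg : (fun y => r * y / (1 + y)) '' Ioi (0 : ℝ) = Ioo 0 r := by
    ext ρ
    constructor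
    · rintro ⟨y, hy, rfl⟩
      have hy' : 0 < y := hy
      refine ⟨by positivity, ?_⟩
      rw [div_lt_iff₀ (by positivity)]
      nlinarith
    · rintro ⟨h0, h1⟩
      have h2 : 0 < r - ρ := by linarith
      refine ⟨ρ / (r - ρ), div_pos h0 h2, ?_⟩
      have h3 : r - ρ ≠ 0 := h2.ne'
      have h4 : 1 + ρ / (r - ρ) = r / (r - ρ) := by field_simp; ring
      simp only [h4]
      field_simp
  have hsub := lintegral_image_eq_lintegral_abs_deriv_mul (s := Ioi (0 : ℝ))
    (f := fun y => r * y / (1 + y)) (f' := fun y => r / (1 + y) ^ 2) measurableSet_Ioi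
    (fun y hy => by
      have hy' : 0 < y := hy
      have h1 : (1 + y) ≠ 0 := by positivity
      have h2 := ((hasDerivAt_id y).const_mul r).fun_div ((hasDerivAt_id y).const_add 1) h1
      simp only [id] at h2
      refine (h2.congr_deriv ?_).hasDerivWithinAt
      field_simp
      ring)
    (fun a ha b hb hab => by
      have ha' : 0 < a := ha
      have hb' : 0 < b := hb
      simp only at hab
      rw [div_eq_div_iff (by positivity) (by positivity)] at hab
      have : r * (a - b) = 0 := by linear_combination hab
      rcases mul_eq_zero.1 this with h | h
      · exact absurd h hr.ne'
      · linarith)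
    (fun ρ => ENNReal.ofReal (pker s (r - ρ) * pker t ρ))
  rw [himg] at hsub
  rw [hIoo, hsub]
  have hsr : 0 < √r := Real.sqrt_pos.2 hr
  have hsr2 : √r ^ 2 = r := Real.sq_sqrt hr.le
  set A := t / (2 * √r) with hA
  set B := s / (2 * √r) with hB
  have hA0 : 0 < A := by positivity
  have hB0 : 0 < B := by positivity
  set c := s * t / (4 * Real.pi) / r ^ 2 * Real.exp (-((s ^ 2 + t ^ 2) / (4 * r))) with hc
  have hpt : ∀ y ∈ Ioi (0 : ℝ), ENNReal.ofReal |r / (1 + y) ^ 2| *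
      ENNReal.ofReal (pker s (r - r * y / (1 + y)) * pker t (r * y / (1 + y))) =
      ENNReal.ofReal c * (ENNReal.ofReal ((y * √y)⁻¹ * Real.exp (-(A ^ 2 / y) - B ^ 2 * y)) +
        ENNReal.ofReal ((√y)⁻¹ * Real.exp (-(A ^ 2 / y) - B ^ 2 * y))) := by
    intro y hy
    have hy' : 0 < y := hy
    have hsy : 0 < √y := Real.sqrt_pos.2 hy'
    rw [← ENNReal.ofReal_add (by positivity) (by positivity), ← ENNReal.ofReal_mul (by positivity),
      ← ENNReal.ofReal_mul (by positivity)]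
    congr 1
    have h1 : r - r * y / (1 + y) = r / (1 + y) := by field_simp; ring
    have h1y : 0 < √(1 + y) := Real.sqrt_pos.2 (by positivity)
    have h1y2 : √(1 + y) ^ 2 = 1 + y := Real.sq_sqrt (by positivity)
    have hπ : 0 < √Real.pi := Real.sqrt_pos.2 Real.pi_pos
    have hπ2 : √Real.pi ^ 2 = Real.pi := Real.sq_sqrt Real.pi_pos.le
    rw [h1, pker, pker, Real.sqrt_div hr.le, Real.sqrt_div (by positivity), Real.sqrt_mul hr.le,
      abs_of_nonneg (by positivity)]
    have hexp : Real.exp (-(s ^ 2 / (4 * (r / (1 + y))))) *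
        Real.exp (-(t ^ 2 / (4 * (r * y / (1 + y))))) =
        Real.exp (-((s ^ 2 + t ^ 2) / (4 * r))) * Real.exp (-(A ^ 2 / y) - B ^ 2 * y) := by
      rw [← Real.exp_add, ← Real.exp_add]
      congr 1
      rw [hA, hB, div_pow, div_pow, mul_pow, hsr2]
      field_simp
      ring
    have hcoef : r / (1 + y) ^ 2 * (s / (2 * √Real.pi) * (r / (1 + y) * (√r / √(1 + y)))⁻¹ *
        (t / (2 * √Real.pi) * (r * y / (1 + y) * (√r * √y / √(1 + y)))⁻¹)) =
        s * t / (4 * Real.pi) / r ^ 2 * ((y * √y)⁻¹ + (√y)⁻¹) := by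
      field_simp
      rw [h1y2, hsr2, hπ2]
      ring
    rw [hc]
    linear_combination (Real.exp (-(s ^ 2 / (4 * (r / (1 + y))))) *
        Real.exp (-(t ^ 2 / (4 * (r * y / (1 + y)))))) * hcoef +
      s * t / (4 * Real.pi) / r ^ 2 * ((y * √y)⁻¹ + (√y)⁻¹) * hexp
  rw [setLIntegral_congr_fun measurableSet_Ioi hpt, lintegral_const_mul' _ _ ENNReal.ofReal_ne_top,
    lintegral_add_left (by fun_prop), lintegral_exp_three_halves hA0 hB0.le,
    lintegral_exp_one_half hA0 hB0, ← ENNReal.ofReal_add (by positivity) (by positivity),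
    ← ENNReal.ofReal_mul (by positivity)]
  congr 1
  have hπ : 0 < √Real.pi := Real.sqrt_pos.2 Real.pi_pos
  have hπ2 : √Real.pi ^ 2 = Real.pi := Real.sq_sqrt Real.pi_pos.le
  have hexp : Real.exp (-((s ^ 2 + t ^ 2) / (4 * r))) * Real.exp (-(2 * A * B)) =
      Real.exp (-((s + t) ^ 2 / (4 * r))) := by
    rw [← Real.exp_add]
    congr 1
    have : 2 * A * B = 2 * s * t / (4 * r) := by
      rw [hA, hB]
      field_simp
      rw [hsr2]
      ring
    rw [this]
    ring
  have hcoef : s * t / (4 * Real.pi) / r ^ 2 * (√Real.pi / A + √Real.pi / B) =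
      (s + t) / (2 * √Real.pi) * (r * √r)⁻¹ := by
    rw [hA, hB]
    field_simp
    rw [hsr2, hπ2]
    ring
  rw [hc, pker, ← hexp]
  linear_combination (Real.exp (-((s ^ 2 + t ^ 2) / (4 * r))) * Real.exp (-(2 * A * B))) * hcoef

end

section

/-! ### Time derivatives of the subordination kernel -/

/-- The polynomials `p_m` with `∂_t^m w_t(r) = t^{-m} p_m(t²/r) w_t(r)`. -/
def pkPoly : ℕ → Polynomial ℝ
  | 0 => 1
  | m + 1 => (Polynomial.C (1 - (m : ℝ)) - Polynomial.C (1 / 2) * Polynomial.X) * pkPoly m +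
      2 * Polynomial.X * Polynomial.derivative (pkPoly m)

/-- The derivative `∂_t^m w_t(r)`, for `t > 0`. -/
def pkd (m : ℕ) (t r : ℝ) : ℝ := (pkPoly m).eval (t ^ 2 / r) / t ^ m * pker t r

theorem pkd_zero (t r : ℝ) : pkd 0 t r = pker t r := by
  simp [pkd, pkPoly]

theorem measurable_pkd (m : ℕ) : Measurable fun z : ℝ × ℝ => pkd m z.1 z.2 := by
  have h := (pkPoly m).continuous.measurable
  have h2 := measurable_pker
  unfold pkd
  fun_prop

theorem measurable_pkd_right (m : ℕ) (t : ℝ) : Measurable fun r => pkd m t r := by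
  have h := (measurable_pkd m).comp (measurable_prodMk_left (x := t))
  exact h

theorem hasDerivAt_pkd (m : ℕ) {t : ℝ} (ht : 0 < t) (r : ℝ) :
    HasDerivAt (fun s => pkd m s r) (pkd (m + 1) t r) t := by
  rcases le_or_gt r 0 with hr | hr
  · simp only [pkd, pker_of_nonpos _ hr, mul_zero]
    exact hasDerivAt_const _ _
  · have h1 : HasDerivAt (fun s : ℝ => s ^ 2 / r) (2 * t / r) t := by
      simpa using (hasDerivAt_pow 2 t).div_const r
    have h2 : HasDerivAt (fun s : ℝ => s ^ 2 / (4 * r)) (2 * t / (4 * r)) t := by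
      simpa using (hasDerivAt_pow 2 t).div_const (4 * r)
    have h3 : HasDerivAt (fun s => pker s r) (pker t r * (1 / t - t / (2 * r))) t := by
      have h4 := (((hasDerivAt_id t).div_const (2 * √Real.pi)).mul_const (r * √r)⁻¹).fun_mul
        h2.fun_neg.exp
      refine h4.congr_deriv ?_
      have hs : 0 < √r := Real.sqrt_pos.2 hr
      simp only [id, pker]
      field_simp
      ring
    have h5 := ((((pkPoly m).hasDerivAt (t ^ 2 / r)).comp t h1).fun_div (hasDerivAt_pow m t)
      (by positivity)).fun_mul h3
    refine h5.congr_deriv ?_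
    simp only [Function.comp_apply, pkd, pkPoly]
    simp only [Polynomial.eval_add, Polynomial.eval_mul, Polynomial.eval_sub, Polynomial.eval_C,
      Polynomial.eval_X, Polynomial.eval_ofNat]
    rcases m with _ | m
    · simp
      field_simp
      ring
    · simp only [Nat.add_sub_cancel]
      push_cast
      field_simp
      ring

/-- `|∂_t^m w_t| ≤ C t^{-m} w_{t/2}`: halving the time turns `e^{-t²/4r}` into `e^{-t²/16r}`, and the
difference absorbs the polynomial factor in `t²/r`. -/
theorem exists_abs_pkd_le (m : ℕ) : ∃ C : ℝ, 0 ≤ C ∧ ∀ t : ℝ, 0 < t → ∀ r,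
    |pkd m t r| ≤ C / t ^ m * pker (t / 2) r := by
  -- `3/16 = 1/4 - 1/16` is the difference of the exponents at the times `t` and `t / 2`
  obtain ⟨C, hC, hb⟩ := poly_bound ((pkPoly m).comp (Polynomial.X ^ 2)) (ε := 3 / 16) (by norm_num)
  refine ⟨2 * C, by positivity, fun t ht r => ?_⟩
  rcases le_or_gt r 0 with hr | hr
  · simp [pkd, pker_of_nonpos _ hr]
  · have hz : 0 ≤ t ^ 2 / r := by positivity
    have h1 := hb (√(t ^ 2 / r))
    simp only [Polynomial.eval_comp, Polynomial.eval_pow, Polynomial.eval_X,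
      Real.sq_sqrt hz] at h1
    have h2 : Real.exp (3 / 16 * (t ^ 2 / r)) * Real.exp (-(t ^ 2 / (4 * r))) =
        Real.exp (-((t / 2) ^ 2 / (4 * r))) := by
      rw [← Real.exp_add]
      congr 1
      field_simp
      ring
    have h3 : pker t r = t / (2 * √Real.pi) * (r * √r)⁻¹ * Real.exp (-(t ^ 2 / (4 * r))) := rfl
    rw [pkd, abs_mul, abs_div, abs_of_nonneg (pker_nonneg ht.le r),
      abs_of_pos (pow_pos ht m)]
    calc |(pkPoly m).eval (t ^ 2 / r)| / t ^ m * pker t r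
        ≤ C * Real.exp (3 / 16 * (t ^ 2 / r)) / t ^ m * pker t r := by
          have := pker_nonneg ht.le r
          gcongr
      _ = 2 * C / t ^ m * pker (t / 2) r := by
          rw [pker, pker, ← h2]
          ring

/-- Integrability against `w_a` gives integrability against `w_t` for all later times `t`. -/
theorem pker_le_of_le {a b t : ℝ} (ha : 0 < a) (hat : a ≤ t) (htb : t ≤ b) (r : ℝ) :
    pker t r ≤ b / a * pker a r := by
  rcases le_or_gt r 0 with hr | hr
  · simp [pker_of_nonpos _ hr]
  · have : b / a * pker a r =
        b / (2 * √Real.pi) * (r * √r)⁻¹ * Real.exp (-(a ^ 2 / (4 * r))) := by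
      rw [pker]
      field_simp
    rw [this, pker]
    have h0 : 0 ≤ b := (ha.le.trans hat).trans htb
    gcongr

theorem exists_abs_pkd_le_of_mem_ball (m : ℕ) {t₀ : ℝ} (ht₀ : 0 < t₀) : ∃ C : ℝ, 0 ≤ C ∧
    ∀ t ∈ Metric.ball t₀ (t₀ / 2), ∀ r, |pkd m t r| ≤ C * pker (t₀ / 4) r := by
  obtain ⟨C, hC, hb⟩ := exists_abs_pkd_le m
  refine ⟨C / (t₀ / 2) ^ m * (t₀ / (t₀ / 4)), by positivity, fun t ht r => ?_⟩
  rw [Metric.mem_ball, Real.dist_eq, abs_lt] at ht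
  have h1 : t₀ / 2 ≤ t := by linarith
  have htp : 0 < t := by linarith
  refine (hb t htp r).trans ?_
  have h2 := pker_le_of_le (a := t₀ / 4) (b := t₀) (t := t / 2) (by positivity) (by linarith)
    (by linarith) r
  rw [mul_assoc]
  refine mul_le_mul ?_ h2 (pker_nonneg (by linarith) r) (by positivity)
  gcongr

theorem iteratedDeriv_eq_of_hasDerivAt {f : ℝ → ℝ} {G : ℕ → ℝ → ℝ}
    (hf : ∀ t, 0 < t → f t = G 0 t)
    (hG : ∀ m t, 0 < t → HasDerivAt (G m) (G (m + 1) t) t) (m : ℕ) {t : ℝ} (ht : 0 < t) :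
    iteratedDeriv m f t = G m t := by
  induction m generalizing t with
  | zero => simpa using hf t ht
  | succ m ih =>
    rw [iteratedDeriv_succ]
    have : iteratedDeriv m f =ᶠ[nhds t] G m :=
      Filter.eventuallyEq_of_mem (Ioi_mem_nhds ht) fun s hs => ih hs
    rw [this.deriv_eq, (hG m t ht).deriv]

/-- `θ` is integrable against every stable density `w_t`, `t > 0`. -/
structure PkIntegrable (θ : ℝ → ℝ) : Prop where
  meas : AEStronglyMeasurable θ
  integrable : ∀ t, 0 < t → Integrable fun r => pker t r * θ r

theorem PkIntegrable.integrable_pkd {θ : ℝ → ℝ} (hθ : PkIntegrable θ) (m : ℕ) {t : ℝ}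
    (ht : 0 < t) : Integrable fun r => pkd m t r * θ r := by
  obtain ⟨C, hC, hb⟩ := exists_abs_pkd_le m
  refine ((hθ.integrable (t / 2) (by positivity)).norm.const_mul (C / t ^ m)).mono'
    ((measurable_pkd_right m t).aestronglyMeasurable.mul hθ.meas)
    (Filter.Eventually.of_forall fun r => ?_)
  rw [norm_mul, norm_mul, Real.norm_eq_abs, Real.norm_of_nonneg (pker_nonneg (by positivity) r),
    ← mul_assoc]
  exact mul_le_mul_of_nonneg_right (hb t ht r) (norm_nonneg _)

/-- `t ↦ ∫ w_t θ` can be differentiated under the integral sign. -/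
theorem PkIntegrable.hasDerivAt {θ : ℝ → ℝ} (hθ : PkIntegrable θ) (m : ℕ) {t : ℝ}
    (ht : 0 < t) : HasDerivAt (fun s => ∫ r, pkd m s r * θ r) (∫ r, pkd (m + 1) t r * θ r) t := by
  obtain ⟨C, hC, hb⟩ := exists_abs_pkd_le_of_mem_ball (m + 1) ht
  refine (hasDerivAt_integral_of_dominated_loc_of_deriv_le (μ := volume)
    (F := fun s r => pkd m s r * θ r) (F' := fun s r => pkd (m + 1) s r * θ r)
    (bound := fun r => C * ‖pker (t / 4) r * θ r‖)
    (Metric.ball_mem_nhds t (half_pos ht)) ?_ (hθ.integrable_pkd m ht) ?_ ?_ ?_ ?_).2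
  · exact Filter.Eventually.of_forall fun s =>
      (measurable_pkd_right m s).aestronglyMeasurable.mul hθ.meas
  · exact (measurable_pkd_right (m + 1) t).aestronglyMeasurable.mul hθ.meas
  · refine Filter.Eventually.of_forall fun r s hs => ?_
    rw [norm_mul, norm_mul, Real.norm_eq_abs, Real.norm_of_nonneg (pker_nonneg (by positivity) r),
      ← mul_assoc]
    exact mul_le_mul_of_nonneg_right (hb s hs r) (norm_nonneg _)
  · exact (hθ.integrable (t / 4) (by positivity)).norm.const_mul C
  · refine Filter.Eventually.of_forall fun r s hs => ?_
    rw [Metric.mem_ball, Real.dist_eq, abs_lt] at hs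
    exact (hasDerivAt_pkd m (by linarith) r).mul_const (θ r)

theorem PkIntegrable.iteratedDeriv_eq {θ : ℝ → ℝ} (hθ : PkIntegrable θ) {f : ℝ → ℝ}
    (hf : ∀ t, 0 < t → f t = ∫ r, pker t r * θ r) (m : ℕ) {t : ℝ} (ht : 0 < t) :
    iteratedDeriv m f t = ∫ r, pkd m t r * θ r :=
  iteratedDeriv_eq_of_hasDerivAt (G := fun m t => ∫ r, pkd m t r * θ r)
    (fun t ht => by simpa only [pkd_zero] using hf t ht) (fun m t ht => hθ.hasDerivAt m ht) m ht

theorem measurable_pker_right (t : ℝ) : Measurable fun r => pker t r := by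
  unfold pker
  fun_prop

theorem integrable_pker_conv {s t : ℝ} (hs : 0 < s) (ht : 0 < t) (r : ℝ) :
    Integrable fun ρ => pker s (r - ρ) * pker t ρ := by
  have h := lintegral_pker_conv hs ht r
  have hm : Measurable fun ρ => pker s (r - ρ) * pker t ρ :=
    ((measurable_pker_right s).comp (measurable_const.sub measurable_id)).mul
      (measurable_pker_right t)
  refine ⟨hm.aestronglyMeasurable, ?_⟩
  rw [hasFiniteIntegral_iff_ofReal (Filter.Eventually.of_forall fun ρ =>
    mul_nonneg (pker_nonneg hs.le _) (pker_nonneg ht.le _)), h]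
  exact ENNReal.ofReal_lt_top

theorem integral_pker_conv {s t : ℝ} (hs : 0 < s) (ht : 0 < t) (r : ℝ) :
    ∫ ρ, pker s (r - ρ) * pker t ρ = pker (s + t) r := by
  rw [integral_eq_lintegral_of_nonneg_ae (Filter.Eventually.of_forall fun ρ =>
    mul_nonneg (pker_nonneg hs.le _) (pker_nonneg ht.le _))
    (integrable_pker_conv hs ht r).aestronglyMeasurable, lintegral_pker_conv hs ht,
    ENNReal.toReal_ofReal (pker_nonneg (by linarith) r)]

theorem iteratedDeriv_pkd_add (m k : ℕ) {s : ℝ} (hs : 0 < s) {t : ℝ} (ht : 0 < t) (r : ℝ) :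
    iteratedDeriv k (fun s => pkd m (s + t) r) s = pkd (m + k) (s + t) r :=
  iteratedDeriv_eq_of_hasDerivAt (G := fun k s => pkd (m + k) (s + t) r)
    (fun _ _ => rfl) (fun k s hs => by
      have h := (hasDerivAt_pkd (m + k) (add_pos hs ht) r).comp_add_const s t
      exact h) k hs

/-- `(∂_s^k w_s) * (∂_t^m w_t) = (∂^{m+k} w)_{s+t}`, obtained by differentiating
`w_s * w_t = w_{s+t}` in each parameter. -/
theorem integral_pkd_conv (k m : ℕ) {s t : ℝ} (hs : 0 < s) (ht : 0 < t) (r : ℝ) :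
    ∫ ρ, pkd k s ρ * pkd m t (r - ρ) = pkd (m + k) (s + t) r := by
  have h1 : ∀ s, 0 < s → PkIntegrable fun ρ => pker s (r - ρ) := fun s hs =>
    ⟨((measurable_pker_right s).comp (measurable_const.sub measurable_id)).aestronglyMeasurable,
      fun t ht => by simpa only [mul_comm] using integrable_pker_conv hs ht r⟩
  have h2 : ∀ s, 0 < s → ∫ ρ, pkd m t ρ * pker s (r - ρ) = pkd m (s + t) r := fun s hs => by
    rw [← (h1 s hs).iteratedDeriv_eq (f := fun t => pker (s + t) r)
      (fun t ht => by simp only [← integral_pker_conv hs ht, mul_comm]) m ht]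
    have h3 := iteratedDeriv_pkd_add 0 m ht hs r
    simp only [pkd_zero, zero_add] at h3
    simpa only [add_comm] using h3
  have h4 : PkIntegrable fun ρ => pkd m t (r - ρ) :=
    ⟨((measurable_pkd_right m t).comp (measurable_const.sub measurable_id)).aestronglyMeasurable,
      fun s hs => by
        have h5 := ((h1 s hs).integrable_pkd m ht).comp_sub_left r
        simpa only [sub_sub_cancel, mul_comm] using h5⟩
  rw [← h4.iteratedDeriv_eq (f := fun s => pkd m (s + t) r) (fun s hs => ?_) k hs]
  · exact iteratedDeriv_pkd_add m k hs ht r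
  · rw [← h2 s hs, ← integral_sub_left_eq_self _ _ r]
    simp only [sub_sub_cancel, mul_comm]

/-! ### The subordinated measures are dominated by the maximal function -/

/-- The one-sided stable law `w_t(r) dr`, so that `P_t = ∫ T_r d(pois t)(r)`. -/
def pois (t : ℝ) : Measure ℝ := volume.withDensity fun r => ENNReal.ofReal (pker t r)

instance sFinite_pois (t : ℝ) : SFinite (pois t) := by
  unfold pois
  infer_instance

theorem isProbabilityMeasure_pois {t : ℝ} (ht : 0 < t) : IsProbabilityMeasure (pois t) := by
  refine ⟨?_⟩
  rw [pois, withDensity_apply _ MeasurableSet.univ, Measure.restrict_univ, lintegral_pker ht]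

theorem ae_pois_pos (t : ℝ) : ∀ᵐ r ∂(pois t), 0 < r := by
  rw [pois, ae_withDensity_iff (measurable_pker_right t).ennreal_ofReal]
  refine Filter.Eventually.of_forall fun r hr => ?_
  by_contra hc
  exact hr (by rw [pker_of_nonpos t (not_lt.1 hc), ENNReal.ofReal_zero])

variable {d : ℕ}

theorem mix_pois (t : ℝ) (F : EuclideanSpace ℝ (Fin d) → ℝ≥0∞) (x : EuclideanSpace ℝ (Fin d)) :
    mix (pois t) F x = ∫⁻ r, ENNReal.ofReal (pker t r) * ouL r F x := by
  rw [mix, pois, lintegral_withDensity_eq_lintegral_mul_non_measurable _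
    (measurable_pker_right t).ennreal_ofReal (Filter.Eventually.of_forall fun _ =>
      ENNReal.ofReal_lt_top)]
  rfl

/-- A stable density at scale `t² ≈ 2^J` is dominated by a geometrically weighted sum of uniform
densities on the intervals `(0, 2^{J+n}]`. -/
theorem exists_pker_le_uniform {t : ℝ} (ht : 0 < t) : ∃ J : ℤ, ∀ r : ℝ, 0 < r → ∃ n : ℕ,
    r ≤ 2 ^ (J + n) ∧ pker t r ≤ 18 * √(1 / 2) ^ n * ((2 : ℝ) ^ (J + n))⁻¹ := by
  obtain ⟨j, hj1, hj2⟩ := exists_mem_Ioc_zpow (pow_pos ht 2) (one_lt_two (α := ℝ))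
  refine ⟨j + 1, fun r hr => ?_⟩
  have hπ : 1 ≤ √Real.pi := Real.one_le_sqrt.2 (by linarith [Real.pi_gt_three])
  have hsr : 0 < √r := Real.sqrt_pos.2 hr
  have hsr2 : √r ^ 2 = r := Real.sq_sqrt hr.le
  have hcoef : t / (2 * √Real.pi) ≤ t / 2 := by gcongr; linarith
  rcases le_or_gt r (2 ^ (j + 1)) with hle | hgt
  · refine ⟨0, by simpa using hle, ?_⟩
    simp only [pow_zero, mul_one, Nat.cast_zero, add_zero]
    set y := t / √r with hy
    have hy0 : 0 < y := by positivity
    have hyr : y ^ 2 = t ^ 2 / r := by rw [hy, div_pow, hsr2]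
    have he : t ^ 2 / (4 * r) = y ^ 2 / 4 := by rw [hyr]; field_simp
    have hexp : y ^ 3 * Real.exp (-(y ^ 2 / 4)) ≤ 18 := by
      have h1 := Real.quadratic_le_exp_of_nonneg (x := y ^ 2 / 4) (by positivity)
      rw [Real.exp_neg, ← div_eq_mul_inv, div_le_iff₀ (Real.exp_pos _)]
      have h2 : y ^ 3 ≤ (y ^ 2 + y ^ 4) / 2 := by nlinarith [sq_nonneg (y ^ 2 - y)]
      nlinarith
    calc pker t r ≤ t / 2 * (r * √r)⁻¹ * Real.exp (-(t ^ 2 / (4 * r))) := by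
          unfold pker
          gcongr
      _ = (y ^ 3 * Real.exp (-(y ^ 2 / 4))) / (2 * t ^ 2) := by
          rw [he]
          have : t / 2 * (r * √r)⁻¹ = y ^ 3 / (2 * t ^ 2) := by
            rw [hy, ← hsr2, Real.sqrt_sq hsr.le]
            field_simp
          rw [this]
          ring
      _ ≤ 18 / (2 * t ^ 2) := by gcongr
      _ ≤ 18 * ((2 : ℝ) ^ (j + 1))⁻¹ := by
          rw [div_eq_mul_inv]
          gcongr
          rw [zpow_add_one₀ two_ne_zero]
          linarith
  · obtain ⟨i, hi1, hi2⟩ := exists_mem_Ioc_zpow hr (one_lt_two (α := ℝ))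
    have hij : j + 1 ≤ i := by
      have h := hgt.trans_le hi2
      have := (zpow_lt_zpow_iff_right₀ (one_lt_two (α := ℝ))).1 h
      omega
    obtain ⟨n, hn⟩ := Int.eq_ofNat_of_zero_le (a := i - j) (by omega)
    have hn' : j + 1 + (n : ℤ) = i + 1 := by omega
    refine ⟨n, by rw [hn']; exact hi2, ?_⟩
    rw [hn']
    have h2i : (0 : ℝ) < 2 ^ i := by positivity
    have h1 : (r * √r)⁻¹ ≤ (2 ^ i * √(2 ^ i))⁻¹ := by gcongr
    have h2 : t ≤ √(2 ^ (j + 1)) := Real.le_sqrt_of_sq_le hj2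
    have h3 : √((2 : ℝ) ^ (j + 1)) = √2 * √(1 / 2) ^ n * √(2 ^ i) := by
      rw [← Real.sqrt_sq (show 0 ≤ √2 * √(1 / 2) ^ n * √(2 ^ i) by positivity)]
      congr 1
      rw [mul_pow, mul_pow, ← pow_mul, mul_comm n 2, pow_mul, Real.sq_sqrt h2i.le,
        Real.sq_sqrt zero_le_two, Real.sq_sqrt (by norm_num)]
      have : i = j + n := by omega
      rw [this, zpow_add_one₀ two_ne_zero, zpow_add₀ two_ne_zero, zpow_natCast, one_div, inv_pow]
      field_simp
    have h2s : √(2 : ℝ) ≤ 2 := Real.sqrt_le_iff.2 ⟨by norm_num, by norm_num⟩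
    calc pker t r ≤ t / 2 * (r * √r)⁻¹ * 1 := by
          unfold pker
          gcongr
          rw [Real.exp_le_one_iff]
          simp only [Left.neg_nonpos_iff]
          positivity
      _ ≤ √(2 ^ (j + 1)) / 2 * (2 ^ i * √(2 ^ i))⁻¹ * 1 := by gcongr
      _ = √2 * √(1 / 2) ^ n * ((2 : ℝ) ^ (i + 1))⁻¹ := by
          rw [h3, zpow_add_one₀ two_ne_zero]
          have : √((2 : ℝ) ^ i) ≠ 0 := (Real.sqrt_pos.2 h2i).ne'
          field_simp
      _ ≤ 18 * √(1 / 2) ^ n * ((2 : ℝ) ^ (i + 1))⁻¹ := by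
          gcongr
          linarith

/-- The constant in `P_t F ≤ C sup_j 2^{-j} ∫_0^{2^j} T_r F dr`. -/
def poisConst : ℝ≥0∞ := ∑' n : ℕ, ENNReal.ofReal (18 * √(1 / 2) ^ n)

theorem poisConst_ne_top : poisConst ≠ ∞ := by
  unfold poisConst
  simp only [ENNReal.ofReal_mul (show (0 : ℝ) ≤ 18 by norm_num),
    ENNReal.ofReal_pow (Real.sqrt_nonneg _)]
  rw [ENNReal.tsum_mul_left, ENNReal.tsum_geometric]
  refine ENNReal.mul_ne_top ENNReal.ofReal_ne_top (ENNReal.inv_ne_top.2 ?_)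
  refine (tsub_pos_of_lt ?_).ne'
  rw [ENNReal.ofReal_lt_one, Real.sqrt_lt' one_pos]
  norm_num

/-- Averaging the domination of `w_t` by uniform densities over dyadic intervals bounds `P_t F` by
the ergodic maximal function, uniformly in `t`. -/
theorem mix_pois_le_maxFun {t : ℝ} (ht : 0 < t) {F : EuclideanSpace ℝ (Fin d) → ℝ≥0∞}
    (hF : Measurable F) (x : EuclideanSpace ℝ (Fin d)) :
    mix (pois t) F x ≤ poisConst * maxFun F x := by
  obtain ⟨J, hJ⟩ := exists_pker_le_uniform ht
  have hF' := measurable_ouL_time hF x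
  rw [mix_pois]
  calc ∫⁻ r, ENNReal.ofReal (pker t r) * ouL r F x
      ≤ ∫⁻ r, ∑' n : ℕ, ENNReal.ofReal (18 * √(1 / 2) ^ n * ((2 : ℝ) ^ (J + n))⁻¹) *
          (Ioc 0 ((2 : ℝ) ^ (J + n))).indicator (fun r => ouL r F x) r := by
        refine lintegral_mono fun r => ?_
        rcases le_or_gt r 0 with hr | hr
        · simp [pker_of_nonpos t hr]
        · obtain ⟨n, hn1, hn2⟩ := hJ r hr
          refine le_trans ?_ (ENNReal.le_tsum n)
          rw [indicator_of_mem (by exact ⟨hr, hn1⟩)]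
          gcongr
    _ = ∑' n : ℕ, ENNReal.ofReal (18 * √(1 / 2) ^ n * ((2 : ℝ) ^ (J + n))⁻¹) *
          ∫⁻ r in Ioc 0 ((2 : ℝ) ^ (J + n)), ouL r F x := by
        rw [lintegral_tsum fun n => ((hF'.indicator measurableSet_Ioc).const_mul _).aemeasurable]
        refine tsum_congr fun n => ?_
        rw [lintegral_const_mul' _ _ ENNReal.ofReal_ne_top, lintegral_indicator measurableSet_Ioc]
    _ = ∑' n : ℕ, ENNReal.ofReal (18 * √(1 / 2) ^ n) * mix (unif (2 ^ (J + n))) F x := by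
        refine tsum_congr fun n => ?_
        rw [mix_unif, ENNReal.ofReal_mul (by positivity), ENNReal.ofReal_inv_of_pos (by positivity),
          mul_assoc]
    _ ≤ ∑' n : ℕ, ENNReal.ofReal (18 * √(1 / 2) ^ n) * maxFun F x := by
        gcongr with n
        exact le_iSup (fun j : ℤ => mix (unif (2 ^ j)) F x) (J + n)
    _ = _ := by rw [ENNReal.tsum_mul_right, poisConst]

end

section

/-! ### Subordinated operators on real-valued functions -/

variable {d : ℕ}

theorem stronglyMeasurable_ou {f : EuclideanSpace ℝ (Fin d) → ℝ} (hf : Measurable f) :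
    StronglyMeasurable fun z : ℝ × EuclideanSpace ℝ (Fin d) => ornsteinUhlenbeck z.1 f z.2 := by
  unfold ornsteinUhlenbeck
  have h : Measurable fun z : (ℝ × EuclideanSpace ℝ (Fin d)) × EuclideanSpace ℝ (Fin d) =>
      f (√(1 - Real.exp (-2 * z.1.1)) • z.2 + Real.exp (-z.1.1) • z.1.2) := by fun_prop
  exact h.stronglyMeasurable.integral_prod_right'

theorem measurable_ou_time {f : EuclideanSpace ℝ (Fin d) → ℝ} (hf : Measurable f)
    (x : EuclideanSpace ℝ (Fin d)) : Measurable fun r => ornsteinUhlenbeck r f x := by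
  have h := (stronglyMeasurable_ou hf).measurable.comp (measurable_prodMk_right (y := x))
  exact h

theorem enorm_ou_le (f : EuclideanSpace ℝ (Fin d) → ℝ) (r : ℝ) (x : EuclideanSpace ℝ (Fin d)) :
    ‖ornsteinUhlenbeck r f x‖ₑ ≤ ouL r (fun y => ‖f y‖ₑ) x :=
  enorm_integral_le_lintegral_enorm _

theorem map_prod_ou {s t : ℝ} (hs : 0 ≤ s) (ht : 0 ≤ t) (x : EuclideanSpace ℝ (Fin d)) :
    Measure.map (fun z : EuclideanSpace ℝ (Fin d) × EuclideanSpace ℝ (Fin d) =>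
        √(1 - Real.exp (-2 * t)) • z.2 +
        Real.exp (-t) • (√(1 - Real.exp (-2 * s)) • z.1 + Real.exp (-s) • x))
        ((gaussian d).prod (gaussian d)) =
      Measure.map (fun u => √(1 - Real.exp (-2 * (s + t))) • u + Real.exp (-(s + t)) • x)
        (gaussian d) := by
  refine Measure.ext_of_lintegral _ fun F hF => ?_
  rw [lintegral_map hF (by fun_prop), lintegral_map hF (by fun_prop), lintegral_prod_ou hF hs ht]
  rfl

theorem ou_ou {f : EuclideanSpace ℝ (Fin d) → ℝ} (hf : Measurable f) {s t : ℝ} (hs : 0 ≤ s)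
    (ht : 0 ≤ t) {x : EuclideanSpace ℝ (Fin d)} (h : ouL (s + t) (fun y => ‖f y‖ₑ) x ≠ ∞) :
    ornsteinUhlenbeck s (ornsteinUhlenbeck t f) x = ornsteinUhlenbeck (s + t) f x := by
  have hmap := map_prod_ou hs ht x
  have h1 : ornsteinUhlenbeck (s + t) f x = ∫ z, f (√(1 - Real.exp (-2 * t)) • z.2 +
        Real.exp (-t) • (√(1 - Real.exp (-2 * s)) • z.1 + Real.exp (-s) • x))
        ∂((gaussian d).prod (gaussian d)) := by
    rw [ornsteinUhlenbeck, ← integral_map (f := f) (by fun_prop) hf.aestronglyMeasurable, ← hmap,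
      integral_map (by fun_prop) hf.aestronglyMeasurable]
  rw [h1, integral_prod]
  · rfl
  · refine ⟨(by fun_prop : Measurable _).aestronglyMeasurable, ?_⟩
    rw [hasFiniteIntegral_iff_enorm, lintegral_prod_ou (F := fun y => ‖f y‖ₑ) (by fun_prop) hs ht]
    exact lt_top_iff_ne_top.2 h

/-- The operator `∂_t^m P_t`, written as an integral of the Ornstein-Uhlenbeck semigroup. -/
def dP (m : ℕ) (t : ℝ) (f : EuclideanSpace ℝ (Fin d) → ℝ) (x : EuclideanSpace ℝ (Fin d)) : ℝ :=
  ∫ r, pkd m t r * ornsteinUhlenbeck r f x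

theorem poissonHermite_eq {t : ℝ} (ht : 0 < t) (f : EuclideanSpace ℝ (Fin d) → ℝ)
    (x : EuclideanSpace ℝ (Fin d)) :
    poissonHermite t f x = ∫ r, pker t r * ornsteinUhlenbeck r f x := by
  have ht4 : 0 < t ^ 2 / 4 := by positivity
  have himg : (fun s => (t ^ 2 / 4) / s) '' Ioi (0 : ℝ) = Ioi 0 := by
    ext y
    constructor
    · rintro ⟨s, hs, rfl⟩
      exact div_pos ht4 hs
    · intro hy
      exact ⟨(t ^ 2 / 4) / y, div_pos ht4 hy, by
        have : y ≠ 0 := ne_of_gt hy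
        field_simp⟩
  have h := integral_image_eq_integral_abs_deriv_smul (s := Ioi (0 : ℝ))
    (f := fun s => (t ^ 2 / 4) / s)
    (f' := fun s => -((t ^ 2 / 4) / s ^ 2)) measurableSet_Ioi (fun s hs => by
      have hs0 : s ≠ 0 := ne_of_gt hs
      have h1 := ((hasDerivAt_id s).fun_inv hs0).const_mul (t ^ 2 / 4)
      simp only [id, ← div_eq_mul_inv] at h1
      refine (h1.congr_deriv ?_).hasDerivWithinAt
      ring) (fun (a : ℝ) ha (b : ℝ) hb hab => by
      have ha0 : a ≠ 0 := ne_of_gt ha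
      have hb0 : b ≠ 0 := ne_of_gt hb
      simp only at hab
      field_simp at hab
      exact hab.symm)
    (fun u => Real.exp (-u) / √u * ornsteinUhlenbeck (t ^ 2 / (4 * u)) f x)
  rw [himg] at h
  rw [poissonHermite, h, ← integral_const_mul]
  rw [← setIntegral_eq_integral_of_forall_compl_eq_zero (s := Ioi (0 : ℝ))
    (f := fun r => pker t r * ornsteinUhlenbeck r f x)
    (fun r hr => by simp [pker_of_nonpos t (not_lt.1 hr)])]
  refine setIntegral_congr_fun measurableSet_Ioi fun r hr => ?_
  have hr' : 0 < r := hr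
  have hsr : 0 < √r := Real.sqrt_pos.2 hr'
  have hsr2 : √r ^ 2 = r := Real.sq_sqrt hr'.le
  have h1 : t ^ 2 / (4 * (t ^ 2 / 4 / r)) = r := by field_simp
  have h2 : √(t ^ 2 / 4 / r) = t / 2 / √r := by
    rw [Real.sqrt_div (by positivity), show t ^ 2 / 4 = (t / 2) ^ 2 by ring,
      Real.sqrt_sq (by positivity)]
  have h3 : t ^ 2 / 4 / r = t ^ 2 / (4 * r) := by field_simp
  simp only [smul_eq_mul, abs_neg]
  rw [h1, h2, h3, abs_of_nonneg (by positivity), pker]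
  have h4 : 1 / √Real.pi * (t ^ 2 / 4 / r ^ 2 * (Real.exp (-(t ^ 2 / (4 * r))) / (t / 2 / √r))) =
      t / (2 * √Real.pi) * (r * √r)⁻¹ * Real.exp (-(t ^ 2 / (4 * r))) := by
    field_simp
    rw [hsr2]
    ring
  rw [← h4]
  ring

/-- The points `x` at which all `P_t |f|(x)`, `t > 0`, are finite. At such points `P_t f(x)` is smooth
in `t` and the semigroup identities hold for every `t`; almost every point is good. -/
def IsGood (f : EuclideanSpace ℝ (Fin d) → ℝ) (x : EuclideanSpace ℝ (Fin d)) : Prop :=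
  ∀ t, 0 < t → mix (pois t) (fun y => ‖f y‖ₑ) x ≠ ∞

theorem mix_pois_le_mul {a t : ℝ} (ha : 0 < a) (hat : a ≤ t)
    (F : EuclideanSpace ℝ (Fin d) → ℝ≥0∞) (x : EuclideanSpace ℝ (Fin d)) :
    mix (pois t) F x ≤ ENNReal.ofReal (t / a) * mix (pois a) F x := by
  rw [mix_pois, mix_pois, ← lintegral_const_mul' _ _ ENNReal.ofReal_ne_top]
  refine lintegral_mono fun r => ?_
  rw [← mul_assoc, ← ENNReal.ofReal_mul (div_nonneg (ha.le.trans hat) ha.le)]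
  gcongr
  exact pker_le_of_le ha hat le_rfl r

/-- By `mix_pois_le_mul` it suffices that `P_t |f|` is finite along a sequence of times tending
to `0`. -/
theorem ae_isGood {f : EuclideanSpace ℝ (Fin d) → ℝ} (hf : Measurable f)
    (hfi : ∫⁻ x, ‖f x‖ₑ ∂(gaussian d) ≠ ∞) : ∀ᵐ x ∂(gaussian d), IsGood f x := by
  have h : ∀ n : ℕ, ∀ᵐ x ∂(gaussian d),
      mix (pois (1 / ((n : ℝ) + 1))) (fun y => ‖f y‖ₑ) x < ∞ := fun n => by
    have hn : 0 < 1 / ((n : ℝ) + 1) := by positivity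
    refine ae_lt_top (by fun_prop) ?_
    have := isProbabilityMeasure_pois hn
    rwa [lintegral_mix ((ae_pois_pos _).mono fun r hr => hr.le) (by fun_prop), measure_univ,
      one_mul]
  filter_upwards [ae_all_iff.2 h] with x hx t ht
  obtain ⟨n, hn⟩ := exists_nat_one_div_lt ht
  exact ne_top_of_le_ne_top (ENNReal.mul_ne_top ENNReal.ofReal_ne_top (hx n).ne)
    (mix_pois_le_mul (by positivity) hn.le _ x)

theorem IsGood.pkIntegrable {f : EuclideanSpace ℝ (Fin d) → ℝ} (hf : Measurable f)
    {x : EuclideanSpace ℝ (Fin d)} (hx : IsGood f x) :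
    PkIntegrable fun r => ornsteinUhlenbeck r f x where
  meas := (measurable_ou_time hf x).aestronglyMeasurable
  integrable t ht := by
    refine ⟨((measurable_pker_right t).mul (measurable_ou_time hf x)).aestronglyMeasurable, ?_⟩
    rw [hasFiniteIntegral_iff_enorm]
    refine lt_of_le_of_lt ?_ (lt_top_iff_ne_top.2 (hx t ht))
    rw [mix_pois]
    refine lintegral_mono fun r => ?_
    rw [enorm_mul, Real.enorm_of_nonneg (pker_nonneg ht.le r)]
    gcongr
    exact enorm_ou_le f r x

theorem IsGood.iteratedDeriv_eq {f : EuclideanSpace ℝ (Fin d) → ℝ} (hf : Measurable f)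
    {x : EuclideanSpace ℝ (Fin d)} (hx : IsGood f x) (m : ℕ) {t : ℝ} (ht : 0 < t) :
    iteratedDeriv m (fun s => poissonHermite s f x) t = dP m t f x :=
  (hx.pkIntegrable hf).iteratedDeriv_eq (fun _ ht => poissonHermite_eq ht f x) m ht

theorem exists_enorm_pkd_le (m : ℕ) : ∃ C : ℝ, 0 ≤ C ∧ ∀ t : ℝ, 0 < t → ∀ r,
    ‖pkd m t r‖ₑ ≤ ENNReal.ofReal (C / t ^ m) * ENNReal.ofReal (pker (t / 2) r) := by
  obtain ⟨C, hC, hb⟩ := exists_abs_pkd_le m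
  refine ⟨C, hC, fun t ht r => ?_⟩
  rw [← ENNReal.ofReal_mul (by positivity), Real.enorm_eq_ofReal_abs]
  exact ENNReal.ofReal_le_ofReal (hb t ht r)

theorem exists_lintegral_enorm_pkd_le (m : ℕ) : ∃ C : ℝ, 0 ≤ C ∧ ∀ t : ℝ, 0 < t →
    ∀ F : EuclideanSpace ℝ (Fin d) → ℝ≥0∞, ∀ x,
    ∫⁻ r, ‖pkd m t r‖ₑ * ouL r F x ≤
      ENNReal.ofReal (C / t ^ m) * mix (pois (t / 2)) F x := by
  obtain ⟨C, hC, hb⟩ := exists_enorm_pkd_le m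
  refine ⟨C, hC, fun t ht F x => ?_⟩
  rw [mix_pois, ← lintegral_const_mul' _ _ ENNReal.ofReal_ne_top]
  refine lintegral_mono fun r => ?_
  rw [← mul_assoc]
  gcongr
  exact hb t ht r

theorem enorm_dP_le (m : ℕ) (t : ℝ) (f : EuclideanSpace ℝ (Fin d) → ℝ)
    (x : EuclideanSpace ℝ (Fin d)) :
    ‖dP m t f x‖ₑ ≤ ∫⁻ r, ‖pkd m t r‖ₑ * ouL r (fun y => ‖f y‖ₑ) x := by
  refine (enorm_integral_le_lintegral_enorm _).trans (lintegral_mono fun r => ?_)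
  rw [enorm_mul]
  gcongr
  exact enorm_ou_le f r x

theorem measurable_dP (m : ℕ) {f : EuclideanSpace ℝ (Fin d) → ℝ} (hf : Measurable f) :
    Measurable fun z : ℝ × EuclideanSpace ℝ (Fin d) => dP m z.1 f z.2 := by
  have h1 : Measurable fun z : (ℝ × EuclideanSpace ℝ (Fin d)) × ℝ => pkd m z.1.1 z.2 :=
    (measurable_pkd m).comp (f := fun z : (ℝ × EuclideanSpace ℝ (Fin d)) × ℝ => (z.1.1, z.2))
      (by fun_prop)
  have h2 : Measurable fun z : (ℝ × EuclideanSpace ℝ (Fin d)) × ℝ =>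
      ornsteinUhlenbeck z.2 f z.1.2 :=
    (stronglyMeasurable_ou hf).measurable.comp
      (f := fun z : (ℝ × EuclideanSpace ℝ (Fin d)) × ℝ => (z.2, z.1.2)) (by fun_prop)
  exact ((h1.mul h2).stronglyMeasurable.integral_prod_right').measurable

theorem measurable_dP_right (m : ℕ) (t : ℝ) {f : EuclideanSpace ℝ (Fin d) → ℝ}
    (hf : Measurable f) : Measurable (dP m t f) := by
  have h := (measurable_dP m hf).comp (measurable_prodMk_left (x := t))
  exact h

theorem integrable_pkd_prod (m : ℕ) {f : EuclideanSpace ℝ (Fin d) → ℝ} (hf : Measurable f)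
    {t : ℝ} (ht : 0 < t) {x : EuclideanSpace ℝ (Fin d)}
    (hx : mix (pois (t / 2)) (fun y => ‖f y‖ₑ) x ≠ ∞) :
    Integrable (fun z : ℝ × EuclideanSpace ℝ (Fin d) => pkd m t z.1 *
      f (√(1 - Real.exp (-2 * z.1)) • z.2 + Real.exp (-z.1) • x)) (volume.prod (gaussian d)) := by
  obtain ⟨C, hC, hb⟩ := exists_lintegral_enorm_pkd_le (d := d) m
  have hm := measurable_pkd_right m t
  have hmeas : Measurable (fun z : ℝ × EuclideanSpace ℝ (Fin d) => pkd m t z.1 *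
      f (√(1 - Real.exp (-2 * z.1)) • z.2 + Real.exp (-z.1) • x)) :=
    (hm.comp measurable_fst).mul (by fun_prop)
  refine ⟨hmeas.aestronglyMeasurable, ?_⟩
  rw [hasFiniteIntegral_iff_enorm, lintegral_prod _ (by fun_prop)]
  refine lt_of_le_of_lt (le_of_eq_of_le (lintegral_congr fun r => ?_)
    (hb t ht (fun y => ‖f y‖ₑ) x)) (ENNReal.mul_lt_top ENNReal.ofReal_lt_top
      (lt_top_iff_ne_top.2 hx))
  simp only [enorm_mul]
  rw [lintegral_const_mul _ (by fun_prop)]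
  rfl

/-- `∂_t^m P_t f(x)` as an integral over the product of time and Gauss space. -/
theorem dP_eq_integral_prod (m : ℕ) {f : EuclideanSpace ℝ (Fin d) → ℝ} (hf : Measurable f)
    {t : ℝ} (ht : 0 < t) {x : EuclideanSpace ℝ (Fin d)}
    (hx : mix (pois (t / 2)) (fun y => ‖f y‖ₑ) x ≠ ∞) :
    dP m t f x = ∫ z, pkd m t z.1 *
      f (√(1 - Real.exp (-2 * z.1)) • z.2 + Real.exp (-z.1) • x) ∂(volume.prod (gaussian d)) := by
  rw [integral_prod _ (integrable_pkd_prod m hf ht hx)]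
  simp only [integral_const_mul]
  rfl

theorem lintegral_pkd_shift_ne_top {F : EuclideanSpace ℝ (Fin d) → ℝ≥0∞} (hF : Measurable F)
    {x : EuclideanSpace ℝ (Fin d)} (hx : ∀ t, 0 < t → mix (pois t) F x ≠ ∞) (k m : ℕ) {s t : ℝ}
    (hs : 0 < s) (ht : 0 < t) :
    ∫⁻ r, ∫⁻ ρ, ‖pkd k s r‖ₑ * ‖pkd m t (ρ - r)‖ₑ * ouL ρ F x ≠ ∞ := by
  obtain ⟨C, hC, hb⟩ := exists_enorm_pkd_le k
  obtain ⟨D, hD, hb'⟩ := exists_enorm_pkd_le m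
  have hFm := measurable_ouL_time hF x
  have h1 := measurable_pker_right (s / 2)
  have h2 := measurable_pker_right (t / 2)
  set K := ENNReal.ofReal (C / s ^ k) * ENNReal.ofReal (D / t ^ m) with hK
  have hKt : K ≠ ∞ := ENNReal.mul_ne_top ENNReal.ofReal_ne_top ENNReal.ofReal_ne_top
  refine ne_top_of_le_ne_top (b := K * mix (pois (t / 2 + s / 2)) F x)
    (ENNReal.mul_ne_top hKt (hx _ (by positivity))) ?_
  have hmeas2 : Measurable fun z : ℝ × ℝ => pker (t / 2) (z.2 - z.1) :=
    h2.comp (measurable_snd.sub measurable_fst)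
  calc ∫⁻ r, ∫⁻ ρ, ‖pkd k s r‖ₑ * ‖pkd m t (ρ - r)‖ₑ * ouL ρ F x
      ≤ ∫⁻ r, ∫⁻ ρ, K * (ENNReal.ofReal (pker (t / 2) (ρ - r) * pker (s / 2) r) * ouL ρ F x) := by
        refine lintegral_mono fun r => lintegral_mono fun ρ => ?_
        refine (mul_le_mul' (mul_le_mul' (hb s hs r) (hb' t ht (ρ - r))) le_rfl).trans_eq ?_
        rw [hK, ENNReal.ofReal_mul (pker_nonneg (by positivity) _)]
        ring
    _ = ∫⁻ ρ, ∫⁻ r, K * (ENNReal.ofReal (pker (t / 2) (ρ - r) * pker (s / 2) r) * ouL ρ F x) :=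
        lintegral_lintegral_swap (by
          refine Measurable.aemeasurable ?_
          exact (((hmeas2.mul (h1.comp measurable_fst)).ennreal_ofReal).mul
            (hFm.comp measurable_snd)).const_mul K)
    _ = K * mix (pois (t / 2 + s / 2)) F x := by
        rw [mix_pois, ← lintegral_const_mul' _ _ hKt]
        refine lintegral_congr fun ρ => ?_
        have h3 : Measurable fun r => ENNReal.ofReal (pker (t / 2) (ρ - r) * pker (s / 2) r) :=
          ((h2.comp (measurable_const.sub measurable_id)).mul h1).ennreal_ofReal
        rw [lintegral_const_mul' _ _ hKt, lintegral_mul_const _ h3]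
        congr 2
        exact lintegral_pker_conv (by positivity) (by positivity) ρ

/-- `∂_s^k P_s (∂_t^m P_t f) = (∂^{k+m} P)_{s+t} f` at good points. -/
theorem dP_dP {f : EuclideanSpace ℝ (Fin d) → ℝ} (hf : Measurable f)
    {x : EuclideanSpace ℝ (Fin d)} (hx : IsGood f x) (k m : ℕ) {s t : ℝ} (hs : 0 < s)
    (ht : 0 < t) : dP k s (dP m t f) x = dP (m + k) (s + t) f x := by
  let F : EuclideanSpace ℝ (Fin d) → ℝ≥0∞ := fun y => ‖f y‖ₑ
  have hF : Measurable F := by fun_prop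
  have hfin := lintegral_pkd_shift_ne_top hF hx k m hs ht
  have hk := measurable_pkd_right k s
  have hm := measurable_pkd_right m t
  have hFm := measurable_ouL_time hF x
  have hfm := measurable_ou_time hf x
  have hmeas2 : Measurable fun z : ℝ × ℝ => pkd m t (z.2 - z.1) :=
    hm.comp (measurable_snd.sub measurable_fst)
  -- Fubini for the double time integral
  have hI : Integrable (fun z : ℝ × ℝ => pkd k s z.1 * pkd m t (z.2 - z.1) *
      ornsteinUhlenbeck z.2 f x) (volume.prod volume) := by
    refine ⟨(((hk.comp measurable_fst).mul hmeas2).mul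
      (hfm.comp measurable_snd)).aestronglyMeasurable, ?_⟩
    rw [hasFiniteIntegral_iff_enorm, lintegral_prod _ (by
      exact (((hk.comp measurable_fst).mul hmeas2).mul
        (hfm.comp measurable_snd)).enorm.aemeasurable)]
    refine lt_of_le_of_lt (lintegral_mono fun r => lintegral_mono fun ρ => ?_)
      (lt_top_iff_ne_top.2 hfin)
    simp only [enorm_mul]
    gcongr
    exact enorm_ou_le f ρ x
  have hae : ∀ᵐ r, ∫⁻ ρ, ‖pkd k s r‖ₑ * ‖pkd m t (ρ - r)‖ₑ * ouL ρ F x < ∞ := by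
    refine ae_lt_top (Measurable.lintegral_prod_right' (f := fun z : ℝ × ℝ =>
      ‖pkd k s z.1‖ₑ * ‖pkd m t (z.2 - z.1)‖ₑ * ouL z.2 F x) ?_) hfin
    exact ((hk.comp measurable_fst).enorm.mul hmeas2.enorm).mul (hFm.comp measurable_snd)
  have hinner : ∀ᵐ r, pkd k s r * ornsteinUhlenbeck r (dP m t f) x =
      ∫ ρ, pkd k s r * pkd m t (ρ - r) * ornsteinUhlenbeck ρ f x := by
    filter_upwards [hae] with r hr
    by_cases h0 : pkd k s r = 0
    · simp [h0]
    have hrpos : 0 < r := by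
      by_contra hc
      exact h0 (by simp [pkd, pker_of_nonpos s (not_lt.1 hc)])
    have h0' : ‖pkd k s r‖ₑ ≠ 0 := by simpa using h0
    have hr2 : ∫⁻ ρ, ‖pkd m t ρ‖ₑ * ouL (r + ρ) F x < ∞ := by
      have h1 : ∫⁻ ρ, ‖pkd k s r‖ₑ * ‖pkd m t (ρ - r)‖ₑ * ouL ρ F x =
          ‖pkd k s r‖ₑ * ∫⁻ ρ, ‖pkd m t ρ‖ₑ * ouL (r + ρ) F x := by
        rw [← lintegral_add_left_eq_self _ r, ← lintegral_const_mul' _ _ enorm_ne_top]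
        refine lintegral_congr fun ρ => ?_
        rw [add_sub_cancel_left, mul_assoc]
      rw [h1] at hr
      exact ENNReal.lt_top_of_mul_ne_top_right hr.ne h0'
    have hou : ornsteinUhlenbeck r (dP m t f) x =
        ∫ ρ, pkd m t ρ * ornsteinUhlenbeck (r + ρ) f x := by
      have hmu : Measurable fun z : EuclideanSpace ℝ (Fin d) × ℝ => pkd m t z.2 *
          ornsteinUhlenbeck z.2 f (√(1 - Real.exp (-2 * r)) • z.1 + Real.exp (-r) • x) :=
        (hm.comp measurable_snd).mul ((stronglyMeasurable_ou hf).measurable.comp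
          (f := fun z : EuclideanSpace ℝ (Fin d) × ℝ =>
            (z.2, √(1 - Real.exp (-2 * r)) • z.1 + Real.exp (-r) • x)) (by fun_prop))
      have hmuL : Measurable fun z : EuclideanSpace ℝ (Fin d) × ℝ => ‖pkd m t z.2‖ₑ *
          ouL z.2 F (√(1 - Real.exp (-2 * r)) • z.1 + Real.exp (-r) • x) :=
        (hm.comp measurable_snd).enorm.mul ((measurable_ouL_prod hF).comp
          (f := fun z : EuclideanSpace ℝ (Fin d) × ℝ =>
            (z.2, √(1 - Real.exp (-2 * r)) • z.1 + Real.exp (-r) • x)) (by fun_prop))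
      rw [ornsteinUhlenbeck]
      simp only [dP]
      rw [integral_integral_swap]
      · refine integral_congr_ae ?_
        have hae2 := ae_lt_top (by
          exact hm.enorm.mul (hFm.comp (measurable_const.add measurable_id))) hr2.ne
        filter_upwards [hae2] with ρ hρ
        rw [integral_const_mul]
        by_cases h1 : pkd m t ρ = 0
        · simp [h1]
        have hρpos : 0 < ρ := by
          by_contra hc
          exact h1 (by simp [pkd, pker_of_nonpos t (not_lt.1 hc)])
        congr 1
        refine ou_ou hf hrpos.le hρpos.le ?_
        exact (ENNReal.lt_top_of_mul_ne_top_right hρ.ne (by simpa using h1)).ne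
      · refine ⟨hmu.aestronglyMeasurable, ?_⟩
        rw [hasFiniteIntegral_iff_enorm]
        refine lt_of_le_of_lt (lintegral_mono (g := fun z : EuclideanSpace ℝ (Fin d) × ℝ =>
          ‖pkd m t z.2‖ₑ * ouL z.2 F (√(1 - Real.exp (-2 * r)) • z.1 + Real.exp (-r) • x))
          fun z => ?_) ?_
        · simp only [Function.uncurry, enorm_mul]
          gcongr
          exact enorm_ou_le f _ _
        · rw [lintegral_prod_symm _ hmuL.aemeasurable]
          refine lt_of_eq_of_lt (lintegral_congr fun ρ => ?_) hr2
          dsimp only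
          rw [lintegral_const_mul' _ _ enorm_ne_top]
          rcases le_or_gt ρ 0 with hρ | hρ
          · simp [pkd, pker_of_nonpos t hρ]
          · congr 1
            exact ouL_ouL hF hrpos.le hρ.le x
    rw [hou, ← integral_const_mul]
    refine Eq.trans (integral_congr_ae (Filter.Eventually.of_forall fun ρ => ?_))
      (integral_add_left_eq_self
        (fun ρ => pkd k s r * pkd m t (ρ - r) * ornsteinUhlenbeck ρ f x) r)
    simp only [add_sub_cancel_left, mul_assoc]
  rw [dP, integral_congr_ae hinner,
    integral_integral_swap (f := fun r ρ => pkd k s r * pkd m t (ρ - r) *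
      ornsteinUhlenbeck ρ f x) hI, dP]
  refine integral_congr_ae (Filter.Eventually.of_forall fun ρ => ?_)
  simp only
  rw [integral_mul_const, integral_pkd_conv k m hs ht]

/-- Functions equal almost everywhere have the same `∂_t^m P_t` for all `m` and `t`, outside one
null set. -/
theorem ae_dP_congr {f g : EuclideanSpace ℝ (Fin d) → ℝ} (hf : Measurable f) (hg : Measurable g)
    (h : f =ᵐ[gaussian d] g) : ∀ᵐ x ∂(gaussian d), (IsGood g x → IsGood f x) ∧
      ∀ m t, dP m t f x = dP m t g x := by
  let H : EuclideanSpace ℝ (Fin d) → ℝ≥0∞ := fun y => ‖f y - g y‖ₑ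
  have hH : Measurable H := by fun_prop
  have h1 : ∫⁻ x, mix (pois 1) H x ∂(gaussian d) = 0 := by
    rw [lintegral_mix ((ae_pois_pos _).mono fun r hr => hr.le) hH]
    have : ∫⁻ x, H x ∂(gaussian d) = 0 := by
      rw [lintegral_eq_zero_iff hH]
      filter_upwards [h] with x hx
      simp [H, hx]
    rw [this, mul_zero]
  rw [lintegral_eq_zero_iff (measurable_mix hH)] at h1
  filter_upwards [h1] with x hx
  have hx' : ∫⁻ r, ENNReal.ofReal (pker 1 r) * ouL r H x = 0 := by
    rw [← mix_pois]
    exact hx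
  have hHm := measurable_ouL_time hH x
  have hpk := measurable_pker_right 1
  have hm : Measurable fun r => ENNReal.ofReal (pker 1 r) * ouL r H x := hpk.ennreal_ofReal.mul hHm
  rw [lintegral_eq_zero_iff hm] at hx'
  have key : ∀ᵐ r : ℝ, 0 < r → (∀ᵐ u ∂(gaussian d),
      f (√(1 - Real.exp (-2 * r)) • u + Real.exp (-r) • x) =
      g (√(1 - Real.exp (-2 * r)) • u + Real.exp (-r) • x)) := by
    filter_upwards [hx'] with r hr hr0
    have hpos : 0 < pker 1 r := by
      have : 0 < √r := Real.sqrt_pos.2 hr0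
      unfold pker
      positivity
    have h2 : ouL r H x = 0 := by
      rcases mul_eq_zero.1 hr with h3 | h3
      · exact absurd h3 (by simpa using hpos)
      · exact h3
    rw [ouL, lintegral_eq_zero_iff (by fun_prop)] at h2
    filter_upwards [h2] with u hu
    simpa [H, sub_eq_zero] using hu
  constructor
  · intro hgood t ht
    rw [mix_pois]
    have h3 := hgood t ht
    rw [mix_pois] at h3
    refine ne_of_eq_of_ne (lintegral_congr_ae ?_) h3
    filter_upwards [key] with r hr
    rcases le_or_gt r 0 with h0 | h0
    · simp [pker_of_nonpos t h0]
    · congr 1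
      refine lintegral_congr_ae ?_
      filter_upwards [hr h0] with u hu
      rw [hu]
  · intro m t
    refine integral_congr_ae ?_
    filter_upwards [key] with r hr
    rcases le_or_gt r 0 with h0 | h0
    · simp [pkd, pker_of_nonpos t h0]
    · congr 1
      exact integral_congr_ae (hr h0)

end

section

/-! ### Hermite polynomials are eigenfunctions -/

/-- The one-variable Hermite polynomials `H_n(s) = (-1)^n e^{s²} (d/ds)^n e^{-s²}`. -/
def hermPoly : ℕ → Polynomial ℝ
  | 0 => 1
  | n + 1 => 2 * Polynomial.X * hermPoly n - Polynomial.derivative (hermPoly n)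

theorem iteratedDeriv_exp_neg_sq (n : ℕ) (s : ℝ) :
    iteratedDeriv n (fun s : ℝ => Real.exp (-s ^ 2)) s =
      (-1) ^ n * (hermPoly n).eval s * Real.exp (-s ^ 2) := by
  induction n generalizing s with
  | zero => simp [hermPoly]
  | succ n ih =>
    rw [iteratedDeriv_succ, funext ih]
    have h1 : HasDerivAt (fun s : ℝ => Real.exp (-s ^ 2)) (Real.exp (-s ^ 2) * (-(2 * s))) s := by
      simpa using ((hasDerivAt_pow 2 s).neg).exp
    have h2 := (((hermPoly n).hasDerivAt s).const_mul ((-1 : ℝ) ^ n)).fun_mul h1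
    rw [h2.deriv, hermPoly]
    simp only [Polynomial.eval_sub, Polynomial.eval_mul, Polynomial.eval_ofNat, Polynomial.eval_X]
    ring

theorem derivative_hermPoly_succ (n : ℕ) :
    Polynomial.derivative (hermPoly (n + 1)) = Polynomial.C (2 * ((n : ℝ) + 1)) * hermPoly n := by
  induction n with
  | zero => simp [hermPoly, Polynomial.C_ofNat]
  | succ n ih =>
    have h2 : Polynomial.derivative (2 * Polynomial.X : Polynomial ℝ) = 2 := by simp
    rw [hermPoly, Polynomial.derivative_sub, Polynomial.derivative_mul, h2, ih,
      Polynomial.derivative_C_mul, hermPoly]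
    simp only [map_add, map_mul, Polynomial.C_1, Polynomial.C_ofNat, map_natCast, Nat.cast_add,
      Nat.cast_one]
    ring

theorem integrable_poly_mul_exp (P : Polynomial ℝ) :
    Integrable fun s : ℝ => P.eval s * Real.exp (-s ^ 2) := by
  obtain ⟨C, hC, hb⟩ := poly_bound P (ε := 1 / 2) (by norm_num)
  have h := (integrable_exp_neg_mul_sq (b := 1 / 2) (by norm_num)).const_mul C
  have hP := P.continuous
  refine h.mono' (by fun_prop) (Filter.Eventually.of_forall fun s => ?_)
  rw [norm_mul, Real.norm_of_nonneg (Real.exp_nonneg _), Real.norm_eq_abs]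
  calc |P.eval s| * Real.exp (-s ^ 2) ≤ C * Real.exp (1 / 2 * s ^ 2) * Real.exp (-s ^ 2) := by
        gcongr
        exact hb s
    _ = C * Real.exp (-(1 / 2) * s ^ 2) := by
        rw [mul_assoc, ← Real.exp_add]
        ring_nf

/-- Gaussian integration by parts for polynomials. -/
theorem integral_two_mul_poly_mul_exp (P : Polynomial ℝ) :
    ∫ s : ℝ, 2 * s * P.eval s * Real.exp (-s ^ 2) =
      ∫ s : ℝ, (Polynomial.derivative P).eval s * Real.exp (-s ^ 2) := by
  have hd : ∀ s : ℝ, HasDerivAt (fun s => P.eval s * Real.exp (-s ^ 2))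
      ((Polynomial.derivative P).eval s * Real.exp (-s ^ 2) -
        2 * s * P.eval s * Real.exp (-s ^ 2)) s := fun s => by
    have h1 : HasDerivAt (fun s : ℝ => Real.exp (-s ^ 2)) (Real.exp (-s ^ 2) * (-(2 * s))) s := by
      simpa using ((hasDerivAt_pow 2 s).neg).exp
    refine ((P.hasDerivAt s).fun_mul h1).congr_deriv ?_
    ring
  have h2 : Integrable fun s : ℝ => 2 * s * P.eval s * Real.exp (-s ^ 2) := by
    have h := integrable_poly_mul_exp (2 * Polynomial.X * P)
    simpa only [Polynomial.eval_mul, Polynomial.eval_X, Polynomial.eval_ofNat] using h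
  have h3 := integrable_poly_mul_exp (Polynomial.derivative P)
  have h := integral_eq_zero_of_hasDerivAt_of_integrable hd (h3.sub h2) (integrable_poly_mul_exp P)
  rw [integral_sub h3 h2] at h
  linarith

theorem integrable_poly_comp_mul_exp (P : Polynomial ℝ) (a y : ℝ) :
    Integrable fun s : ℝ => P.eval (a * s + y) * Real.exp (-s ^ 2) := by
  have h := integrable_poly_mul_exp (P.comp (Polynomial.C a * Polynomial.X + Polynomial.C y))
  simpa only [Polynomial.eval_mul, Polynomial.eval_comp, Polynomial.eval_add, Polynomial.eval_C,
    Polynomial.eval_X] using h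

/-- The one-dimensional Mehler formula `∫ H_n(a s + b x) e^{-s²} ds = √π b^n H_n(x)`,
`a² + b² = 1`. -/
theorem integral_hermPoly {a b : ℝ} (hab : a ^ 2 + b ^ 2 = 1) (x : ℝ) (n : ℕ) :
    ∫ s : ℝ, (hermPoly n).eval (a * s + b * x) * Real.exp (-s ^ 2) =
        √Real.pi * b ^ n * (hermPoly n).eval x ∧
      b * ∫ s : ℝ, (Polynomial.derivative (hermPoly n)).eval (a * s + b * x) * Real.exp (-s ^ 2) =
        √Real.pi * b ^ n * (Polynomial.derivative (hermPoly n)).eval x := by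
  induction n with
  | zero =>
    have h := integral_gaussian 1
    simp only [neg_mul, one_mul, div_one] at h
    simp [hermPoly, h]
  | succ n ih =>
    constructor
    · have hparts := integral_two_mul_poly_mul_exp
        ((hermPoly n).comp (Polynomial.C a * Polynomial.X + Polynomial.C (b * x)))
      simp only [Polynomial.derivative_comp, Polynomial.eval_comp, Polynomial.eval_add,
        Polynomial.eval_mul, Polynomial.eval_C, Polynomial.eval_X, Polynomial.derivative_add,
        Polynomial.derivative_mul, Polynomial.derivative_C, Polynomial.derivative_X, zero_mul,
        mul_one, zero_add, add_zero] at hparts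
      have i1 := integrable_poly_comp_mul_exp (hermPoly n) a (b * x)
      have i2 := integrable_poly_comp_mul_exp (Polynomial.derivative (hermPoly n)) a (b * x)
      have i3 : Integrable fun s : ℝ => 2 * s * (hermPoly n).eval (a * s + b * x) *
          Real.exp (-s ^ 2) := by
        have h := integrable_poly_mul_exp (2 * Polynomial.X *
          (hermPoly n).comp (Polynomial.C a * Polynomial.X + Polynomial.C (b * x)))
        simpa only [Polynomial.eval_mul, Polynomial.eval_comp, Polynomial.eval_add,
          Polynomial.eval_C, Polynomial.eval_X, Polynomial.eval_ofNat] using h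
      have hpt : ∀ s : ℝ, (hermPoly (n + 1)).eval (a * s + b * x) * Real.exp (-s ^ 2) =
          a * (2 * s * (hermPoly n).eval (a * s + b * x) * Real.exp (-s ^ 2)) +
          2 * b * x * ((hermPoly n).eval (a * s + b * x) * Real.exp (-s ^ 2)) -
          (Polynomial.derivative (hermPoly n)).eval (a * s + b * x) * Real.exp (-s ^ 2) := by
        intro s
        rw [hermPoly]
        simp only [Polynomial.eval_sub, Polynomial.eval_mul, Polynomial.eval_ofNat,
          Polynomial.eval_X]
        ring
      simp only [hpt]
      have i4 : Integrable fun s : ℝ =>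
          a * (2 * s * (hermPoly n).eval (a * s + b * x) * Real.exp (-s ^ 2)) +
          2 * b * x * ((hermPoly n).eval (a * s + b * x) * Real.exp (-s ^ 2)) :=
        (i3.const_mul a).add (i1.const_mul (2 * b * x))
      rw [integral_sub i4 i2, integral_add (i3.const_mul a) (i1.const_mul (2 * b * x)),
        integral_const_mul,
        integral_const_mul, hparts, ih.1]
      have h5 : ∀ s : ℝ, a * (Polynomial.derivative (hermPoly n)).eval (a * s + b * x) *
          Real.exp (-s ^ 2) = a * ((Polynomial.derivative (hermPoly n)).eval (a * s + b * x) *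
          Real.exp (-s ^ 2)) := fun s => mul_assoc _ _ _
      simp only [h5]
      rw [integral_const_mul, hermPoly]
      simp only [Polynomial.eval_sub, Polynomial.eval_mul, Polynomial.eval_ofNat,
        Polynomial.eval_X]
      have h6 := ih.2
      linear_combination (-b) * h6 + (∫ s : ℝ, (Polynomial.derivative (hermPoly n)).eval
        (a * s + b * x) * Real.exp (-s ^ 2)) * hab
    · rw [derivative_hermPoly_succ]
      simp only [Polynomial.eval_mul, Polynomial.eval_C, mul_assoc]
      rw [integral_const_mul, integral_const_mul, ih.1]
      ring

variable {d : ℕ}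

theorem hermite_eq_prod (ν : Fin d → ℕ) (x : EuclideanSpace ℝ (Fin d)) :
    hermite ν x = 1 / √((2 : ℝ) ^ (∑ i, ν i) * ∏ i, ((ν i).factorial : ℝ)) *
      ∏ i, (hermPoly (ν i)).eval (x i) := by
  rw [hermite]
  congr 1
  refine Finset.prod_congr rfl fun i _ => ?_
  rw [iteratedDeriv_exp_neg_sq]
  have h1 : Real.exp (x i ^ 2) * Real.exp (-x i ^ 2) = 1 := by
    rw [← Real.exp_add]
    simp
  have h2 : (-1 : ℝ) ^ ν i * (-1) ^ ν i = 1 := by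
    rw [← mul_pow]
    simp
  linear_combination (((hermPoly (ν i)).eval (x i)) * (Real.exp (x i ^ 2) *
    Real.exp (-x i ^ 2))) * h2 + ((hermPoly (ν i)).eval (x i)) * h1

/-- `γ_d` is a product measure. -/
theorem integral_gaussian_prod (g : Fin d → ℝ → ℝ) :
    ∫ u : EuclideanSpace ℝ (Fin d), ∏ i, g i (u i) ∂(gaussian d) =
      ∏ i, ((1 / √Real.pi) * ∫ s : ℝ, g i s * Real.exp (-s ^ 2)) := by
  have hpi : Real.pi ^ ((d : ℝ) / 2) = ∏ _i : Fin d, √Real.pi := by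
    rw [Finset.prod_const, Finset.card_univ, Fintype.card_fin, Real.sqrt_eq_rpow,
      ← Real.rpow_mul_natCast Real.pi_pos.le]
    congr 1
    ring
  rw [gaussian, integral_withDensity_eq_integral_toReal_smul (by fun_prop) (by simp)]
  have hpt : ∀ u : EuclideanSpace ℝ (Fin d),
      (ENNReal.ofReal (Real.exp (-‖u‖ ^ 2) / Real.pi ^ ((d : ℝ) / 2))).toReal • ∏ i, g i (u i) =
      ∏ i, ((1 / √Real.pi) * (g i (u i) * Real.exp (-u i ^ 2))) := by
    intro u
    rw [ENNReal.toReal_ofReal (by positivity), smul_eq_mul, hpi, EuclideanSpace.real_norm_sq_eq,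
      ← Finset.sum_neg_distrib, Real.exp_sum, ← Finset.prod_div_distrib, ← Finset.prod_mul_distrib]
    refine Finset.prod_congr rfl fun i _ => ?_
    ring
  simp only [hpt]
  rw [← (PiLp.volume_preserving_toLp (Fin d)).integral_comp
    (MeasurableEquiv.toLp 2 (Fin d → ℝ)).measurableEmbedding]
  simp only [← integral_const_mul]
  exact integral_fintype_prod_volume_eq_prod
    (fun i s => (1 / √Real.pi) * (g i s * Real.exp (-s ^ 2)))

/-- `T_r h_ν = e^{-r|ν|} h_ν`. -/
theorem ou_hermite (ν : Fin d → ℕ) {r : ℝ} (hr : 0 ≤ r) (x : EuclideanSpace ℝ (Fin d)) :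
    ornsteinUhlenbeck r (hermite ν) x =
      Real.exp (-(((∑ i, ν i : ℕ) : ℝ) * r)) * hermite ν x := by
  simp only [ornsteinUhlenbeck, hermite_eq_prod, PiLp.add_apply, PiLp.smul_apply, smul_eq_mul]
  rw [integral_const_mul, integral_gaussian_prod (fun i s =>
    (hermPoly (ν i)).eval (√(1 - Real.exp (-2 * r)) * s + Real.exp (-r) * x i))]
  have h : ∀ i, (1 / √Real.pi) * ∫ s : ℝ, (hermPoly (ν i)).eval
      (√(1 - Real.exp (-2 * r)) * s + Real.exp (-r) * x i) * Real.exp (-s ^ 2) =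
      Real.exp (-r) ^ ν i * (hermPoly (ν i)).eval (x i) := fun i => by
    rw [(integral_hermPoly (sq_ouCoeff_add hr) (x i) (ν i)).1]
    have : √Real.pi ≠ 0 := (Real.sqrt_pos.2 Real.pi_pos).ne'
    field_simp
  simp only [h]
  rw [Finset.prod_mul_distrib, Finset.prod_pow_eq_pow_sum, ← Real.exp_nat_mul, mul_neg]
  ring

/-- `P_t h_ν = e^{-t√|ν|} h_ν`. -/
theorem dP_zero_hermite (ν : Fin d → ℕ) {t : ℝ} (ht : 0 < t) (x : EuclideanSpace ℝ (Fin d)) :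
    dP 0 t (hermite ν) x = Real.exp (-(t * √((∑ i, ν i : ℕ) : ℝ))) * hermite ν x := by
  have h1 : ∀ r, pkd 0 t r * ornsteinUhlenbeck r (hermite ν) x =
      pker t r * Real.exp (-(((∑ i, ν i : ℕ) : ℝ) * r)) * hermite ν x := fun r => by
    rw [pkd_zero]
    rcases le_or_gt r 0 with hr | hr
    · simp [pker_of_nonpos t hr]
    · rw [ou_hermite ν hr.le, mul_assoc]
  simp only [dP, h1]
  rw [integral_mul_const]
  congr 1
  have hm := measurable_pker_right t
  rw [integral_eq_lintegral_of_nonneg_ae (Filter.Eventually.of_forall fun r =>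
    mul_nonneg (pker_nonneg ht.le r) (Real.exp_nonneg _)) (by fun_prop),
    lintegral_pker_mul_exp ht (Nat.cast_nonneg _), ENNReal.toReal_ofReal (Real.exp_nonneg _)]

end

section

/-! ### Density of the Hermite polynomials -/

variable {d : ℕ}

theorem two_mul_X_mul_hermPoly (n : ℕ) : 2 * Polynomial.X * hermPoly n =
    hermPoly (n + 1) + Polynomial.C (2 * (n : ℝ)) * hermPoly (n - 1) := by
  have h : Polynomial.derivative (hermPoly n) = Polynomial.C (2 * (n : ℝ)) * hermPoly (n - 1) := by
    cases n with
    | zero => simp [hermPoly]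
    | succ n => simpa using derivative_hermPoly_succ n
  rw [← h, hermPoly]
  ring

/-- The linear span of the Hermite polynomials, as functions. -/
def hermiteSpan (d : ℕ) : Submodule ℝ (EuclideanSpace ℝ (Fin d) → ℝ) :=
  Submodule.span ℝ (range hermite)

theorem prod_hermPoly_mem (ν : Fin d → ℕ) :
    (fun x : EuclideanSpace ℝ (Fin d) => ∏ i, (hermPoly (ν i)).eval (x i)) ∈ hermiteSpan d := by
  have h0 : 0 < √((2 : ℝ) ^ (∑ i, ν i) * ∏ i, ((ν i).factorial : ℝ)) := Real.sqrt_pos.2 (by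
    have : 0 < ∏ i, ((ν i).factorial : ℝ) :=
      Finset.prod_pos fun i _ => by exact_mod_cast Nat.factorial_pos _
    positivity)
  have h : (fun x : EuclideanSpace ℝ (Fin d) => ∏ i, (hermPoly (ν i)).eval (x i)) =
      √((2 : ℝ) ^ (∑ i, ν i) * ∏ i, ((ν i).factorial : ℝ)) • hermite ν := by
    funext x
    rw [Pi.smul_apply, hermite_eq_prod, smul_eq_mul, ← mul_assoc, mul_one_div_cancel h0.ne',
      one_mul]
  rw [h]
  exact Submodule.smul_mem _ _ (Submodule.subset_span ⟨ν, rfl⟩)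

theorem one_mem_hermiteSpan : (fun _ => 1) ∈ hermiteSpan d := by
  simpa [hermPoly] using prod_hermPoly_mem (d := d) 0

/-- The span of the Hermite polynomials is stable under multiplication by coordinates, by the
three-term recurrence. -/
theorem coord_mul_mem_hermiteSpan (i : Fin d) {f : EuclideanSpace ℝ (Fin d) → ℝ}
    (hf : f ∈ hermiteSpan d) : (fun x => x i * f x) ∈ hermiteSpan d := by
  induction hf using Submodule.span_induction with
  | mem f hf =>
    obtain ⟨ν, rfl⟩ := hf
    have hupd : ∀ (m : ℕ) (x : EuclideanSpace ℝ (Fin d)),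
        ∏ j, (hermPoly (Function.update ν i m j)).eval (x j) =
        (hermPoly m).eval (x i) * ∏ j ∈ Finset.univ.erase i, (hermPoly (ν j)).eval (x j) := by
      intro m x
      rw [← Finset.mul_prod_erase _ _ (Finset.mem_univ i), Function.update_self]
      congr 1
      refine Finset.prod_congr rfl fun j hj => ?_
      rw [Function.update_of_ne (Finset.ne_of_mem_erase hj)]
    have h := Submodule.smul_mem _ (1 / √((2 : ℝ) ^ (∑ i, ν i) * ∏ i, ((ν i).factorial : ℝ)))
      (Submodule.add_mem _
        (Submodule.smul_mem _ (1 / 2 : ℝ) (prod_hermPoly_mem (Function.update ν i (ν i + 1))))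
        (Submodule.smul_mem _ (ν i : ℝ) (prod_hermPoly_mem (Function.update ν i (ν i - 1)))))
    convert h using 1
    funext x
    simp only [Pi.smul_apply, Pi.add_apply, hupd, smul_eq_mul]
    rw [hermite_eq_prod,
      ← Finset.mul_prod_erase _ (fun i => (hermPoly (ν i)).eval (x i)) (Finset.mem_univ i)]
    have h1 := congrArg (Polynomial.eval (x i)) (two_mul_X_mul_hermPoly (ν i))
    simp only [Polynomial.eval_add, Polynomial.eval_mul, Polynomial.eval_ofNat,
      Polynomial.eval_X, Polynomial.eval_C] at h1
    linear_combination (1 / √((2 : ℝ) ^ (∑ i, ν i) * ∏ i, ((ν i).factorial : ℝ)) *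
      (∏ j ∈ Finset.univ.erase i, (hermPoly (ν j)).eval (x j)) / 2) * h1
  | zero =>
    simp only [Pi.zero_apply, mul_zero]
    exact Submodule.zero_mem (hermiteSpan d)
  | add f g _ _ hf hg =>
    convert Submodule.add_mem _ hf hg using 1
    funext x
    simp [mul_add]
  | smul a f _ hf =>
    convert Submodule.smul_mem _ a hf using 1
    funext x
    simp only [Pi.smul_apply, smul_eq_mul]
    ring

theorem inner_pow_mem_hermiteSpan (ξ : EuclideanSpace ℝ (Fin d)) (n : ℕ) :
    (fun x => (inner ℝ ξ x) ^ n) ∈ hermiteSpan d := by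
  induction n with
  | zero => simpa using one_mem_hermiteSpan (d := d)
  | succ n ih =>
    have h : (fun x => (inner ℝ ξ x) ^ (n + 1)) =
        ∑ i, ξ i • fun x : EuclideanSpace ℝ (Fin d) => x i * (inner ℝ ξ x) ^ n := by
      funext x
      rw [Finset.sum_apply, pow_succ']
      simp only [Pi.smul_apply, smul_eq_mul, ← mul_assoc, ← Finset.sum_mul]
      congr 1
      rw [PiLp.inner_apply]
      exact Finset.sum_congr rfl fun i _ => by simp [mul_comm]
    rw [h]
    exact Submodule.sum_mem _ fun i _ => Submodule.smul_mem _ _ (coord_mul_mem_hermiteSpan i ih)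

/-- A continuous function growing more slowly than every `e^{ε|x|²}` has all moments. -/
theorem memLp_of_exp_bound {f : EuclideanSpace ℝ (Fin d) → ℝ} (hf : Continuous f)
    (hb : ∀ ε : ℝ, 0 < ε → ∃ C : ℝ, 0 ≤ C ∧ ∀ x, |f x| ≤ C * Real.exp (ε * ‖x‖ ^ 2))
    {p : ℝ≥0∞} (hp0 : p ≠ 0) (hp : p ≠ ∞) : MemLp f p (gaussian d) := by
  have hpos : 0 < p.toReal := ENNReal.toReal_pos hp0 hp
  obtain ⟨C, hC, hb⟩ := hb (1 / (2 * p.toReal)) (by positivity)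
  rw [← integrable_norm_rpow_iff hf.aestronglyMeasurable hp0 hp, gaussian,
    integrable_withDensity_iff (by fun_prop) (by simp)]
  have hint : Integrable (fun x : EuclideanSpace ℝ (Fin d) =>
      C ^ p.toReal / Real.pi ^ ((d : ℝ) / 2) * Real.exp (-(1 / 2) * ‖x‖ ^ 2)) := by
    refine Integrable.const_mul ?_ _
    have h := (GaussianFourier.integrable_cexp_neg_mul_sq_norm_add
      (V := EuclideanSpace ℝ (Fin d)) (b := 1 / 2) (by norm_num) 0 0).norm
    refine h.congr (Filter.Eventually.of_forall fun x => ?_)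
    simp only [Complex.norm_exp]
    congr 1
    simp [← Complex.ofReal_pow]
  have hm := hf.measurable
  refine hint.mono' ?_ (Filter.Eventually.of_forall fun x => ?_)
  · exact (by fun_prop : Measurable _).aestronglyMeasurable
  · rw [ENNReal.toReal_ofReal (by positivity), Real.norm_of_nonneg (by positivity)]
    have h1 : ‖f x‖ ^ p.toReal ≤ C ^ p.toReal * Real.exp (1 / 2 * ‖x‖ ^ 2) := by
      refine (Real.rpow_le_rpow (norm_nonneg _) (hb x) hpos.le).trans_eq ?_
      rw [Real.mul_rpow hC (Real.exp_nonneg _), ← Real.exp_mul]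
      congr 2
      field_simp
    refine (mul_le_mul_of_nonneg_right h1 (by positivity)).trans_eq ?_
    have h2 : Real.exp (-(1 / 2) * ‖x‖ ^ 2) =
        Real.exp (1 / 2 * ‖x‖ ^ 2) * Real.exp (-‖x‖ ^ 2) := by
      rw [← Real.exp_add]
      ring_nf
    rw [h2]
    ring

theorem memLp_exp_abs_inner (ξ : EuclideanSpace ℝ (Fin d)) {p : ℝ≥0∞} (hp0 : p ≠ 0)
    (hp : p ≠ ∞) : MemLp (fun x => Real.exp |inner ℝ ξ x|) p (gaussian d) := by
  refine memLp_of_exp_bound (by fun_prop) (fun ε hε => ⟨Real.exp (‖ξ‖ ^ 2 / (4 * ε)),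
    Real.exp_nonneg _, fun x => ?_⟩) hp0 hp
  rw [abs_of_pos (Real.exp_pos _), ← Real.exp_add]
  refine Real.exp_le_exp.2 ((abs_real_inner_le_norm ξ x).trans ?_)
  -- `ab ≤ a² / (4ε) + ε b²`
  have h : ‖ξ‖ ^ 2 / (4 * ε) + ε * ‖x‖ ^ 2 - ‖ξ‖ * ‖x‖ =
      (‖ξ‖ - 2 * ε * ‖x‖) ^ 2 / (4 * ε) := by
    field_simp
    ring
  have h2 : 0 ≤ (‖ξ‖ - 2 * ε * ‖x‖) ^ 2 / (4 * ε) := by positivity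
  linarith

variable {p : ℝ≥0∞} [Fact (1 ≤ p)]

/-- The closed linear span of the Hermite polynomials in `L^p(γ_d)`. -/
def hermiteClosure (d : ℕ) (hp : p ≠ ∞) : Submodule ℝ (Lp ℝ p (gaussian d)) :=
  (Submodule.span ℝ (range (hermiteLp hp))).topologicalClosure

/-- The function `f` lies in `L^p(γ_d)`, in the closed span of the Hermite polynomials. -/
def InClosure (hp : p ≠ ∞) (f : EuclideanSpace ℝ (Fin d) → ℝ) : Prop :=
  ∃ h : MemLp f p (gaussian d), h.toLp f ∈ hermiteClosure d hp

theorem InClosure.of_mem_span (hp : p ≠ ∞) {f : EuclideanSpace ℝ (Fin d) → ℝ}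
    (hf : f ∈ hermiteSpan d) : InClosure hp f := by
  induction hf using Submodule.span_induction with
  | mem f hf =>
    obtain ⟨ν, rfl⟩ := hf
    exact ⟨memLp_hermite ν hp, Submodule.le_topologicalClosure _ (Submodule.subset_span ⟨ν, rfl⟩)⟩
  | zero => exact ⟨MemLp.zero, by rw [MemLp.toLp_zero]; exact Submodule.zero_mem _⟩
  | add f g _ _ hf hg =>
    exact ⟨hf.1.add hg.1, by rw [MemLp.toLp_add hf.1 hg.1]; exact Submodule.add_mem _ hf.2 hg.2⟩
  | smul a f _ hf =>
    exact ⟨hf.1.const_smul a, by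
        rw [MemLp.toLp_const_smul a hf.1]
        exact Submodule.smul_mem _ a hf.2⟩

theorem InClosure.of_approx (hp : p ≠ ∞) {f : EuclideanSpace ℝ (Fin d) → ℝ}
    (hf : MemLp f p (gaussian d))
    (h : ∀ ε : ℝ≥0∞, 0 < ε → ∃ g, InClosure hp g ∧ eLpNorm (f - g) p (gaussian d) < ε) :
    InClosure hp f := by
  refine ⟨hf, ?_⟩
  have hc : IsClosed (hermiteClosure d hp : Set (Lp ℝ p (gaussian d))) :=
    Submodule.isClosed_topologicalClosure _
  rw [← SetLike.mem_coe, ← hc.closure_eq, EMetric.mem_closure_iff]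
  intro ε hε
  obtain ⟨g, ⟨hg, hgc⟩, hlt⟩ := h ε hε
  exact ⟨hg.toLp g, hgc, by rwa [Lp.edist_toLp_toLp]⟩

/-- The waves `x ↦ cos(⟨ξ, x⟩ + φ)`. -/
def wave (z : EuclideanSpace ℝ (Fin d) × ℝ) : C(EuclideanSpace ℝ (Fin d), ℝ) :=
  ⟨fun x => Real.cos (inner ℝ z.1 x + z.2), by fun_prop⟩

/-- The coefficients of the Taylor series of `y ↦ cos(y + φ)`. -/
def cosCoeff (φ : ℝ) (n : ℕ) : ℝ :=
  (Complex.exp (φ * Complex.I) * Complex.I ^ n / n.factorial).re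

theorem hasSum_cosCoeff (φ y : ℝ) :
    HasSum (fun n => cosCoeff φ n * y ^ n) (Real.cos (y + φ)) := by
  have h := (NormedSpace.expSeries_div_hasSum_exp ((y : ℂ) * Complex.I)).mul_left
    (Complex.exp (φ * Complex.I))
  rw [← Complex.exp_eq_exp_ℂ, ← Complex.exp_add] at h
  convert Complex.hasSum_re h using 1
  · funext n
    rw [cosCoeff, ← Complex.re_mul_ofReal]
    congr 1
    push_cast
    ring
  · rw [← add_mul, add_comm, ← Complex.ofReal_add, Complex.exp_ofReal_mul_I_re]

theorem abs_cosCoeff_le (φ : ℝ) (n : ℕ) : |cosCoeff φ n| ≤ 1 / n.factorial := by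
  refine (Complex.abs_re_le_norm _).trans_eq ?_
  rw [norm_div, norm_mul, Complex.norm_exp_ofReal_mul_I, norm_pow, Complex.norm_I]
  simp

theorem abs_sum_cosCoeff_le (φ y : ℝ) (N : ℕ) :
    |∑ n ∈ Finset.range N, cosCoeff φ n * y ^ n| ≤ Real.exp |y| := by
  refine (Finset.abs_sum_le_sum_abs _ _).trans
    (le_trans (Finset.sum_le_sum fun n _ => ?_) (Real.sum_le_exp_of_nonneg (abs_nonneg y) N))
  rw [abs_mul, abs_pow, div_eq_mul_one_div, mul_comm]
  gcongr
  exact abs_cosCoeff_le φ n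

/-- Dominated convergence in `L^p` for the Taylor series of the cosine. -/
theorem InClosure.wave (hp : p ≠ ∞) (z : EuclideanSpace ℝ (Fin d) × ℝ) :
    InClosure hp (GaussTL.wave z) := by
  have hp0 : p ≠ 0 := (lt_of_lt_of_le one_pos (Fact.out : 1 ≤ p)).ne'
  have hpos : 0 < p.toReal := ENNReal.toReal_pos hp0 hp
  obtain ⟨ξ, φ⟩ := z
  let g : ℕ → EuclideanSpace ℝ (Fin d) → ℝ := fun N x =>
    ∑ n ∈ Finset.range N, cosCoeff φ n * (inner ℝ ξ x) ^ n
  have hg : ∀ N, g N ∈ hermiteSpan d := fun N => by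
    have : g N = ∑ n ∈ Finset.range N, cosCoeff φ n • fun x => (inner ℝ ξ x) ^ n := by
      funext x
      simp [g, Finset.sum_apply]
    rw [this]
    exact Submodule.sum_mem _ fun n _ => Submodule.smul_mem _ _ (inner_pow_mem_hermiteSpan ξ n)
  have hgm : ∀ N, Measurable (g N) := fun N => by fun_prop
  let f : EuclideanSpace ℝ (Fin d) → ℝ := GaussTL.wave (ξ, φ)
  have hfm : Measurable f := (GaussTL.wave (ξ, φ)).continuous.measurable
  have hfb : ∀ x, |f x| ≤ 1 := fun x => Real.abs_cos_le_one _
  have hexp := memLp_exp_abs_inner ξ hp0 hp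
  refine InClosure.of_approx hp (MemLp.of_bound hfm.aestronglyMeasurable 1
    (Filter.Eventually.of_forall hfb)) fun ε hε => ?_
  have hlim : Filter.Tendsto (fun N => ∫⁻ x, ‖(f - g N) x‖ₑ ^ p.toReal ∂(gaussian d))
      Filter.atTop (nhds (∫⁻ _, 0 ∂(gaussian d))) := by
    refine tendsto_lintegral_of_dominated_convergence
      (fun x => ‖2 * Real.exp |inner ℝ ξ x|‖ₑ ^ p.toReal) (fun N => by fun_prop)
      (fun N => Filter.Eventually.of_forall fun x => ?_) ?_
      (Filter.Eventually.of_forall fun x => ?_)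
    · refine ENNReal.rpow_le_rpow ?_ hpos.le
      rw [enorm_le_iff_norm_le, Real.norm_of_nonneg (by positivity : (0 : ℝ) ≤ 2 * Real.exp _)]
      refine (norm_sub_le _ _).trans ?_
      have h1 : ‖f x‖ ≤ Real.exp |inner ℝ ξ x| :=
        (hfb x).trans (Real.one_le_exp (abs_nonneg _))
      have h2 : ‖g N x‖ ≤ Real.exp |inner ℝ ξ x| := abs_sum_cosCoeff_le φ _ N
      linarith
    · have h := lintegral_rpow_enorm_lt_top_of_eLpNorm_lt_top hp0 hp (hexp.const_mul 2).2
      exact h.ne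
    · have h1 : Filter.Tendsto (fun N => ‖(f - g N) x‖) Filter.atTop (nhds 0) := by
        have h := (hasSum_cosCoeff φ (inner ℝ ξ x)).tendsto_sum_nat
        have h2 := (h.const_sub (f x)).norm
        simpa [f, GaussTL.wave, g] using h2
      have h2 := (ENNReal.continuous_rpow_const (y := p.toReal)).tendsto 0
      rw [ENNReal.zero_rpow_of_pos hpos] at h2
      refine h2.comp ?_
      have h3 := ENNReal.tendsto_ofReal h1
      simp only [ofReal_norm, ENNReal.ofReal_zero] at h3
      exact h3
  rw [lintegral_zero] at hlim
  have hlim2 := ((ENNReal.continuous_rpow_const (y := 1 / p.toReal)).tendsto 0).comp hlim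
  rw [ENNReal.zero_rpow_of_pos (by positivity)] at hlim2
  obtain ⟨N, hN⟩ := (hlim2.eventually_lt_const hε).exists
  refine ⟨g N, .of_mem_span hp (hg N), ?_⟩
  rw [eLpNorm_eq_lintegral_rpow_enorm_toReal hp0 hp]
  exact hN

/-- The algebra of trigonometric polynomials on `ℝ^d`. -/
def waveAlgebra (d : ℕ) : Subalgebra ℝ C(EuclideanSpace ℝ (Fin d), ℝ) :=
  (Submodule.span ℝ (range (wave (d := d)))).toSubalgebra
    (Submodule.subset_span ⟨0, by ext x; simp [wave]⟩) fun f g hf hg => by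
      induction hf, hg using Submodule.span_induction₂ with
      | mem_mem f g hf hg =>
        obtain ⟨⟨ξ, φ⟩, rfl⟩ := hf
        obtain ⟨⟨η, ψ⟩, rfl⟩ := hg
        have h : wave (ξ, φ) * wave (η, ψ) =
            (1 / 2 : ℝ) • (wave (ξ + η, φ + ψ) + wave (ξ - η, φ - ψ)) := by
          ext x
          simp only [wave, ContinuousMap.mul_apply, ContinuousMap.coe_mk, ContinuousMap.smul_apply,
            ContinuousMap.add_apply, smul_eq_mul]
          rw [inner_add_left, inner_sub_left,
            show inner ℝ ξ x + inner ℝ η x + (φ + ψ) =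
              (inner ℝ ξ x + φ) + (inner ℝ η x + ψ) by ring,
            show inner ℝ ξ x - inner ℝ η x + (φ - ψ) =
              (inner ℝ ξ x + φ) - (inner ℝ η x + ψ) by ring,
            Real.cos_add (inner ℝ ξ x + φ) (inner ℝ η x + ψ), Real.cos_sub]
          ring
        rw [h]
        exact Submodule.smul_mem _ _ (Submodule.add_mem _ (Submodule.subset_span ⟨_, rfl⟩)
          (Submodule.subset_span ⟨_, rfl⟩))
      | zero_left => simp
      | zero_right => simp
      | add_left f g h _ _ _ hf hg => rw [add_mul]; exact Submodule.add_mem _ hf hg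
      | add_right f g h _ _ _ hf hg => rw [mul_add]; exact Submodule.add_mem _ hf hg
      | smul_left a f g _ _ h => rw [smul_mul_assoc]; exact Submodule.smul_mem _ a h
      | smul_right a f g _ _ h => rw [mul_smul_comm]; exact Submodule.smul_mem _ a h

theorem separatesPoints_waveAlgebra (d : ℕ) : (waveAlgebra d).SeparatesPoints := by
  intro x y hxy
  have hn : ‖x - y‖ ≠ 0 := norm_ne_zero_iff.2 (sub_ne_zero.2 hxy)
  let ξ : EuclideanSpace ℝ (Fin d) := (1 / ‖x - y‖ ^ 2) • (x - y)
  refine ⟨wave (ξ, -inner ℝ ξ y), ⟨_, Submodule.subset_span ⟨_, rfl⟩, rfl⟩, ?_⟩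
  have h : inner ℝ ξ x + -inner ℝ ξ y = 1 := by
    rw [← sub_eq_add_neg, ← inner_sub_right, real_inner_smul_left, real_inner_self_eq_norm_sq]
    field_simp
  simp only [wave, ContinuousMap.coe_mk]
  rw [h, add_neg_cancel, Real.cos_zero]
  have h1 : Real.cos 1 < 1 := by
    have := Real.cos_one_le
    linarith
  exact h1.ne

theorem InClosure.of_mem_waveAlgebra (hp : p ≠ ∞) {f : C(EuclideanSpace ℝ (Fin d), ℝ)}
    (hf : f ∈ waveAlgebra d) : InClosure hp f := by
  change f ∈ Submodule.span ℝ (range (GaussTL.wave (d := d))) at hf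
  induction hf using Submodule.span_induction with
  | mem f hf =>
    obtain ⟨z, rfl⟩ := hf
    exact InClosure.wave hp z
  | zero => exact .of_mem_span hp (Submodule.zero_mem _)
  | add f g h1 h2 hf hg =>
    obtain ⟨hf, hf'⟩ := hf
    obtain ⟨hg, hg'⟩ := hg
    exact ⟨hf.add hg, Submodule.add_mem _ hf' hg'⟩
  | smul a f h1 hf =>
    obtain ⟨hf, hf'⟩ := hf
    exact ⟨hf.const_smul a, Submodule.smul_mem _ a hf'⟩

theorem exists_bound_of_mem_waveAlgebra {f : C(EuclideanSpace ℝ (Fin d), ℝ)}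
    (hf : f ∈ waveAlgebra d) : ∃ B, ∀ x, |f x| ≤ B := by
  change f ∈ Submodule.span ℝ (range (GaussTL.wave (d := d))) at hf
  induction hf using Submodule.span_induction with
  | mem f hf =>
    obtain ⟨z, rfl⟩ := hf
    exact ⟨1, fun x => Real.abs_cos_le_one _⟩
  | zero => exact ⟨0, by simp⟩
  | add f g h1 h2 hf hg =>
    obtain ⟨B, hB⟩ := hf
    obtain ⟨D, hD⟩ := hg
    exact ⟨B + D, fun x => (abs_add_le _ _).trans (add_le_add (hB x) (hD x))⟩
  | smul a f h1 hf =>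
    obtain ⟨B, hB⟩ := hf
    exact ⟨|a| * B, fun x => by
      rw [ContinuousMap.smul_apply, smul_eq_mul, abs_mul]
      exact mul_le_mul_of_nonneg_left (hB x) (abs_nonneg a)⟩

/-- A bounded continuous function is uniformly close on a compact set to a trigonometric
polynomial which is bounded everywhere by nearly the same constant. -/
theorem exists_mem_waveAlgebra_near (f : C(EuclideanSpace ℝ (Fin d), ℝ)) {M δ : ℝ}
    (hM : ∀ x, |f x| ≤ M) (hδ : 0 < δ) {K : Set (EuclideanSpace ℝ (Fin d))} (hK : IsCompact K) :
    ∃ g ∈ waveAlgebra d, (∀ x ∈ K, |g x - f x| ≤ 2 * δ) ∧ ∀ x, |g x| ≤ M + 2 * δ := by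
  have hM0 : 0 ≤ M := (abs_nonneg _).trans (hM 0)
  obtain ⟨g, hg, hgf⟩ :=
    ContinuousMap.exists_mem_subalgebra_near_continuous_of_isCompact_of_separatesPoints
      (separatesPoints_waveAlgebra d) f hK hδ
  obtain ⟨B, hB⟩ := exists_bound_of_mem_waveAlgebra hg
  -- `P` approximates the truncation at height `M + δ` on the range of `g`
  obtain ⟨P, hP⟩ := exists_polynomial_near_of_continuousOn (-B) B
    (fun s => max (-(M + δ)) (min s (M + δ))) (by fun_prop) δ hδ
  have hval : ∀ x, (Polynomial.aeval g P) x = P.eval (g x) := fun x =>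
    Polynomial.aeval_continuousMap_apply P g x
  have hP' : ∀ x, |P.eval (g x) - max (-(M + δ)) (min (g x) (M + δ))| < δ := fun x =>
    hP _ (abs_le.1 (hB x))
  refine ⟨Polynomial.aeval g P, Algebra.adjoin_le (by simpa using hg)
    (Polynomial.aeval_mem_adjoin_singleton ℝ g), fun x hx => ?_, fun x => ?_⟩
  · rw [hval]
    have h1 := abs_lt.1 (hgf x hx)
    have h2 := abs_le.1 (hM x)
    have h3 := abs_lt.1 (hP' x)
    rw [min_eq_left (by linarith), max_eq_right (by linarith)] at h3
    rw [abs_le]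
    constructor <;> linarith
  · rw [hval]
    have h3 := abs_lt.1 (hP' x)
    have h4 : max (-(M + δ)) (min (g x) (M + δ)) ≤ M + δ :=
      max_le (by linarith) (min_le_right _ _)
    have h5 : -(M + δ) ≤ max (-(M + δ)) (min (g x) (M + δ)) := le_max_left _ _
    rw [abs_le]
    constructor <;> linarith

/-- Trigonometric polynomials `2δ`-close to `f` on a compact set and bounded by `M + 2δ` everywhere
are close to `f` in `L^p(γ_d)` once the complement of the compact set has small measure. -/
theorem InClosure.of_bounded (hp : p ≠ ∞) (f : C(EuclideanSpace ℝ (Fin d), ℝ)) {M : ℝ}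
    (hM : ∀ x, |f x| ≤ M) : InClosure hp f := by
  have hp1 : 1 ≤ p := Fact.out
  have hp0 : p ≠ 0 := (lt_of_lt_of_le one_pos hp1).ne'
  have hpos : 0 < p.toReal := ENNReal.toReal_pos hp0 hp
  have hM0 : 0 ≤ M := (abs_nonneg _).trans (hM 0)
  refine InClosure.of_approx hp (MemLp.of_bound f.continuous.aestronglyMeasurable M
    (Filter.Eventually.of_forall hM)) fun ε hε => ?_
  obtain ⟨δ, hδ0, hδ⟩ : ∃ δ : ℝ, 0 < δ ∧ ENNReal.ofReal (2 * δ) +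
      ENNReal.ofReal (2 * M + 2 * δ) * ENNReal.ofReal δ ^ (1 / p.toReal) < ε := by
    have hc : Filter.Tendsto (fun δ : ℝ => ENNReal.ofReal (2 * δ) +
        ENNReal.ofReal (2 * M + 2 * δ) * ENNReal.ofReal δ ^ (1 / p.toReal))
        (nhdsWithin 0 (Ioi 0)) (nhds (ENNReal.ofReal (2 * 0) +
        ENNReal.ofReal (2 * M + 2 * 0) * ENNReal.ofReal 0 ^ (1 / p.toReal))) := by
      refine Filter.Tendsto.mono_left ?_ nhdsWithin_le_nhds
      refine Filter.Tendsto.add ?_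
        (ENNReal.Tendsto.mul ?_ (Or.inr ?_) ?_ (Or.inr ENNReal.ofReal_ne_top))
      · exact (ENNReal.continuous_ofReal.comp (continuous_const.mul continuous_id)).tendsto 0
      · exact (ENNReal.continuous_ofReal.comp
          (continuous_const.add (continuous_const.mul continuous_id))).tendsto 0
      · rw [ENNReal.ofReal_zero, ENNReal.zero_rpow_of_pos (by positivity)]
        exact ENNReal.zero_ne_top
      · exact ((ENNReal.continuous_rpow_const).comp ENNReal.continuous_ofReal).tendsto 0
    have h0 : ENNReal.ofReal (2 * 0) +
        ENNReal.ofReal (2 * M + 2 * 0) * ENNReal.ofReal 0 ^ (1 / p.toReal) = 0 := by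
      rw [ENNReal.ofReal_zero, ENNReal.zero_rpow_of_pos (by positivity)]
      simp
    rw [h0] at hc
    obtain ⟨δ, h1, h2⟩ := ((hc.eventually_lt_const hε).and self_mem_nhdsWithin).exists
    exact ⟨δ, h2, h1⟩
  obtain ⟨K, -, hK, hKlt⟩ := (MeasurableSet.univ (α := EuclideanSpace ℝ (Fin d)))
    |>.exists_isCompact_sdiff_lt (μ := gaussian d) (measure_ne_top _ _)
      (ENNReal.ofReal_pos.2 hδ0).ne'
  have hKc : MeasurableSet Kᶜ := hK.measurableSet.compl
  obtain ⟨g, hg, hg1, hg2⟩ := exists_mem_waveAlgebra_near f hM hδ0 hK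
  refine ⟨g, .of_mem_waveAlgebra hp hg, lt_of_le_of_lt ?_ hδ⟩
  have hpt : ∀ x, ‖((f : EuclideanSpace ℝ (Fin d) → ℝ) - g) x‖ ≤
      ‖2 * δ + Kᶜ.indicator (fun _ => 2 * M + 2 * δ) x‖ := fun x => by
    rw [Pi.sub_apply, norm_sub_rev, Real.norm_eq_abs]
    by_cases hx : x ∈ K
    · rw [indicator_of_notMem (by simpa using hx), add_zero,
        Real.norm_of_nonneg (by positivity)]
      exact hg1 x hx
    · rw [indicator_of_mem (by simpa using hx), Real.norm_of_nonneg (by positivity)]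
      have h1 := abs_le.1 (hg2 x)
      have h2 := abs_le.1 (hM x)
      rw [abs_le]
      constructor <;> linarith
  refine (eLpNorm_mono hpt).trans ((eLpNorm_add_le (f := fun _ => 2 * δ)
    aestronglyMeasurable_const
    (aestronglyMeasurable_const.indicator hKc) hp1).trans (add_le_add ?_ ?_))
  · rw [eLpNorm_const' _ hp0 hp, measure_univ, ENNReal.one_rpow, mul_one,
      Real.enorm_of_nonneg (by positivity)]
  · rw [eLpNorm_indicator_const hKc hp0 hp, Real.enorm_of_nonneg (by positivity)]
    gcongr
    rw [compl_eq_univ_sdiff]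
    exact hKlt.le

/-- The Hermite polynomials span a dense subspace of `L^p(γ_d)`, `1 ≤ p < ∞`. -/
theorem hermiteClosure_eq_top (d : ℕ) (hp : p ≠ ∞) : hermiteClosure d hp = ⊤ := by
  have hc : IsClosed (hermiteClosure d hp : Set (Lp ℝ p (gaussian d))) :=
    Submodule.isClosed_topologicalClosure _
  have hd := BoundedContinuousFunction.toLp_denseRange (E := ℝ) (gaussian d) ℝ hp
  refine eq_top_iff.2 fun f _ => ?_
  have hsub : range (BoundedContinuousFunction.toLp p (gaussian d) ℝ) ⊆
      (hermiteClosure d hp : Set (Lp ℝ p (gaussian d))) := by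
    rintro _ ⟨u, rfl⟩
    obtain ⟨h, hmem⟩ := InClosure.of_bounded hp u.toContinuousMap (M := ‖u‖)
      fun x => u.norm_coe_le_norm x
    have heq : BoundedContinuousFunction.toLp p (gaussian d) ℝ u = h.toLp _ := by
      refine Lp.ext ?_
      filter_upwards [BoundedContinuousFunction.coeFn_toLp (p := p) (gaussian d) ℝ u,
        h.coeFn_toLp] with x h1 h2
      rw [h1, h2]
      rfl
    rw [heq]
    exact hmem
  exact (closure_minimal hsub hc) (hd f)

theorem eq_of_forall_hermiteLp (hp : p ≠ ∞)
    {J J' : Lp ℝ p (gaussian d) →L[ℝ] Lp ℝ p (gaussian d)}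
    (h : ∀ ν, J (hermiteLp hp ν) = J' (hermiteLp hp ν)) : J = J' := by
  refine ContinuousLinearMap.ext_on (s := range (hermiteLp hp)) ?_ ?_
  · exact Submodule.dense_iff_topologicalClosure_eq_top.2 (hermiteClosure_eq_top d hp)
  · rintro _ ⟨ν, rfl⟩
    exact h ν

end

section

/-! ### The Bessel potential -/

variable {d : ℕ}

theorem measurable_mix_pois_param {ι : Type*} [MeasurableSpace ι] {θ : ι → ℝ}
    (hθ : Measurable θ) {G : ι × EuclideanSpace ℝ (Fin d) → ℝ≥0∞} (hG : Measurable G) :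
    Measurable fun z : ι × EuclideanSpace ℝ (Fin d) =>
      mix (pois (θ z.1)) (fun y => G (z.1, y)) z.2 := by
  simp only [mix_pois]
  have h1 : Measurable fun z : (ι × EuclideanSpace ℝ (Fin d)) × ℝ => pker (θ z.1.1) z.2 :=
    measurable_pker.comp (f := fun z : (ι × EuclideanSpace ℝ (Fin d)) × ℝ => (θ z.1.1, z.2))
      (by fun_prop)
  have h2 : Measurable fun z : (ι × EuclideanSpace ℝ (Fin d)) × ℝ =>
      ouL z.2 (fun y => G (z.1.1, y)) z.1.2 :=
    (measurable_ouL_param hG).comp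
      (f := fun z : (ι × EuclideanSpace ℝ (Fin d)) × ℝ => ((z.1.1, z.2), z.1.2)) (by fun_prop)
  exact Measurable.lintegral_prod_right' (h1.ennreal_ofReal.mul h2)

theorem measurable_mix_pois_prod {F : EuclideanSpace ℝ (Fin d) → ℝ≥0∞} (hF : Measurable F) :
    Measurable fun z : ℝ × EuclideanSpace ℝ (Fin d) => mix (pois z.1) F z.2 :=
  measurable_mix_pois_param measurable_id (G := fun z => F z.2) (hF.comp measurable_snd)

theorem measurable_mix_pois_time {F : EuclideanSpace ℝ (Fin d) → ℝ≥0∞} (hF : Measurable F)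
    (x : EuclideanSpace ℝ (Fin d)) : Measurable fun s => mix (pois s) F x := by
  have h := (measurable_mix_pois_prod hF).comp (measurable_prodMk_right (y := x))
  exact h

/-- The semigroup law `P_a P_s = P_{a+s}` on nonnegative functions. -/
theorem mix_pois_mix_pois {F : EuclideanSpace ℝ (Fin d) → ℝ≥0∞} (hF : Measurable F) {a s : ℝ}
    (ha : 0 < a) (hs : 0 < s) (x : EuclideanSpace ℝ (Fin d)) :
    mix (pois a) (mix (pois s) F) x = mix (pois (s + a)) F x := by
  have h1 := measurable_pker_right a
  have h2 := measurable_pker_right s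
  have hFm := measurable_ouL_time hF x
  have hmeas2 : Measurable fun z : ℝ × ℝ => pker s (z.2 - z.1) :=
    h2.comp (measurable_snd.sub measurable_fst)
  have h3 : ∀ r, ENNReal.ofReal (pker a r) * ouL r (mix (pois s) F) x =
      ∫⁻ ρ, ENNReal.ofReal (pker s (ρ - r) * pker a r) * ouL ρ F x := fun r => by
    rcases le_or_gt r 0 with hr | hr
    · simp [pker_of_nonpos a hr]
    · rw [ouL_mix ((ae_pois_pos s).mono fun r hr => hr.le) hF hr.le, pois,
        lintegral_withDensity_eq_lintegral_mul_non_measurable _ h2.ennreal_ofReal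
          (Filter.Eventually.of_forall fun _ => ENNReal.ofReal_lt_top),
        ← lintegral_const_mul' _ _ ENNReal.ofReal_ne_top,
        ← lintegral_add_left_eq_self (fun ρ =>
          ENNReal.ofReal (pker s (ρ - r) * pker a r) * ouL ρ F x) r]
      refine lintegral_congr fun ρ => ?_
      rw [add_sub_cancel_left, ENNReal.ofReal_mul (pker_nonneg hs.le _), Pi.mul_apply]
      ring
  rw [mix_pois, mix_pois, lintegral_congr h3, lintegral_lintegral_swap (f := fun r ρ =>
    ENNReal.ofReal (pker s (ρ - r) * pker a r) * ouL ρ F x) (by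
      exact (((hmeas2.mul (h1.comp measurable_fst)).ennreal_ofReal).mul
        (hFm.comp measurable_snd)).aemeasurable)]
  refine lintegral_congr fun ρ => ?_
  have h4 : Measurable fun r => ENNReal.ofReal (pker s (ρ - r) * pker a r) :=
    ((h2.comp (measurable_const.sub measurable_id)).mul h1).ennreal_ofReal
  rw [lintegral_mul_const _ h4, lintegral_pker_conv hs ha]

/-- The Gamma law `Γ(β)⁻¹ s^{β-1} e^{-s} ds` on `(0, ∞)`: the Bessel potential is the mean of
`P_s` under this law, since `(1 + λ)^{-β}` is its Laplace transform. -/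
def gammaLaw (β : ℝ) : Measure ℝ :=
  (volume.restrict (Ioi 0)).withDensity fun s =>
    ENNReal.ofReal (s ^ (β - 1) * Real.exp (-s) / Real.Gamma β)

instance sFinite_gammaLaw (β : ℝ) : SFinite (gammaLaw β) := by
  unfold gammaLaw
  infer_instance

theorem ae_gammaLaw_pos (β : ℝ) : ∀ᵐ s ∂(gammaLaw β), 0 < s :=
  (withDensity_absolutelyContinuous _ _).ae_le (ae_restrict_mem measurableSet_Ioi)

theorem lintegral_gammaLaw (β : ℝ) (f : ℝ → ℝ≥0∞) : ∫⁻ s, f s ∂(gammaLaw β) =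
    ∫⁻ s in Ioi 0, ENNReal.ofReal (s ^ (β - 1) * Real.exp (-s) / Real.Gamma β) * f s := by
  rw [gammaLaw, lintegral_withDensity_eq_lintegral_mul_non_measurable _ (by fun_prop)
    (Filter.Eventually.of_forall fun _ => ENNReal.ofReal_lt_top)]
  rfl

theorem lintegral_Ioi_rpow_mul_exp {a b : ℝ} (ha : 0 < a) (hb : 0 < b) :
    ∫⁻ s in Ioi 0, ENNReal.ofReal (s ^ (a - 1) * Real.exp (-(b * s))) =
      ENNReal.ofReal ((1 / b) ^ a * Real.Gamma a) := by
  have h := Real.integral_rpow_mul_exp_neg_mul_Ioi ha hb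
  have hpos : 0 < (1 / b) ^ a * Real.Gamma a :=
    mul_pos (Real.rpow_pos_of_pos (by positivity) a) (Real.Gamma_pos_of_pos ha)
  have hi : Integrable (fun s : ℝ => s ^ (a - 1) * Real.exp (-(b * s)))
      (volume.restrict (Ioi 0)) := by
    by_contra hc
    rw [integral_undef hc] at h
    exact hpos.ne h
  rw [← h, ofReal_integral_eq_lintegral_ofReal hi]
  filter_upwards [ae_restrict_mem measurableSet_Ioi] with s hs
  exact mul_nonneg (Real.rpow_nonneg (le_of_lt hs) _) (Real.exp_nonneg _)

theorem lintegral_exp_gammaLaw {β b : ℝ} (hβ : 0 < β) (hb : 0 ≤ b) :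
    ∫⁻ s, ENNReal.ofReal (Real.exp (-(s * b))) ∂(gammaLaw β) =
      ENNReal.ofReal ((1 + b) ^ (-β)) := by
  have hΓ := Real.Gamma_pos_of_pos hβ
  have h := lintegral_Ioi_rpow_mul_exp hβ (by linarith : 0 < 1 + b)
  rw [lintegral_gammaLaw]
  have h1 : ∀ s : ℝ, ENNReal.ofReal (s ^ (β - 1) * Real.exp (-s) / Real.Gamma β) *
      ENNReal.ofReal (Real.exp (-(s * b))) =
      ENNReal.ofReal (s ^ (β - 1) * Real.exp (-((1 + b) * s))) *
        ENNReal.ofReal (Real.Gamma β)⁻¹ := fun s => by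
    rw [← ENNReal.ofReal_mul' (Real.exp_nonneg _), ← ENNReal.ofReal_mul' (by positivity),
      show -((1 + b) * s) = -s + -(s * b) by ring, Real.exp_add]
    congr 1
    ring
  rw [lintegral_congr h1, lintegral_mul_const _ (by fun_prop), h,
    ← ENNReal.ofReal_mul' (by positivity), mul_assoc, mul_inv_cancel₀ hΓ.ne', mul_one,
    Real.rpow_neg (by positivity), one_div, Real.inv_rpow (by positivity)]

theorem isProbabilityMeasure_gammaLaw {β : ℝ} (hβ : 0 < β) :
    IsProbabilityMeasure (gammaLaw β) := by
  refine ⟨?_⟩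
  have h := lintegral_exp_gammaLaw hβ le_rfl
  simpa using h

theorem lintegral_ofReal_gammaLaw_ne_top {β : ℝ} (hβ : 0 < β) :
    ∫⁻ s, ENNReal.ofReal s ∂(gammaLaw β) ≠ ∞ := by
  have hΓ := Real.Gamma_pos_of_pos hβ
  have h := lintegral_Ioi_rpow_mul_exp (by linarith : 0 < β + 1) one_pos
  rw [lintegral_gammaLaw]
  have h1 : ∀ s ∈ Ioi (0 : ℝ), ENNReal.ofReal (s ^ (β - 1) * Real.exp (-s) / Real.Gamma β) *
      ENNReal.ofReal s =
      ENNReal.ofReal (s ^ (β + 1 - 1) * Real.exp (-(1 * s))) *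
        ENNReal.ofReal (Real.Gamma β)⁻¹ := fun s hs => by
    have hs0 : (0 : ℝ) < s := hs
    rw [← ENNReal.ofReal_mul' hs0.le, ← ENNReal.ofReal_mul' (by positivity),
      show β + 1 - 1 = (β - 1) + 1 by ring, Real.rpow_add_one hs0.ne', one_mul]
    congr 1
    ring
  rw [setLIntegral_congr_fun measurableSet_Ioi h1, lintegral_mul_const _ (by fun_prop), h]
  exact ENNReal.mul_ne_top ENNReal.ofReal_ne_top ENNReal.ofReal_ne_top

/-- The Bessel potential on nonnegative functions. -/
def besL (β : ℝ) (F : EuclideanSpace ℝ (Fin d) → ℝ≥0∞) (x : EuclideanSpace ℝ (Fin d)) : ℝ≥0∞ :=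
  ∫⁻ s, mix (pois s) F x ∂(gammaLaw β)

theorem measurable_besL (β : ℝ) {F : EuclideanSpace ℝ (Fin d) → ℝ≥0∞} (hF : Measurable F) :
    Measurable (besL β F) :=
  Measurable.lintegral_prod_left' (measurable_mix_pois_prod hF)

theorem lintegral_besL_rpow_le {β : ℝ} (hβ : 0 < β) {F : EuclideanSpace ℝ (Fin d) → ℝ≥0∞}
    (hF : Measurable F) {p : ℝ} (hp : 1 ≤ p) :
    ∫⁻ x, besL β F x ^ p ∂(gaussian d) ≤ ∫⁻ x, F x ^ p ∂(gaussian d) := by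
  have := isProbabilityMeasure_gammaLaw hβ
  have hm := measurable_mix_pois_prod hF
  calc ∫⁻ x, besL β F x ^ p ∂(gaussian d)
      ≤ ∫⁻ x, ∫⁻ s, mix (pois s) F x ^ p ∂(gammaLaw β) ∂(gaussian d) := by
        refine lintegral_mono fun x => ?_
        refine (lintegral_rpow_le _ (measurable_mix_pois_time hF x).aemeasurable hp).trans_eq ?_
        simp
    _ = ∫⁻ s, ∫⁻ x, mix (pois s) F x ^ p ∂(gaussian d) ∂(gammaLaw β) :=
        lintegral_lintegral_swap (f := fun x s => mix (pois s) F x ^ p) (by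
          exact ((hm.comp measurable_swap).pow_const p).aemeasurable)
    _ ≤ ∫⁻ _, ∫⁻ x, F x ^ p ∂(gaussian d) ∂(gammaLaw β) := by
        refine lintegral_mono_ae ((ae_gammaLaw_pos β).mono fun s hs => ?_)
        have := isProbabilityMeasure_pois hs
        exact lintegral_mix_rpow_le ((ae_pois_pos s).mono fun r hr => hr.le) hF hp
    _ = ∫⁻ x, F x ^ p ∂(gaussian d) := by simp

/-- `P_t (I + √(-L))^{-β} F` is finite as soon as `P_t F` is. -/
theorem lintegral_mix_pois_add_ne_top {β : ℝ} (hβ : 0 < β)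
    {F : EuclideanSpace ℝ (Fin d) → ℝ≥0∞} {t : ℝ} (ht : 0 < t) {x : EuclideanSpace ℝ (Fin d)}
    (hx : mix (pois t) F x ≠ ∞) : ∫⁻ s, mix (pois (s + t)) F x ∂(gammaLaw β) ≠ ∞ := by
  have := isProbabilityMeasure_gammaLaw hβ
  have hle : ∫⁻ s, mix (pois (s + t)) F x ∂(gammaLaw β) ≤
      (∫⁻ s, ENNReal.ofReal t⁻¹ * ENNReal.ofReal s + 1 ∂(gammaLaw β)) * mix (pois t) F x := by
    rw [← lintegral_mul_const _ (by fun_prop)]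
    refine lintegral_mono_ae ((ae_gammaLaw_pos β).mono fun s hs => ?_)
    refine (mix_pois_le_mul ht (by linarith : t ≤ s + t) F x).trans ?_
    gcongr
    rw [← ENNReal.ofReal_mul (by positivity), ← ENNReal.ofReal_one,
      ← ENNReal.ofReal_add (by positivity) one_pos.le]
    refine ENNReal.ofReal_le_ofReal (le_of_eq ?_)
    field_simp
  refine ne_top_of_le_ne_top (ENNReal.mul_ne_top ?_ hx) hle
  rw [lintegral_add_right _ measurable_const, lintegral_const_mul _ (by fun_prop)]
  refine ENNReal.add_ne_top.2 ⟨ENNReal.mul_ne_top ENNReal.ofReal_ne_top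
    (lintegral_ofReal_gammaLaw_ne_top hβ), by simp⟩

/-- The Bessel potential `(I + √(-L))^{-β} f`, as the integral of `P_s f` against the Gamma
law. -/
def bop (β : ℝ) (f : EuclideanSpace ℝ (Fin d) → ℝ) (x : EuclideanSpace ℝ (Fin d)) : ℝ :=
  ∫ s, dP 0 s f x ∂(gammaLaw β)

theorem measurable_bop (β : ℝ) {f : EuclideanSpace ℝ (Fin d) → ℝ} (hf : Measurable f) :
    Measurable (bop β f) :=
  ((measurable_dP 0 hf).stronglyMeasurable.integral_prod_left').measurable

theorem measurable_dP_time (m : ℕ) {f : EuclideanSpace ℝ (Fin d) → ℝ} (hf : Measurable f)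
    (x : EuclideanSpace ℝ (Fin d)) : Measurable fun s => dP m s f x := by
  have h := (measurable_dP m hf).comp (measurable_prodMk_right (y := x))
  exact h

theorem enorm_dP_zero_le {s : ℝ} (hs : 0 < s) (f : EuclideanSpace ℝ (Fin d) → ℝ)
    (x : EuclideanSpace ℝ (Fin d)) : ‖dP 0 s f x‖ₑ ≤ mix (pois s) (fun y => ‖f y‖ₑ) x := by
  refine (enorm_dP_le 0 s f x).trans_eq ?_
  rw [mix_pois]
  refine lintegral_congr fun r => ?_
  rw [pkd_zero, Real.enorm_of_nonneg (pker_nonneg hs.le r)]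

theorem lintegral_enorm_dP_zero_le (β : ℝ) (f : EuclideanSpace ℝ (Fin d) → ℝ)
    (x : EuclideanSpace ℝ (Fin d)) :
    ∫⁻ s, ‖dP 0 s f x‖ₑ ∂(gammaLaw β) ≤ besL β (fun y => ‖f y‖ₑ) x :=
  lintegral_mono_ae ((ae_gammaLaw_pos β).mono fun _ hs => enorm_dP_zero_le hs f x)

theorem enorm_bop_le (β : ℝ) (f : EuclideanSpace ℝ (Fin d) → ℝ) (x : EuclideanSpace ℝ (Fin d)) :
    ‖bop β f x‖ₑ ≤ besL β (fun y => ‖f y‖ₑ) x :=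
  (enorm_integral_le_lintegral_enorm _).trans (lintegral_enorm_dP_zero_le β f x)

theorem mix_pois_enorm_bop_le (β : ℝ) {f : EuclideanSpace ℝ (Fin d) → ℝ} (hf : Measurable f)
    {t : ℝ} (ht : 0 < t) (x : EuclideanSpace ℝ (Fin d)) :
    mix (pois t) (fun y => ‖bop β f y‖ₑ) x ≤
      ∫⁻ s, mix (pois (s + t)) (fun y => ‖f y‖ₑ) x ∂(gammaLaw β) := by
  have hF : Measurable fun y => ‖f y‖ₑ := by fun_prop
  have hm := measurable_mix_pois_prod hF
  refine (mix_mono (fun y => enorm_bop_le β f y) x).trans_eq ?_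
  rw [mix_eq_lintegral_prod (measurable_besL β hF)]
  simp only [besL]
  rw [lintegral_lintegral_swap (by
    have h := hm.comp (f := fun z : (ℝ × EuclideanSpace ℝ (Fin d)) × ℝ =>
      (z.2, √(1 - Real.exp (-2 * z.1.1)) • z.1.2 + Real.exp (-z.1.1) • x)) (by fun_prop)
    exact h.aemeasurable)]
  refine lintegral_congr_ae ((ae_gammaLaw_pos β).mono fun s hs => ?_)
  dsimp only
  rw [← mix_pois_mix_pois hF ht hs, mix_eq_lintegral_prod (measurable_mix hF)]

theorem IsGood.bop {β : ℝ} (hβ : 0 < β) {f : EuclideanSpace ℝ (Fin d) → ℝ} (hf : Measurable f)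
    {x : EuclideanSpace ℝ (Fin d)} (hx : IsGood f x) : IsGood (bop β f) x := fun t ht =>
  ne_top_of_le_ne_top (lintegral_mix_pois_add_ne_top hβ ht (hx t ht))
    (mix_pois_enorm_bop_le β hf ht x)

/-- The derivatives of `P_t (I + √(-L))^{-β} f` in terms of those of `P_t f`. -/
theorem dP_bop {β : ℝ} (hβ : 0 < β) {f : EuclideanSpace ℝ (Fin d) → ℝ} (hf : Measurable f)
    {x : EuclideanSpace ℝ (Fin d)} (hx : IsGood f x) (m : ℕ) {t : ℝ} (ht : 0 < t) :
    dP m t (bop β f) x = ∫ s, dP m (t + s) f x ∂(gammaLaw β) := by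
  have hF : Measurable fun y => ‖f y‖ₑ := by fun_prop
  have ht2 : 0 < t / 2 := by positivity
  have hk := measurable_pkd_right m t
  have hd := measurable_dP 0 hf
  have hmeas : Measurable fun z : (ℝ × EuclideanSpace ℝ (Fin d)) × ℝ => pkd m t z.1.1 *
      dP 0 z.2 f (√(1 - Real.exp (-2 * z.1.1)) • z.1.2 + Real.exp (-z.1.1) • x) := by
    have h1 := hd.comp (f := fun z : (ℝ × EuclideanSpace ℝ (Fin d)) × ℝ =>
      (z.2, √(1 - Real.exp (-2 * z.1.1)) • z.1.2 + Real.exp (-z.1.1) • x)) (by fun_prop)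
    exact (hk.comp (measurable_fst.comp measurable_fst)).mul h1
  rw [dP_eq_integral_prod m (measurable_bop β hf) ht (hx.bop hβ hf _ ht2)]
  simp only [bop, ← integral_const_mul]
  rw [integral_integral_swap]
  · refine integral_congr_ae ((ae_gammaLaw_pos β).mono fun s hs => ?_)
    dsimp only
    have hfin : mix (pois (t / 2)) (fun y => ‖dP 0 s f y‖ₑ) x ≠ ∞ := by
      refine ne_top_of_le_ne_top ?_ (mix_mono (fun y => enorm_dP_zero_le hs f y) x)
      rw [mix_pois_mix_pois hF ht2 hs]
      exact hx _ (by positivity)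
    rw [← dP_eq_integral_prod m (measurable_dP_right 0 s hf) ht hfin, dP_dP hf hx m 0 ht hs,
      zero_add]
  · refine ⟨hmeas.aestronglyMeasurable, ?_⟩
    rw [hasFiniteIntegral_iff_enorm, lintegral_prod_symm _ (by exact hmeas.enorm.aemeasurable)]
    obtain ⟨C, hC, hb⟩ := exists_lintegral_enorm_pkd_le (d := d) m
    refine lt_of_le_of_lt (b := ENNReal.ofReal (C / t ^ m) *
      ∫⁻ s, mix (pois (s + t / 2)) (fun y => ‖f y‖ₑ) x ∂(gammaLaw β)) ?_
      (ENNReal.mul_lt_top ENNReal.ofReal_lt_top (lt_top_iff_ne_top.2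
        (lintegral_mix_pois_add_ne_top hβ ht2 (hx _ ht2))))
    rw [← lintegral_const_mul' _ _ ENNReal.ofReal_ne_top]
    refine lintegral_mono_ae ((ae_gammaLaw_pos β).mono fun s hs => ?_)
    rw [← mix_pois_mix_pois hF ht2 hs]
    refine le_trans ?_ (hb t ht (mix (pois s) fun y => ‖f y‖ₑ) x)
    have hmix := measurable_mix (ν := pois s) hF
    rw [lintegral_prod _ (by
      have h := hmeas.comp (measurable_prodMk_right (y := s))
      exact h.enorm.aemeasurable)]
    refine lintegral_mono fun r => ?_
    simp only [Function.uncurry, enorm_mul]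
    rw [lintegral_const_mul' _ _ enorm_ne_top]
    gcongr
    exact lintegral_mono fun u => enorm_dP_zero_le hs f _

theorem bop_congr {β : ℝ} {f g : EuclideanSpace ℝ (Fin d) → ℝ} (hf : Measurable f)
    (hg : Measurable g) (h : f =ᵐ[gaussian d] g) : bop β f =ᵐ[gaussian d] bop β g := by
  filter_upwards [ae_dP_congr hf hg h] with x hx
  simp only [bop, hx.2]

theorem dP_const_mul (m : ℕ) (t a : ℝ) (f : EuclideanSpace ℝ (Fin d) → ℝ)
    (x : EuclideanSpace ℝ (Fin d)) : dP m t (fun y => a * f y) x = a * dP m t f x := by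
  simp only [dP, ornsteinUhlenbeck]
  rw [← integral_const_mul]
  refine integral_congr_ae (Filter.Eventually.of_forall fun r => ?_)
  simp only [integral_const_mul]
  ring

theorem bop_const_mul (β a : ℝ) (f : EuclideanSpace ℝ (Fin d) → ℝ)
    (x : EuclideanSpace ℝ (Fin d)) : bop β (fun y => a * f y) x = a * bop β f x := by
  simp only [bop, dP_const_mul, integral_const_mul]

theorem dP_add (m : ℕ) {f g : EuclideanSpace ℝ (Fin d) → ℝ} (hf : Measurable f)
    (hg : Measurable g) {x : EuclideanSpace ℝ (Fin d)} (hfx : IsGood f x) (hgx : IsGood g x)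
    {t : ℝ} (ht : 0 < t) : dP m t (fun y => f y + g y) x = dP m t f x + dP m t g x := by
  have ht2 : 0 < t / 2 := by positivity
  have hsum : mix (pois (t / 2)) (fun y => ‖f y + g y‖ₑ) x ≠ ∞ := by
    refine ne_top_of_le_ne_top (ENNReal.add_ne_top.2 ⟨hfx _ ht2, hgx _ ht2⟩) ?_
    rw [← mix_add (by fun_prop)]
    exact mix_mono (fun y => enorm_add_le _ _) x
  rw [dP_eq_integral_prod m (f := fun y => f y + g y) (hf.add hg) ht hsum,
    dP_eq_integral_prod m hf ht (hfx _ ht2),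
    dP_eq_integral_prod m hg ht (hgx _ ht2), ← integral_add (integrable_pkd_prod m hf ht (hfx _ ht2))
      (integrable_pkd_prod m hg ht (hgx _ ht2))]
  simp only [mul_add]

theorem bop_add {β : ℝ} {f g : EuclideanSpace ℝ (Fin d) → ℝ} (hf : Measurable f)
    (hg : Measurable g) {x : EuclideanSpace ℝ (Fin d)} (hfx : IsGood f x) (hgx : IsGood g x)
    (hfb : besL β (fun y => ‖f y‖ₑ) x ≠ ∞) (hgb : besL β (fun y => ‖g y‖ₑ) x ≠ ∞) :
    bop β (fun y => f y + g y) x = bop β f x + bop β g x := by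
  have hint : ∀ {h : EuclideanSpace ℝ (Fin d) → ℝ}, Measurable h →
      besL β (fun y => ‖h y‖ₑ) x ≠ ∞ → Integrable (fun s => dP 0 s h x) (gammaLaw β) :=
    fun {h} hm hb => ⟨(measurable_dP_time 0 hm x).aestronglyMeasurable,
      lt_of_le_of_lt (lintegral_enorm_dP_zero_le β h x) (lt_top_iff_ne_top.2 hb)⟩
  simp only [bop]
  rw [← integral_add (hint hf hfb) (hint hg hgb)]
  exact integral_congr_ae ((ae_gammaLaw_pos β).mono fun s hs => dP_add 0 hf hg hfx hgx hs)

/-- The Laplace transform of the Gamma law at `√|ν|` is `(1 + √|ν|)^{-β}`. -/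
theorem bop_hermite {β : ℝ} (hβ : 0 < β) (ν : Fin d → ℕ) (x : EuclideanSpace ℝ (Fin d)) :
    bop β (hermite ν) x = (1 + √((∑ i, ν i : ℕ) : ℝ)) ^ (-β) * hermite ν x := by
  rw [bop, integral_congr_ae ((ae_gammaLaw_pos β).mono fun s hs => dP_zero_hermite ν hs x),
    integral_mul_const]
  congr 1
  rw [integral_eq_lintegral_of_nonneg_ae (Filter.Eventually.of_forall fun s => Real.exp_nonneg _)
    (by fun_prop), lintegral_exp_gammaLaw hβ (Real.sqrt_nonneg _),
    ENNReal.toReal_ofReal (by positivity)]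

variable {p : ℝ≥0∞} [Fact (1 ≤ p)]

theorem eLpNorm_bop_le (hp : p ≠ ∞) {β : ℝ} (hβ : 0 < β) {f : EuclideanSpace ℝ (Fin d) → ℝ}
    (hf : Measurable f) : eLpNorm (bop β f) p (gaussian d) ≤ eLpNorm f p (gaussian d) := by
  have hp1 : 1 ≤ p := Fact.out
  have hp0 : p ≠ 0 := (lt_of_lt_of_le one_pos hp1).ne'
  have hpr : 1 ≤ p.toReal := by
    simpa using ENNReal.toReal_mono hp hp1
  rw [eLpNorm_eq_lintegral_rpow_enorm_toReal hp0 hp, eLpNorm_eq_lintegral_rpow_enorm_toReal hp0 hp]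
  gcongr 1
  refine le_trans (lintegral_mono fun x => ?_)
    (lintegral_besL_rpow_le hβ (F := fun y => ‖f y‖ₑ) (by fun_prop) hpr)
  gcongr
  exact enorm_bop_le β f x

theorem memLp_bop (hp : p ≠ ∞) {β : ℝ} (hβ : 0 < β) (f : Lp ℝ p (gaussian d)) :
    MemLp (bop β f) p (gaussian d) :=
  ⟨(measurable_bop β (Lp.stronglyMeasurable f).measurable).aestronglyMeasurable,
    (eLpNorm_bop_le hp hβ (Lp.stronglyMeasurable f).measurable).trans_lt (Lp.memLp f).2⟩

theorem lintegral_enorm_ne_top (f : Lp ℝ p (gaussian d)) : ∫⁻ x, ‖f x‖ₑ ∂(gaussian d) ≠ ∞ :=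
  (((Lp.memLp f).integrable Fact.out).2).ne

theorem ae_besL_ne_top {β : ℝ} (hβ : 0 < β) (f : Lp ℝ p (gaussian d)) :
    ∀ᵐ x ∂(gaussian d), besL β (fun y => ‖f y‖ₑ) x ≠ ∞ := by
  have hm : Measurable fun y => ‖f y‖ₑ := (Lp.stronglyMeasurable f).measurable.enorm
  have h := lintegral_besL_rpow_le hβ hm le_rfl
  simp only [ENNReal.rpow_one] at h
  exact (ae_lt_top (measurable_besL β hm)
    (ne_top_of_le_ne_top (lintegral_enorm_ne_top f) h)).mono fun x hx => hx.ne

/-- The Bessel potential as a bounded operator on `L^p(γ_d)`. -/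
def besselOp (hp : p ≠ ∞) {β : ℝ} (hβ : 0 < β) :
    Lp ℝ p (gaussian d) →L[ℝ] Lp ℝ p (gaussian d) :=
  LinearMap.mkContinuous
    { toFun := fun f => (memLp_bop hp hβ f).toLp
      map_add' := fun f g => by
        have hf := (Lp.stronglyMeasurable f).measurable
        have hg := (Lp.stronglyMeasurable g).measurable
        refine Lp.ext ?_
        have h1 := bop_congr (β := β) (Lp.stronglyMeasurable (f + g)).measurable (hf.add hg)
          (Lp.coeFn_add f g)
        filter_upwards [(memLp_bop hp hβ (f + g)).coeFn_toLp, (memLp_bop hp hβ f).coeFn_toLp,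
          (memLp_bop hp hβ g).coeFn_toLp, Lp.coeFn_add (memLp_bop hp hβ f).toLp
          (memLp_bop hp hβ g).toLp, h1, ae_isGood hf (lintegral_enorm_ne_top f),
          ae_isGood hg (lintegral_enorm_ne_top g), ae_besL_ne_top hβ f, ae_besL_ne_top hβ g]
          with x e1 e2 e3 e4 e5 g1 g2 b1 b2
        rw [e1, e4, Pi.add_apply, e2, e3, e5]
        exact bop_add hf hg g1 g2 b1 b2
      map_smul' := fun a f => by
        have hf := (Lp.stronglyMeasurable f).measurable
        refine Lp.ext ?_
        have h1 := bop_congr (β := β) (Lp.stronglyMeasurable (a • f)).measurable (hf.const_smul a)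
          (Lp.coeFn_smul a f)
        filter_upwards [(memLp_bop hp hβ (a • f)).coeFn_toLp, (memLp_bop hp hβ f).coeFn_toLp,
          Lp.coeFn_smul a (memLp_bop hp hβ f).toLp, h1] with x e1 e2 e3 e4
        rw [e1, RingHom.id_apply, e3, Pi.smul_apply, e2, e4]
        exact bop_const_mul β a f x }
    1 fun f => by
      rw [one_mul, LinearMap.coe_mk, AddHom.coe_mk, Lp.norm_toLp, Lp.norm_def]
      exact ENNReal.toReal_mono (Lp.memLp f).2.ne
        (eLpNorm_bop_le hp hβ (Lp.stronglyMeasurable f).measurable)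

theorem coeFn_besselOp (hp : p ≠ ∞) {β : ℝ} (hβ : 0 < β) (f : Lp ℝ p (gaussian d)) :
    besselOp hp hβ f =ᵐ[gaussian d] bop β f :=
  (memLp_bop hp hβ f).coeFn_toLp

theorem isBesselPotential_besselOp (hp : p ≠ ∞) {β : ℝ} (hβ : 0 < β) :
    IsBesselPotential hp β (besselOp (d := d) hp hβ) := fun ν => by
  refine Lp.ext ?_
  have h1 := bop_congr (β := β) (Lp.stronglyMeasurable (hermiteLp hp ν)).measurable
    (continuous_hermite ν).measurable (memLp_hermite ν hp).coeFn_toLp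
  filter_upwards [coeFn_besselOp hp hβ (hermiteLp hp ν), h1, (memLp_hermite ν hp).coeFn_toLp,
    Lp.coeFn_smul ((1 + √((∑ i, ν i : ℕ) : ℝ)) ^ (-β)) (hermiteLp hp ν)] with x e1 e2 e3 e4
  rw [e1, e2, e4, Pi.smul_apply, bop_hermite hβ, smul_eq_mul]
  congr 1
  exact e3.symm

end

section

/-! ### The scale-invariant measure and Hardy's inequality -/

/-- The measure `dt/t` on `(0, ∞)`. -/
def logMeasure : Measure ℝ := (volume.restrict (Ioi 0)).withDensity fun t => ENNReal.ofReal t⁻¹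

instance sFinite_logMeasure : SFinite logMeasure := by
  unfold logMeasure
  infer_instance

theorem ae_logMeasure_pos : ∀ᵐ t ∂logMeasure, 0 < t :=
  (withDensity_absolutelyContinuous _ _).ae_le (ae_restrict_mem measurableSet_Ioi)

theorem lintegral_logMeasure (f : ℝ → ℝ≥0∞) :
    ∫⁻ t, f t ∂logMeasure = ∫⁻ t in Ioi 0, ENNReal.ofReal t⁻¹ * f t := by
  rw [logMeasure, lintegral_withDensity_eq_lintegral_mul_non_measurable _ (by fun_prop)
    (Filter.Eventually.of_forall fun _ => ENNReal.ofReal_lt_top)]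
  rfl

theorem lintegral_Ioi_comp_mul {c : ℝ} (hc : 0 < c) (g : ℝ → ℝ≥0∞) :
    ∫⁻ s in Ioi (0 : ℝ), g s = ∫⁻ σ in Ioi (0 : ℝ), ENNReal.ofReal c * g (c * σ) := by
  have himg : (fun s => c * s) '' Ioi (0 : ℝ) = Ioi 0 := by
    rw [image_mul_left_Ioi hc, mul_zero]
  have h := lintegral_image_eq_lintegral_abs_deriv_mul (s := Ioi (0 : ℝ)) (f := fun s => c * s)
    (f' := fun _ => c) measurableSet_Ioi (fun s _ => by
      simpa using ((hasDerivAt_id s).const_mul c).hasDerivWithinAt)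
    (mul_right_injective₀ hc.ne').injOn g
  rw [himg] at h
  rw [h, abs_of_pos hc]

theorem lintegral_logMeasure_comp_mul {c : ℝ} (hc : 0 < c) (f : ℝ → ℝ≥0∞) :
    ∫⁻ t, f (c * t) ∂logMeasure = ∫⁻ t, f t ∂logMeasure := by
  rw [lintegral_logMeasure, lintegral_logMeasure,
    lintegral_Ioi_comp_mul hc fun t => ENNReal.ofReal t⁻¹ * f t]
  refine setLIntegral_congr_fun measurableSet_Ioi fun t (ht : 0 < t) => ?_
  rw [← mul_assoc, ← ENNReal.ofReal_mul hc.le]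
  congr 2
  field_simp

/-- A mean of dilations acts boundedly on `L^q(dt/t)`. -/
theorem lintegral_dilation_rpow_le (κ : Measure ℝ) [SFinite κ] {c : ℝ → ℝ} (hc : Measurable c)
    (hpos : ∀ᵐ σ ∂κ, 0 < c σ) {h : ℝ → ℝ≥0∞} (hh : Measurable h) {q : ℝ} (hq : 1 ≤ q) :
    ∫⁻ t, (∫⁻ σ, h (c σ * t) ∂κ) ^ q ∂logMeasure ≤
      κ univ ^ (q - 1) * κ univ * ∫⁻ t, h t ^ q ∂logMeasure := by
  calc ∫⁻ t, (∫⁻ σ, h (c σ * t) ∂κ) ^ q ∂logMeasure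
      ≤ ∫⁻ t, κ univ ^ (q - 1) * ∫⁻ σ, h (c σ * t) ^ q ∂κ ∂logMeasure :=
        lintegral_mono fun t => lintegral_rpow_le κ (by fun_prop) hq
    _ = κ univ ^ (q - 1) * ∫⁻ t, ∫⁻ σ, h (c σ * t) ^ q ∂κ ∂logMeasure := by
        rw [lintegral_const_mul _ (Measurable.lintegral_prod_right'
          (f := fun z : ℝ × ℝ => h (c z.2 * z.1) ^ q) (by fun_prop))]
    _ = κ univ ^ (q - 1) * ∫⁻ σ, ∫⁻ t, h (c σ * t) ^ q ∂logMeasure ∂κ := by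
        rw [lintegral_lintegral_swap (f := fun t σ => h (c σ * t) ^ q) (by fun_prop)]
    _ = κ univ ^ (q - 1) * ∫⁻ _, ∫⁻ t, h t ^ q ∂logMeasure ∂κ := by
        congr 1
        exact lintegral_congr_ae (hpos.mono fun σ hσ =>
          lintegral_logMeasure_comp_mul hσ fun t => h t ^ q)
    _ = κ univ ^ (q - 1) * κ univ * ∫⁻ t, h t ^ q ∂logMeasure := by
        rw [lintegral_const]
        ring

/-- The measure `σ^{β-1} (1 + σ)^{-b} dσ` on `(0, ∞)`, the weight in Hardy's inequality; its total
mass is the beta integral `B(β, b - β)`. -/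
def betaLaw (β b : ℝ) : Measure ℝ :=
  (volume.restrict (Ioi 0)).withDensity fun σ => ENNReal.ofReal (σ ^ (β - 1) * (1 + σ) ^ (-b))

instance sFinite_betaLaw (β b : ℝ) : SFinite (betaLaw β b) := by
  unfold betaLaw
  infer_instance

theorem ae_betaLaw_pos (β b : ℝ) : ∀ᵐ σ ∂(betaLaw β b), 0 < σ :=
  (withDensity_absolutelyContinuous _ _).ae_le (ae_restrict_mem measurableSet_Ioi)

theorem lintegral_betaLaw (β b : ℝ) (f : ℝ → ℝ≥0∞) : ∫⁻ σ, f σ ∂(betaLaw β b) =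
    ∫⁻ σ in Ioi 0, ENNReal.ofReal (σ ^ (β - 1) * (1 + σ) ^ (-b)) * f σ := by
  rw [betaLaw, lintegral_withDensity_eq_lintegral_mul_non_measurable _ (by fun_prop)
    (Filter.Eventually.of_forall fun _ => ENNReal.ofReal_lt_top)]
  rfl

theorem betaLaw_univ_ne_top {β b : ℝ} (hβ : 0 < β) (hb : β < b) : betaLaw β b univ ≠ ∞ := by
  rw [betaLaw, withDensity_apply _ MeasurableSet.univ, Measure.restrict_univ,
    ← Ioc_union_Ioi_eq_Ioi zero_le_one]
  refine ne_top_of_le_ne_top ?_ (lintegral_union_le _ _ _)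
  refine ENNReal.add_ne_top.2 ⟨?_, ?_⟩
  · have h1 : IntegrableOn (fun σ : ℝ => σ ^ (β - 1)) (Ioc 0 1) := by
      have h := intervalIntegral.intervalIntegrable_rpow' (a := 0) (b := 1)
        (by linarith : -1 < β - 1)
      rwa [intervalIntegrable_iff_integrableOn_Ioc_of_le zero_le_one] at h
    refine ne_top_of_le_ne_top h1.2.ne (setLIntegral_mono_ae (by fun_prop)
      (Filter.Eventually.of_forall fun σ hσ => ?_))
    have h0 : (0 : ℝ) ≤ σ ^ (β - 1) := Real.rpow_nonneg hσ.1.le _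
    rw [Real.enorm_of_nonneg h0]
    refine ENNReal.ofReal_le_ofReal (mul_le_of_le_one_right h0 ?_)
    exact Real.rpow_le_one_of_one_le_of_nonpos (by linarith [hσ.1]) (by linarith)
  · have h1 : IntegrableOn (fun σ : ℝ => σ ^ (β - 1 + -b)) (Ioi 1) :=
      integrableOn_Ioi_rpow_of_lt (by linarith) one_pos
    refine ne_top_of_le_ne_top h1.2.ne (setLIntegral_mono_ae (by fun_prop)
      (Filter.Eventually.of_forall fun σ (hσ : 1 < σ) => ?_))
    have hσ0 : 0 < σ := by linarith
    have hadd := Real.rpow_add hσ0 (β - 1) (-b)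
    rw [Real.enorm_of_nonneg (by positivity)]
    simp only [hadd]
    refine ENNReal.ofReal_le_ofReal ?_
    gcongr ?_ * ?_
    exact Real.rpow_le_rpow_of_nonpos hσ0 (by linarith) (by linarith)

/-! ### Boundedness on Triebel-Lizorkin spaces -/

variable {d : ℕ}

/-- The weighted derivative `t^{k-α} |∂_t^k P_t f(x)|`. -/
def wd (k : ℕ) (α : ℝ) (f : EuclideanSpace ℝ (Fin d) → ℝ) (z : ℝ × EuclideanSpace ℝ (Fin d)) :
    ℝ≥0∞ :=
  ENNReal.ofReal (z.1 ^ ((k : ℝ) - α)) * ‖dP k z.1 f z.2‖ₑ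

theorem measurable_wd (k : ℕ) (α : ℝ) {f : EuclideanSpace ℝ (Fin d) → ℝ} (hf : Measurable f) :
    Measurable (wd k α f) := by
  have := measurable_dP k hf
  unfold wd
  fun_prop

theorem triebelFun_eq {α q : ℝ} (hq : 1 ≤ q) {f : EuclideanSpace ℝ (Fin d) → ℝ}
    (hf : Measurable f) {x : EuclideanSpace ℝ (Fin d)} (hx : IsGood f x) :
    triebelFun α q f x =
      (∫⁻ t, wd (⌊α⌋₊ + 1) α f (t, x) ^ q ∂logMeasure) ^ (1 / q) := by
  rw [triebelFun, lintegral_logMeasure]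
  congr 1
  refine setLIntegral_congr_fun measurableSet_Ioi fun t (ht : 0 < t) => ?_
  rw [hx.iteratedDeriv_eq hf _ ht, wd, Real.enorm_eq_ofReal_abs,
    ← ENNReal.ofReal_mul (by positivity), ENNReal.ofReal_rpow_of_nonneg (by positivity) (by linarith),
    ← ENNReal.ofReal_mul (by positivity)]
  congr 1
  ring

/-- A higher time derivative is controlled by averages of a lower one at half the time. -/
theorem exists_enorm_dP_le_mix {k l : ℕ} (hkl : k ≤ l) (α : ℝ) : ∃ C : ℝ, 0 ≤ C ∧
    ∀ f : EuclideanSpace ℝ (Fin d) → ℝ, Measurable f → ∀ x, IsGood f x → ∀ t : ℝ, 0 < t →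
      ‖dP l t f x‖ₑ ≤ ENNReal.ofReal (C * t ^ (-((l : ℝ) - α))) *
        mix (pois (t / 2 / 2)) (fun y => wd k α f (t / 2, y)) x := by
  obtain ⟨C, hC, hb⟩ := exists_lintegral_enorm_pkd_le (d := d) (l - k)
  refine ⟨C * 2 ^ ((l : ℝ) - α), by positivity, fun f hf x hx t ht => ?_⟩
  have ht2 : 0 < t / 2 := by positivity
  have h1 : dP l t f x = dP (l - k) (t / 2) (dP k (t / 2) f) x := by
    rw [dP_dP hf hx _ _ ht2 ht2, add_halves, Nat.add_sub_cancel' hkl]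
  have hm : Measurable fun y => ‖dP k (t / 2) f y‖ₑ := (measurable_dP_right k _ hf).enorm
  rw [h1]
  refine (enorm_dP_le _ _ _ _).trans ((hb _ ht2 _ x).trans_eq ?_)
  simp only [wd]
  rw [mix_const_mul hm, ← mul_assoc, ← ENNReal.ofReal_mul (by positivity)]
  congr 2
  have e1 : (t / 2) ^ (l - k) = (t / 2) ^ ((l : ℝ) - k) := by
    rw [← Real.rpow_natCast, Nat.cast_sub hkl]
  have e2 : C * 2 ^ ((l : ℝ) - α) * t ^ (-((l : ℝ) - α)) = C * (t / 2) ^ (-((l : ℝ) - α)) := by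
    rw [Real.div_rpow ht.le (by norm_num), Real.rpow_neg (by norm_num : (0 : ℝ) ≤ 2), div_inv_eq_mul]
    ring
  rw [e1, e2, mul_assoc, div_eq_mul_inv, ← Real.rpow_neg ht2.le, ← Real.rpow_add ht2]
  congr 2
  ring

/-- Pointwise estimate of the derivatives of `P_t (I + √(-L))^{-β} f` by a mean of dilations. The
factor `e^{-s}` of the Gamma law is bounded by `1`, and the substitution `s = tσ` makes the rest
homogeneous in `t`. -/
theorem exists_wd_bop_le {β : ℝ} (hβ : 0 < β) {k l : ℕ} (hkl : k ≤ l) (α : ℝ) : ∃ C : ℝ≥0∞,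
    C ≠ ∞ ∧ ∀ f : EuclideanSpace ℝ (Fin d) → ℝ, Measurable f → ∀ x, IsGood f x →
      ∀ t : ℝ, 0 < t → wd l (α + β) (bop β f) (t, x) ≤
        C * ∫⁻ σ, mix (pois ((1 + σ) / 2 * t / 2)) (fun y => wd k α f ((1 + σ) / 2 * t, y)) x
          ∂(betaLaw β ((l : ℝ) - α)) := by
  obtain ⟨C, hC, hb⟩ := exists_enorm_dP_le_mix (d := d) hkl α
  have hΓ := Real.Gamma_pos_of_pos hβ
  refine ⟨ENNReal.ofReal (C / Real.Gamma β), ENNReal.ofReal_ne_top, fun f hf x hx t ht => ?_⟩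
  simp only [wd]
  rw [dP_bop hβ hf hx l ht]
  refine (mul_le_mul_right (enorm_integral_le_lintegral_enorm _) _).trans ?_
  rw [lintegral_gammaLaw, lintegral_betaLaw, lintegral_Ioi_comp_mul ht,
    ← lintegral_const_mul' _ _ ENNReal.ofReal_ne_top,
    ← lintegral_const_mul' _ _ ENNReal.ofReal_ne_top]
  refine setLIntegral_mono_ae' measurableSet_Ioi (Filter.Eventually.of_forall
    fun σ (hσ : 0 < σ) => ?_)
  have hs : 0 < t + t * σ := by positivity
  have harg : (t + t * σ) / 2 = (1 + σ) / 2 * t := by ring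
  have h1 := hb f hf x hx _ hs
  rw [harg] at h1
  simp only [wd] at h1
  refine (mul_le_mul_right (mul_le_mul_right (mul_le_mul_right h1 _) _) _).trans ?_
  simp only [← mul_assoc]
  gcongr ?_ * _
  rw [← ENNReal.ofReal_mul (by positivity), ← ENNReal.ofReal_mul (by positivity),
    ← ENNReal.ofReal_mul (by positivity), ← ENNReal.ofReal_mul (by positivity)]
  refine ENNReal.ofReal_le_ofReal ?_
  -- the powers of `t` cancel: `l - α - β + 1 + (β - 1) - (l - α) = 0`
  have hpow : t ^ ((l : ℝ) - (α + β)) * t * t ^ (β - 1) * t ^ (-((l : ℝ) - α)) = 1 := by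
    rw [← Real.rpow_add_one ht.ne', ← Real.rpow_add ht, ← Real.rpow_add ht,
      show (l : ℝ) - (α + β) + 1 + (β - 1) + -((l : ℝ) - α) = 0 by ring, Real.rpow_zero]
  have hexp : Real.exp (-(t * σ)) ≤ 1 := Real.exp_le_one_iff.2 (by nlinarith)
  rw [Real.mul_rpow ht.le hσ.le, show t + t * σ = t * (1 + σ) by ring,
    Real.mul_rpow ht.le (by positivity)]
  calc t ^ ((l : ℝ) - (α + β)) * t * (t ^ (β - 1) * σ ^ (β - 1) * Real.exp (-(t * σ)) /
        Real.Gamma β) * (C * (t ^ (-((l : ℝ) - α)) * (1 + σ) ^ (-((l : ℝ) - α))))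
      = (t ^ ((l : ℝ) - (α + β)) * t * t ^ (β - 1) * t ^ (-((l : ℝ) - α))) *
        (C / Real.Gamma β * (σ ^ (β - 1) * (1 + σ) ^ (-((l : ℝ) - α)))) *
          Real.exp (-(t * σ)) := by ring
    _ ≤ C / Real.Gamma β * (σ ^ (β - 1) * (1 + σ) ^ (-((l : ℝ) - α))) := by
        rw [hpow, one_mul]
        exact mul_le_of_le_one_right (by positivity) hexp

/-- Hardy's inequality applied to the derivatives of `P_t (I + √(-L))^{-β} f`. -/
theorem exists_lintegral_wd_bop_le {β : ℝ} (hβ : 0 < β) {k l : ℕ} (hkl : k ≤ l) {α : ℝ}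
    (hl : α + β < l) {q : ℝ} (hq : 1 ≤ q) : ∃ C : ℝ≥0∞, C ≠ ∞ ∧
    ∀ f : EuclideanSpace ℝ (Fin d) → ℝ, Measurable f → ∀ x, IsGood f x →
      ∫⁻ t, wd l (α + β) (bop β f) (t, x) ^ q ∂logMeasure ≤
        C * ∫⁻ t, mix (pois (t / 2)) (fun y => wd k α f (t, y)) x ^ q ∂logMeasure := by
  obtain ⟨C, hC, hb⟩ := exists_wd_bop_le (d := d) hβ hkl α
  have hq0 : 0 ≤ q := by linarith
  have hW := betaLaw_univ_ne_top hβ (by linarith : β < (l : ℝ) - α)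
  set W := betaLaw β ((l : ℝ) - α) univ with hWdef
  refine ⟨C ^ q * (W ^ (q - 1) * W), ENNReal.mul_ne_top (ENNReal.rpow_ne_top_of_nonneg hq0 hC)
    (ENNReal.mul_ne_top (ENNReal.rpow_ne_top_of_nonneg (by linarith) hW) hW),
    fun f hf x hx => ?_⟩
  let h : ℝ → ℝ≥0∞ := fun t => mix (pois (t / 2)) (fun y => wd k α f (t, y)) x
  have hh : Measurable h := by
    have h1 := (measurable_mix_pois_param (θ := fun t : ℝ => t / 2) (by fun_prop)
      (measurable_wd k α hf)).comp (measurable_prodMk_right (y := x))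
    exact h1
  calc ∫⁻ t, wd l (α + β) (bop β f) (t, x) ^ q ∂logMeasure
      ≤ ∫⁻ t, C ^ q * (∫⁻ σ, h ((1 + σ) / 2 * t) ∂(betaLaw β ((l : ℝ) - α))) ^ q
          ∂logMeasure := by
        refine lintegral_mono_ae (ae_logMeasure_pos.mono fun t ht => ?_)
        rw [← ENNReal.mul_rpow_of_nonneg _ _ hq0]
        exact ENNReal.rpow_le_rpow (hb f hf x hx t ht) hq0
    _ = C ^ q * ∫⁻ t, (∫⁻ σ, h ((1 + σ) / 2 * t) ∂(betaLaw β ((l : ℝ) - α))) ^ q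
          ∂logMeasure := lintegral_const_mul' _ _ (ENNReal.rpow_ne_top_of_nonneg hq0 hC)
    _ ≤ C ^ q * (W ^ (q - 1) * W * ∫⁻ t, h t ^ q ∂logMeasure) := by
        gcongr
        exact lintegral_dilation_rpow_le _ (c := fun σ => (1 + σ) / 2) (by fun_prop)
          ((ae_betaLaw_pos _ _).mono fun σ hσ => by positivity) hh hq
    _ = C ^ q * (W ^ (q - 1) * W) * ∫⁻ t, h t ^ q ∂logMeasure := by ring

/-- The averages `P_{t/2}`, indexed by all real `t` with an arbitrary value for `t ≤ 0`. -/
theorem isMixFamily_pois (d : ℕ) :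
    IsMixFamily d (fun t : ℝ => pois ((if 0 < t then t else 1) / 2)) poisConst := by
  have hpos : ∀ t : ℝ, 0 < (if 0 < t then t else 1) / 2 := fun t => by
    split_ifs <;> positivity
  exact
    { prob := fun t => isProbabilityMeasure_pois (hpos t)
      nonneg := fun t => (ae_pois_pos _).mono fun r hr => hr.le
      measurable := fun G hG => measurable_mix_pois_param
        ((Measurable.ite measurableSet_Ioi measurable_id measurable_const).div_const 2) hG
      le_maxFun := fun t F hF x => mix_pois_le_maxFun (hpos t) hF x
      ne_top := poisConst_ne_top }

variable {p : ℝ≥0∞} [Fact (1 ≤ p)]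

theorem eLpNorm_triebelFun (hp : p ≠ ∞) {α q : ℝ} (hq : 1 ≤ q) (f : Lp ℝ p (gaussian d)) :
    eLpNorm (triebelFun α q f) p (gaussian d) =
      (∫⁻ x, (∫⁻ t, wd (⌊α⌋₊ + 1) α f (t, x) ^ q ∂logMeasure) ^ (p.toReal / q)
        ∂(gaussian d)) ^ (1 / p.toReal) := by
  have hp0 : p ≠ 0 := (lt_of_lt_of_le one_pos (Fact.out : 1 ≤ p)).ne'
  have hf := (Lp.stronglyMeasurable f).measurable
  rw [eLpNorm_eq_lintegral_rpow_enorm_toReal hp0 hp]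
  congr 1
  refine lintegral_congr_ae ?_
  filter_upwards [ae_isGood hf (lintegral_enorm_ne_top f)] with x hx
  rw [triebelFun_eq hq hf hx, enorm_eq_self, ← ENNReal.rpow_mul]
  congr 1
  ring

theorem exists_eLpNorm_triebelFun_besselOp_le (hp1 : 1 < p) (hp : p ≠ ∞) {β : ℝ} (hβ : 0 < β)
    {α q : ℝ} (hq : 1 ≤ q) : ∃ C : ℝ≥0∞, C ≠ ∞ ∧ ∀ f : Lp ℝ p (gaussian d),
      eLpNorm (triebelFun (α + β) q (besselOp hp hβ f)) p (gaussian d) ≤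
        C * eLpNorm (triebelFun α q f) p (gaussian d) := by
  have hpr : 1 < p.toReal := by
    rw [← ENNReal.toReal_one]
    exact (ENNReal.toReal_lt_toReal ENNReal.one_ne_top hp).2 hp1
  have hpq : 0 ≤ p.toReal / q := div_nonneg (by linarith) (by linarith)
  have hkl : ⌊α⌋₊ + 1 ≤ ⌊α + β⌋₊ + 1 := by
    have := Nat.floor_mono (by linarith : α ≤ α + β)
    omega
  have hl : α + β < ((⌊α + β⌋₊ + 1 : ℕ) : ℝ) := by
    push_cast
    exact Nat.lt_floor_add_one _
  obtain ⟨C, hC, hb⟩ := exists_lintegral_wd_bop_le (d := d) hβ hkl hl hq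
  obtain ⟨K, hK, hv⟩ := (isMixFamily_pois d).exists_vectorValued logMeasure hpr hq
  refine ⟨(C ^ (p.toReal / q) * K) ^ (1 / p.toReal), ENNReal.rpow_ne_top_of_nonneg (by positivity)
    (ENNReal.mul_ne_top (ENNReal.rpow_ne_top_of_nonneg hpq hC) hK), fun f => ?_⟩
  have hf := (Lp.stronglyMeasurable f).measurable
  have hJ := (Lp.stronglyMeasurable (besselOp hp hβ f)).measurable
  rw [eLpNorm_triebelFun hp hq, eLpNorm_triebelFun hp hq,
    ← ENNReal.mul_rpow_of_nonneg _ _ (by positivity)]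
  refine ENNReal.rpow_le_rpow ?_ (by positivity)
  calc ∫⁻ x, (∫⁻ t, wd (⌊α + β⌋₊ + 1) (α + β) (besselOp hp hβ f) (t, x) ^ q ∂logMeasure) ^
        (p.toReal / q) ∂(gaussian d)
      ≤ ∫⁻ x, C ^ (p.toReal / q) * (∫⁻ t, mix (pois ((if 0 < t then t else 1) / 2))
          (fun y => wd (⌊α⌋₊ + 1) α f (t, y)) x ^ q ∂logMeasure) ^ (p.toReal / q)
          ∂(gaussian d) := by
        refine lintegral_mono_ae ?_
        filter_upwards [ae_isGood hf (lintegral_enorm_ne_top f),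
          ae_dP_congr hJ (measurable_bop β hf) (coeFn_besselOp hp hβ f)] with x hx hxJ
        rw [← ENNReal.mul_rpow_of_nonneg _ _ hpq]
        refine ENNReal.rpow_le_rpow ?_ hpq
        have h1 : ∫⁻ t, mix (pois ((if 0 < t then t else 1) / 2))
            (fun y => wd (⌊α⌋₊ + 1) α f (t, y)) x ^ q ∂logMeasure =
            ∫⁻ t, mix (pois (t / 2)) (fun y => wd (⌊α⌋₊ + 1) α f (t, y)) x ^ q ∂logMeasure :=
          lintegral_congr_ae (ae_logMeasure_pos.mono fun t ht => by
            dsimp only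
            rw [if_pos ht])
        rw [h1]
        refine le_of_eq_of_le (lintegral_congr fun t => ?_) (hb f hf x hx)
        simp only [wd]
        rw [hxJ.2]
    _ = C ^ (p.toReal / q) * ∫⁻ x, (∫⁻ t, mix (pois ((if 0 < t then t else 1) / 2))
          (fun y => wd (⌊α⌋₊ + 1) α f (t, y)) x ^ q ∂logMeasure) ^ (p.toReal / q)
          ∂(gaussian d) :=
        lintegral_const_mul' _ _ (ENNReal.rpow_ne_top_of_nonneg hpq hC)
    _ ≤ C ^ (p.toReal / q) * (K * ∫⁻ x, (∫⁻ t, wd (⌊α⌋₊ + 1) α f (t, x) ^ q ∂logMeasure) ^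
          (p.toReal / q) ∂(gaussian d)) := by
        gcongr
        exact hv (wd (⌊α⌋₊ + 1) α f) (measurable_wd _ α hf)
    _ = C ^ (p.toReal / q) * K * ∫⁻ x, (∫⁻ t, wd (⌊α⌋₊ + 1) α f (t, x) ^ q ∂logMeasure) ^
          (p.toReal / q) ∂(gaussian d) := by ring

end

end GaussTL

end

theorem mainTheorem2 (d : ℕ) (p : ℝ≥0∞) [Fact (1 ≤ p)] (hp1 : 1 < p) (hp : p ≠ ∞)
    (β : ℝ) (hβ : 0 < β) :
    ∃ J : Lp ℝ p (GaussTL.gaussian d) →L[ℝ] Lp ℝ p (GaussTL.gaussian d),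
      GaussTL.IsBesselPotential hp β J ∧
      (∀ J' : Lp ℝ p (GaussTL.gaussian d) →L[ℝ] Lp ℝ p (GaussTL.gaussian d),
        GaussTL.IsBesselPotential hp β J' → J' = J) ∧
      ∀ α q : ℝ, 0 ≤ α → 1 ≤ q →
        ∃ C : ℝ≥0, ∀ f ∈ GaussTL.triebelLizorkin d α p q,
          J f ∈ GaussTL.triebelLizorkin d (α + β) p q ∧
          GaussTL.triebelNorm (α + β) p q (J f) ≤ C * GaussTL.triebelNorm α p q f := by
  have hJ := GaussTL.isBesselPotential_besselOp (d := d) hp hβ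
  refine ⟨GaussTL.besselOp hp hβ, hJ, fun J' hJ' =>
    GaussTL.eq_of_forall_hermiteLp hp fun ν => (hJ' ν).trans (hJ ν).symm,
    fun α q _ hq => ?_⟩
  obtain ⟨C, hC, hb⟩ :=
    GaussTL.exists_eLpNorm_triebelFun_besselOp_le (d := d) hp1 hp hβ (α := α) hq
  refine ⟨(1 + C).toNNReal, fun f hf => ⟨(hb f).trans_lt
    (ENNReal.mul_lt_top (lt_top_iff_ne_top.2 hC) hf), ?_⟩⟩
  rw [ENNReal.coe_toNNReal (ENNReal.add_ne_top.2 ⟨ENNReal.one_ne_top, hC⟩)]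
  have h1 : eLpNorm (GaussTL.besselOp hp hβ f) p (GaussTL.gaussian d) ≤
      eLpNorm f p (GaussTL.gaussian d) :=
    (eLpNorm_congr_ae (GaussTL.coeFn_besselOp hp hβ f)).trans_le
      (GaussTL.eLpNorm_bop_le hp hβ (Lp.stronglyMeasurable f).measurable)
  simp only [GaussTL.triebelNorm, mul_add]
  refine add_le_add (h1.trans ?_) ((hb f).trans ?_)
  · exact le_mul_of_one_le_left' le_self_add
  · exact mul_le_mul_left le_add_self _
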